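/- Let $\alpha>0$. Let $\mathcal M(\mathbb R^2)$ be the space of finite signed Radon measures on $\mathbb R^2$, and let $\mathcal G$ be the group of homeomorphisms of $\mathbb R^2$ that preserve Lebesgue measure. Let $$G^\alpha(x)=\frac1{2\pi}\Bigl(K_0\bigl(|x|/\alpha\bigr)+\ln|x|\Bigr),\qquad K^\alpha(x)=\nabla^\perp G^\alpha(x)=(-\partial_2G^\alpha,\partial_1G^\alpha)(x)\quad(x\neq0),\qquad K^\alpha(0)=0,$$ where $K_0(r)=\int_0^\infty e^{-r\cosh s}\,ds$ is the modified Bessel function of the second kind of order zero. For $q_0\in\mathcal M(\mathbb R^2)$, a global weak solution of $$\partial_t q+u\cdot\operatorname{grad}q=0,\qquad u=K^\alpha*q,\qquad q(0)=q_0$$ is a triple $(\eta,u,q)$ of maps $\eta,u:\mathbb R\times\mathbb R^2\to\mathbb R^2$ and $q:\mathbb R\to\mathcal M(\mathbb R^2)$ such that: $t\mapsto\int f\,dq(t)$ is continuous for every continuous $f$ vanishing at infinity; $q(0)=q_0$; $u(x,t)=\int K^\alpha(x-y)\,dq(t)(y)$ for all $x,t$; $$\int_{\mathbb R}\int_{\mathbb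 R^2}\bigl(\partial_t\phi+u\cdot\operatorname{grad}\phi\bigr)\,dq(t)\,dt=0\qquad\text{for all }\phi\in C_c^\infty(\mathbb R\times\mathbb R^2);$$ and $\eta$ is a flow map of $u$: $\eta(x,0)=x$ and $\partial_t\eta(x,t)=u(\eta(x,t),t)$ for all $x,t$. Then for every $q_0\in\mathcal M(\mathbb R^2)$ there exists exactly one global weak solution $(\eta^\alpha,u^\alpha,q)$. Moreover: 1. $\eta^\alpha\in C^1(\mathbb R;\mathcal G)$: each $\eta^\alpha(\cdot,t)$ lies in $\mathcal G$, and $t\mapsto\eta^\alpha(\cdot,t)-\eta^\alpha(\cdot,0)$ is a $C^1$ curve in the Banach space of bounded continuous vector fields with the supremum norm. 2. $u^\alpha\in C^0(\mathbb R;C^0_{\mathrm{div}}(\mathbb R^2,\mathbb R^2))$: each $u^\alpha(\cdot,t)$ is bounded, continuous and divergence-free in the sense of distributions, and $t\mapsto u^\alpha(\cdot,t)$ is continuous in the supremum norm. 3. $q\in C^0(\mathbb R;\mathcal M(\mathbb R^2))$ with respect to weak convergence of measures: $t\mapsto\int f\,dq(t)$ is continuous for every bounded continuous $f$. 4. The co-Adjoint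 action is conserved: $\operatorname{Ad}^*_{\eta^\alpha(\cdot,t)}(q(t))=q_0$ for all $t\in\mathbb R$, where $\operatorname{Ad}^*_\eta(q)=q\circ\eta$, i.e. $(q\circ\eta)(A)=q(\eta(A))$ for Borel sets $A$. 5. The weak co-adjoint action is conserved: $\operatorname{w-ad}^*_{u^\alpha}(q)=0$, where $\operatorname{w-ad}^*_u(q)$ is the distribution $\phi\mapsto\int_{\mathbb R}\int_{\mathbb R^2}(\partial_t\phi+u\cdot\operatorname{grad}\phi)\,dq(t)\,dt$, $\phi\in C_c^\infty(\mathbb R\times\mathbb R^2)$. -/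

import Mathlib

open MeasureTheory Set Filter Topology
open scoped ContDiff BoundedContinuousFunction ZeroAtInfty

noncomputable section

namespace EulerAlpha

/-- The Euclidean plane. -/
abbrev Plane : Type := EuclideanSpace ℝ (Fin 2)

/-- The space of (finite, signed) Radon measures on the plane. Every finite signed Borel measure
on the plane is regular, so no further condition is needed. -/
abbrev RadonMeasure : Type := SignedMeasure Plane

/-- The group of homeomorphisms of the plane that preserve Lebesgue measure. -/
abbrev MeasurePreservingHomeo : Type :=
  {η : Plane ≃ₜ Plane // MeasurePreserving η (volume : Measure Plane) volume}

/-- The modified Bessel function of the second kind of order zero, at `r > 0`. -/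
def besselK0 (r : ℝ) : ℝ := ∫ s in Ioi (0 : ℝ), Real.exp (-(r * Real.cosh s))

/-- The Green's function `(K₀(|x|/α) + ln |x|) / (2π)` of `(1 - α² Δ) Δ`, for `x ≠ 0`. -/
def greenFunction (α : ℝ) (x : Plane) : ℝ :=
  (besselK0 (‖x‖ / α) + Real.log ‖x‖) / (2 * Real.pi)

/-- The perpendicular gradient `∇^⊥ f = (-∂₂ f, ∂₁ f)`. -/
def perpGradient (f : Plane → ℝ) (x : Plane) : Plane :=
  !₂[-(gradient f x 1), gradient f x 0]

/-- The blob kernel `K^α = ∇^⊥ G^α` as a function of the difference of its two arguments,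
extended by continuity by the value `0` at the origin. -/
def blobKernel (α : ℝ) (x : Plane) : Plane :=
  if x = 0 then 0 else perpGradient (greenFunction α) x

/-- The convolution `K^α * q` of the blob kernel with a measure. -/
def blobVelocity (α : ℝ) (q : RadonMeasure) (x : Plane) : Plane :=
  ∫ᵛ y, blobKernel α (x - y) ∂<•q

/-- Smooth compactly supported real functions. -/
def IsTestFunction {F : Type*} [NormedAddCommGroup F] [NormedSpace ℝ F] (φ : F → ℝ) : Prop :=
  ContDiff ℝ ∞ φ ∧ HasCompactSupport φ

/-- A vector field is divergence-free in the sense of distributions. -/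
def IsDivergenceFree (v : Plane → Plane) : Prop :=
  ∀ φ : Plane → ℝ, IsTestFunction φ → ∫ x, fderiv ℝ φ x (v x) = 0

/-- The co-Adjoint action `Ad*_η(q) = q ∘ η`, that is, `(q ∘ η)(A) = q(η(A))`. -/
def coAdjoint (η : MeasurePreservingHomeo) (q : RadonMeasure) : RadonMeasure :=
  VectorMeasure.map q η.1.symm

/-- The weak co-adjoint action `w-ad*_u(q)`, the distribution on space-time
`φ ↦ ∫_ℝ ∫_{ℝ²} (∂ₜφ + u · grad φ) dq(t) dt`. -/
def weakCoadjoint (u : ℝ → Plane → Plane) (q : ℝ → RadonMeasure) (φ : ℝ × Plane → ℝ) : ℝ :=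
  ∫ t : ℝ, ∫ᵛ x, fderiv ℝ φ (t, x) (1, u t x) ∂<•(q t)

/-- `(η, u, q)` is a global weak solution, with initial datum `q₀`, of
`∂ₜ q + u · grad q = 0`, `u = K^α * q`, where `η` is the flow map of `u`.
Only weak-* continuity of `q` (as a curve in the dual of `C₀(ℝ²)`) is required, and `η` is only
required to solve the flow equation for every single particle. -/
structure IsWeakSolution (α : ℝ) (q₀ : RadonMeasure)
    (η : ℝ → Plane → Plane) (u : ℝ → Plane → Plane) (q : ℝ → RadonMeasure) : Prop where
  continuous_weakStar : ∀ f : C₀(Plane, ℝ), Continuous fun t => ∫ᵛ x, f x ∂<•(q t)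
  initial : q 0 = q₀
  velocity : ∀ t x, u t x = blobVelocity α (q t) x
  transport : ∀ φ : ℝ × Plane → ℝ, IsTestFunction φ → weakCoadjoint u q φ = 0
  flow_initial : ∀ x, η 0 x = x
  flow : ∀ t x, HasDerivAt (fun s => η s x) (u t (η t x)) t

/-- `η` is a `C¹` curve in the group of measure-preserving homeomorphisms, with respect to uniform
convergence on the plane: the displacement `η(t) - η(0)` is a `C¹` curve in the Banach space of
bounded continuous vector fields with the supremum norm. -/
def IsC1Curve (η : ℝ → MeasurePreservingHomeo) : Prop :=
  ∃ w : ℝ → (Plane →ᵇ Plane), ContDiff ℝ 1 w ∧ ∀ t x, (η t).1 x = (η 0).1 x + w t x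

/-- `q` is a continuous curve of measures with respect to weak convergence of measures, tested
against all bounded continuous functions. -/
def IsWeaklyContinuous (q : ℝ → RadonMeasure) : Prop :=
  ∀ f : Plane →ᵇ ℝ, Continuous fun t => ∫ᵛ x, f x ∂<•(q t)

end EulerAlpha

end

open EulerAlpha

/-!
The blob kernel circulates around the origin, with a radial profile whose singularity is
logarithmic. It is therefore the uniform limit of divergence-free Lipschitz kernels, and the
Lipschitz constants grow like `log (1 / ε)` in the error `ε`. This *Osgood* condition passes to the
velocity `u` of every weak-* continuous curve of measures. The barrier solving `B' = B (1 - log B)`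
then yields existence, uniqueness and stability of integral curves, and the flow of `u` preserves
volume because it is a locally uniform limit of volume-preserving Lipschitz flows.

For existence, the measure at time `t` is sought as the image of `q₀` under `x ↦ x + w(t, x)`. The
equation for the displacement `w` is an ordinary differential equation in the Banach space of
bounded continuous vector fields, whose right-hand side again satisfies the Osgood condition.

For uniqueness, let `q` be a weak solution with velocity `u` and flow `η`. It suffices that `q(t)`
is the image of `q₀` under `η(t)`, since then the displacement of `η` solves the same differential
equation. As `q(t)` is only a measure and `u` is not Lipschitz, one differentiates
`∫ φ(x) (g_r * q(t))(η(t, x)) dx` for a mollifier `g_r`. The result is a commutator, which is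
bounded by `κ(r) (1 - log r)`, where `κ` is the modulus of continuity of `φ ∘ η(t)⁻¹`. Because the
flow is Hölder continuous locally in time, this tends to zero with `r`.
-/

noncomputable section

open scoped NNReal

namespace EulerAlpha

/-! ### Modified Bessel functions -/

/-- The Laplace-type integral `(-1)ⁿ K₀⁽ⁿ⁾(r)`; `n = 0` and `n = 1` are the modified Bessel
functions `K₀` and `K₁`. -/
def besselMoment (n : ℕ) (r : ℝ) : ℝ :=
  ∫ s in Ioi (0 : ℝ), Real.cosh s ^ n * Real.exp (-(r * Real.cosh s))

theorem besselMoment_zero : besselMoment 0 = besselK0 := by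
  funext r
  simp only [besselMoment, besselK0, pow_zero, one_mul]

theorem besselMoment_nonneg (n : ℕ) (r : ℝ) : 0 ≤ besselMoment n r :=
  integral_nonneg fun _ => by positivity

theorem tendsto_sinh_atTop : Tendsto Real.sinh atTop atTop :=
  tendsto_atTop_mono' _ ((eventually_ge_atTop 0).mono fun _ => Real.self_le_sinh_iff.2) tendsto_id

theorem tendsto_cosh_atTop : Tendsto Real.cosh atTop atTop :=
  tendsto_atTop_mono (fun s => (Real.sinh_lt_cosh s).le) tendsto_sinh_atTop

section LaplaceIntegral

variable {φ φ' : ℝ → ℝ} {r : ℝ}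

theorem hasDerivAt_neg_exp_neg_mul_div (hr : r ≠ 0) {s : ℝ} (hφ : HasDerivAt φ (φ' s) s) :
    HasDerivAt (fun s => -(Real.exp (-(r * φ s)) / r)) (φ' s * Real.exp (-(r * φ s))) s := by
  refine ((hφ.const_mul r).fun_neg.exp.div_const r).fun_neg.congr_deriv ?_
  field_simp

theorem tendsto_neg_exp_neg_mul_div (hr : 0 < r) (hφ : Tendsto φ atTop atTop) :
    Tendsto (fun s => -(Real.exp (-(r * φ s)) / r)) atTop (𝓝 0) := by
  simpa using ((Real.tendsto_exp_neg_atTop_nhds_zero.comp (hφ.const_mul_atTop hr)).div_const r).neg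

theorem integrableOn_deriv_mul_exp_neg_mul (hr : 0 < r) (hφ : ∀ s, HasDerivAt φ (φ' s) s)
    (hφ' : ∀ s > 0, 0 ≤ φ' s) (hlim : Tendsto φ atTop atTop) :
    IntegrableOn (fun s => φ' s * Real.exp (-(r * φ s))) (Ioi 0) :=
  integrableOn_Ioi_deriv_of_nonneg' (fun s _ => hasDerivAt_neg_exp_neg_mul_div hr.ne' (hφ s))
    (fun s hs => mul_nonneg (hφ' s hs) (Real.exp_pos _).le) (tendsto_neg_exp_neg_mul_div hr hlim)

theorem integral_deriv_mul_exp_neg_mul (hr : 0 < r) (hφ : ∀ s, HasDerivAt φ (φ' s) s)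
    (hφ' : ∀ s > 0, 0 ≤ φ' s) (hlim : Tendsto φ atTop atTop) :
    ∫ s in Ioi (0 : ℝ), φ' s * Real.exp (-(r * φ s)) = Real.exp (-(r * φ 0)) / r := by
  rw [integral_Ioi_of_hasDerivAt_of_nonneg'
    (fun s _ => hasDerivAt_neg_exp_neg_mul_div hr.ne' (hφ s))
    (fun s hs => mul_nonneg (hφ' s hs) (Real.exp_pos _).le) (tendsto_neg_exp_neg_mul_div hr hlim)]
  ring

end LaplaceIntegral

section BesselMoment

variable {r : ℝ}

theorem integrableOn_cosh_mul_exp_neg_mul_sinh (hr : 0 < r) :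
    IntegrableOn (fun s => Real.cosh s * Real.exp (-(r * Real.sinh s))) (Ioi 0) :=
  integrableOn_deriv_mul_exp_neg_mul hr Real.hasDerivAt_sinh (fun s _ => (Real.cosh_pos s).le)
    tendsto_sinh_atTop

theorem exp_neg_mul_cosh_le (hr : 0 < r) (s : ℝ) :
    Real.exp (-(r * Real.cosh s)) ≤ Real.cosh s * Real.exp (-(r * Real.sinh s)) := by
  have h : Real.exp (-(r * Real.cosh s)) ≤ Real.exp (-(r * Real.sinh s)) := by
    gcongr
    exact (Real.sinh_lt_cosh s).le
  exact h.trans (le_mul_of_one_le_left (Real.exp_pos _).le (Real.one_le_cosh s))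

theorem pow_mul_exp_neg_mul_le (n : ℕ) (hr : 0 < r) {c : ℝ} (hc : 0 ≤ c) :
    c ^ n * Real.exp (-(r * c)) ≤ n.factorial / (r / 2) ^ n * Real.exp (-(r / 2 * c)) := by
  have h := Real.pow_div_factorial_le_exp (r / 2 * c) (by positivity) n
  have hsplit : Real.exp (-(r * c)) = Real.exp (-(r / 2 * c)) * Real.exp (-(r / 2 * c)) := by
    rw [← Real.exp_add]
    ring_nf
  rw [hsplit, ← mul_assoc]
  refine mul_le_mul_of_nonneg_right ?_ (Real.exp_pos _).le
  rw [mul_pow, div_le_iff₀ (by positivity)] at h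
  rw [Real.exp_neg, ← div_eq_mul_inv, div_le_div_iff₀ (Real.exp_pos _) (by positivity)]
  linarith

theorem integrableOn_cosh_pow_mul_exp (n : ℕ) (hr : 0 < r) :
    IntegrableOn (fun s => Real.cosh s ^ n * Real.exp (-(r * Real.cosh s))) (Ioi 0) := by
  refine ((integrableOn_cosh_mul_exp_neg_mul_sinh (half_pos hr)).const_mul
    (n.factorial / (r / 2) ^ n)).mono' (by fun_prop) (Eventually.of_forall fun s => ?_)
  rw [Real.norm_of_nonneg (by positivity)]
  refine (pow_mul_exp_neg_mul_le n hr (Real.cosh_pos s).le).trans ?_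
  gcongr
  exact exp_neg_mul_cosh_le (half_pos hr) s

theorem hasDerivAt_besselMoment (n : ℕ) (hr : 0 < r) :
    HasDerivAt (besselMoment n) (-besselMoment (n + 1) r) r := by
  have h := hasDerivAt_integral_of_dominated_loc_of_deriv_le
    (μ := volume.restrict (Ioi (0 : ℝ))) (x₀ := r) (s := Ioi (r / 2))
    (F := fun r s => Real.cosh s ^ n * Real.exp (-(r * Real.cosh s)))
    (F' := fun r s => -(Real.cosh s ^ (n + 1) * Real.exp (-(r * Real.cosh s))))
    (bound := fun s => Real.cosh s ^ (n + 1) * Real.exp (-(r / 2 * Real.cosh s)))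
    (Ioi_mem_nhds (by linarith)) (Eventually.of_forall fun x => by fun_prop)
    (integrableOn_cosh_pow_mul_exp n hr) (by fun_prop)
    (Eventually.of_forall fun s x hx => by
      rw [norm_neg, Real.norm_of_nonneg (by positivity)]
      gcongr
      exact (mem_Ioi.1 hx).le)
    (integrableOn_cosh_pow_mul_exp (n + 1) (half_pos hr))
    (Eventually.of_forall fun s x _ =>
      (((hasDerivAt_id' x).mul_const (Real.cosh s)).fun_neg.exp.const_mul _).congr_deriv (by ring))
  refine h.2.congr_deriv ?_
  rw [besselMoment, integral_neg]

theorem tendsto_sinh_mul_exp_neg_mul_cosh (hr : 0 < r) :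
    Tendsto (fun s => Real.sinh s * Real.exp (-(r * Real.cosh s))) atTop (𝓝 0) := by
  have hlim : Tendsto (fun s => Real.exp (-(r / 2 * Real.cosh s))) atTop (𝓝 0) :=
    Real.tendsto_exp_neg_atTop_nhds_zero.comp (tendsto_cosh_atTop.const_mul_atTop (half_pos hr))
  refine squeeze_zero' ?_ (Eventually.of_forall fun s => ?_)
    (by simpa using hlim.const_mul ((Nat.factorial 1 : ℝ) / (r / 2) ^ 1))
  · filter_upwards [eventually_ge_atTop 0] with s hs
    exact mul_nonneg (Real.sinh_nonneg_iff.2 hs) (Real.exp_pos _).le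
  · have h := pow_mul_exp_neg_mul_le 1 hr (Real.cosh_pos s).le
    simp only [pow_one, Nat.factorial_one, Nat.cast_one] at h ⊢
    refine le_trans ?_ h
    gcongr
    exact (Real.sinh_lt_cosh s).le

/-- Integrate the derivative of `sinh s * exp (-r cosh s)`. -/
theorem mul_besselMoment_two (hr : 0 < r) :
    r * besselMoment 2 r = r * besselMoment 0 r + besselMoment 1 r := by
  have hint (n : ℕ) := integrableOn_cosh_pow_mul_exp n hr
  have hderiv (s : ℝ) : HasDerivAt (fun s => Real.sinh s * Real.exp (-(r * Real.cosh s)))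
      (Real.cosh s ^ 1 * Real.exp (-(r * Real.cosh s)) -
        r * (Real.cosh s ^ 2 * Real.exp (-(r * Real.cosh s))) +
        r * (Real.cosh s ^ 0 * Real.exp (-(r * Real.cosh s)))) s := by
    refine ((Real.hasDerivAt_sinh s).fun_mul
      ((Real.hasDerivAt_cosh s).const_mul r).fun_neg.exp).congr_deriv ?_
    linear_combination (r * Real.exp (-(r * Real.cosh s))) * Real.cosh_sq s
  have h := integral_Ioi_of_hasDerivAt_of_tendsto' (fun s _ => hderiv s)
    (((hint 1).sub ((hint 2).const_mul r)).add ((hint 0).const_mul r))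
    (tendsto_sinh_mul_exp_neg_mul_cosh hr)
  rw [integral_add ((hint 1).fun_sub ((hint 2).const_mul r)) ((hint 0).const_mul r),
    integral_sub (hint 1) ((hint 2).const_mul r), integral_const_mul, integral_const_mul] at h
  simp only [Real.sinh_zero, zero_mul, sub_zero] at h
  unfold besselMoment
  linarith

theorem mul_besselMoment_one_le_one (hr : 0 < r) : r * besselMoment 1 r ≤ 1 := by
  rw [mul_comm, ← le_div_iff₀ hr]
  calc besselMoment 1 r
      ≤ ∫ s in Ioi (0 : ℝ), Real.cosh s * Real.exp (-(r * Real.sinh s)) := by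
        refine integral_mono (integrableOn_cosh_pow_mul_exp 1 hr)
          (integrableOn_cosh_mul_exp_neg_mul_sinh hr) fun s => ?_
        simp only [pow_one]
        gcongr
        exact (Real.sinh_lt_cosh s).le
    _ = 1 / r := by
        rw [integral_deriv_mul_exp_neg_mul hr Real.hasDerivAt_sinh
          (fun s _ => (Real.cosh_pos s).le) tendsto_sinh_atTop]
        simp only [Real.sinh_zero, mul_zero, neg_zero, Real.exp_zero]

theorem exp_neg_le_mul_besselMoment_one (hr : 0 < r) : Real.exp (-r) ≤ r * besselMoment 1 r := by
  have hsinh (s : ℝ) (hs : s > 0) : 0 ≤ Real.sinh s := Real.sinh_nonneg_iff.2 hs.le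
  rw [mul_comm, ← div_le_iff₀ hr]
  calc Real.exp (-r) / r
      = ∫ s in Ioi (0 : ℝ), Real.sinh s * Real.exp (-(r * Real.cosh s)) := by
        rw [integral_deriv_mul_exp_neg_mul hr Real.hasDerivAt_cosh hsinh tendsto_cosh_atTop,
          Real.cosh_zero, mul_one]
    _ ≤ besselMoment 1 r := by
        refine integral_mono
          (integrableOn_deriv_mul_exp_neg_mul hr Real.hasDerivAt_cosh hsinh tendsto_cosh_atTop)
          (integrableOn_cosh_pow_mul_exp 1 hr) fun s => ?_
        simp only [pow_one]
        gcongr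
        exact (Real.sinh_lt_cosh s).le

theorem besselMoment_le_besselMoment_succ (n : ℕ) (hr : 0 < r) :
    besselMoment n r ≤ besselMoment (n + 1) r := by
  refine integral_mono (integrableOn_cosh_pow_mul_exp n hr)
    (integrableOn_cosh_pow_mul_exp (n + 1) hr) fun s => ?_
  dsimp only
  gcongr
  · exact Real.one_le_cosh s
  · exact n.le_succ

end BesselMoment

/-! ### The radial profile of the blob kernel -/

/-- The circulation `1 - r K₁(r)`, around the circle of radius `r`, of the velocity induced by a
unit vortex blob with `α = 1`. -/
def blobCirculation (r : ℝ) : ℝ := 1 - r * besselMoment 1 r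

section BlobCirculation

variable {r : ℝ}

theorem hasDerivAt_blobCirculation (hr : 0 < r) :
    HasDerivAt blobCirculation (r * besselMoment 0 r) r := by
  refine (((hasDerivAt_id' r).fun_mul (hasDerivAt_besselMoment 1 hr)).const_sub 1).congr_deriv ?_
  linear_combination mul_besselMoment_two hr

theorem blobCirculation_nonneg (hr : 0 < r) : 0 ≤ blobCirculation r :=
  sub_nonneg.2 (mul_besselMoment_one_le_one hr)

theorem blobCirculation_le_one (hr : 0 < r) : blobCirculation r ≤ 1 :=
  sub_le_self _ (mul_nonneg hr.le (besselMoment_nonneg 1 r))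

theorem blobCirculation_le_self (hr : 0 < r) : blobCirculation r ≤ r := by
  unfold blobCirculation
  linarith [exp_neg_le_mul_besselMoment_one hr, Real.add_one_le_exp (-r)]

/-- Up to the factor `4πr⁴`, this is the derivative of `blobCirculation r / (2πr²)` with respect
to `r²`. -/
def blobShear (r : ℝ) : ℝ := r ^ 2 * besselMoment 0 r - 2 * blobCirculation r

theorem hasDerivAt_blobShear (hr : 0 < r) :
    HasDerivAt blobShear (-(r ^ 2 * besselMoment 1 r)) r := by
  refine (((hasDerivAt_pow 2 r).fun_mul (hasDerivAt_besselMoment 0 hr)).fun_sub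
    ((hasDerivAt_blobCirculation hr).const_mul 2)).congr_deriv ?_
  simp only [Nat.cast_ofNat]
  ring

theorem tendsto_blobShear : Tendsto blobShear (𝓝[>] 0) (𝓝 0) := by
  have hid : Tendsto (fun r : ℝ => r) (𝓝[>] 0) (𝓝 0) := tendsto_id.mono_left nhdsWithin_le_nhds
  have hsq : Tendsto (fun r => r ^ 2 * besselMoment 0 r) (𝓝[>] 0) (𝓝 0) := by
    refine squeeze_zero' (Eventually.of_forall fun r =>
      mul_nonneg (sq_nonneg _) (besselMoment_nonneg 0 r)) ?_ hid
    filter_upwards [self_mem_nhdsWithin] with r (hr : 0 < r)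
    nlinarith [mul_besselMoment_one_le_one hr, besselMoment_le_besselMoment_succ 0 hr]
  have hcirc : Tendsto blobCirculation (𝓝[>] 0) (𝓝 0) :=
    squeeze_zero' (eventually_nhdsWithin_of_forall fun r => blobCirculation_nonneg)
      (eventually_nhdsWithin_of_forall fun r => blobCirculation_le_self) hid
  unfold blobShear
  simpa using hsq.sub (hcirc.const_mul 2)

theorem monotoneOn_Ioi_of_hasDerivAt_nonneg {f f' : ℝ → ℝ} {a : ℝ}
    (hf : ∀ x > a, HasDerivAt f (f' x) x) (hf' : ∀ x > a, 0 ≤ f' x) : MonotoneOn f (Ioi a) :=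
  monotoneOn_of_hasDerivWithinAt_nonneg (convex_Ioi a)
    (fun x hx => (hf x hx).continuousAt.continuousWithinAt)
    (fun x hx => (hf x (interior_subset hx)).hasDerivWithinAt)
    (fun x hx => hf' x (interior_subset hx))

theorem nonneg_of_hasDerivAt_nonneg_of_tendsto {f f' : ℝ → ℝ} {a x : ℝ}
    (hf : ∀ x > a, HasDerivAt f (f' x) x) (hf' : ∀ x > a, 0 ≤ f' x)
    (hlim : Tendsto f (𝓝[>] a) (𝓝 0)) (hx : a < x) : 0 ≤ f x := by
  refine le_of_tendsto hlim ?_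
  filter_upwards [Ioo_mem_nhdsGT hx] with y hy
  exact monotoneOn_Ioi_of_hasDerivAt_nonneg hf hf' hy.1 hx hy.2.le

theorem blobShear_nonpos (hr : 0 < r) : blobShear r ≤ 0 := by
  refine neg_nonneg.1 (nonneg_of_hasDerivAt_nonneg_of_tendsto (f := fun x => -blobShear x)
    (fun x hx => (hasDerivAt_blobShear hx).fun_neg) (fun x _ => ?_)
    (by simpa using tendsto_blobShear.neg) hr)
  rw [neg_neg]
  exact mul_nonneg (sq_nonneg x) (besselMoment_nonneg 1 x)

theorem neg_sq_div_two_le_blobShear (hr : 0 < r) : -(r ^ 2 / 2) ≤ blobShear r := by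
  have hsq : Tendsto (fun r : ℝ => r ^ 2 / 2) (𝓝[>] 0) (𝓝 0) := by
    have h : Continuous fun r : ℝ => r ^ 2 / 2 := by fun_prop
    simpa using (h.tendsto 0).mono_left nhdsWithin_le_nhds
  have h := nonneg_of_hasDerivAt_nonneg_of_tendsto
    (fun x hx => (hasDerivAt_blobShear hx).fun_add ((hasDerivAt_pow 2 x).div_const 2))
    (fun x hx => ?_) (by simpa using tendsto_blobShear.add hsq) hr
  · linarith
  · have := mul_le_mul_of_nonneg_left (mul_besselMoment_one_le_one hx) (le_of_lt hx)
    simp only [Nat.cast_ofNat, Nat.add_one_sub_one, pow_one]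
    linarith

end BlobCirculation

/-! ### Swirling kernels with a logarithmic profile -/

/-- A radial profile `P` (as a function of the squared radius) with derivative `P'`, whose
singularity at the origin is at most logarithmic: this is what makes the kernel `P(|x|²) x^⊥`
log-Lipschitz. -/
structure IsLogProfile (P P' : ℝ → ℝ) (C : ℝ) : Prop where
  hasDerivAt : ∀ s > 0, HasDerivAt P (P' s) s
  deriv_nonpos : ∀ s > 0, P' s ≤ 0
  neg_div_le_deriv : ∀ s > 0, -(C / s) ≤ P' s
  nonneg : ∀ s > 0, 0 ≤ P s
  le_div : ∀ s > 0, P s ≤ C / s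
  sqrt_mul_le : ∀ s > 0, √s * P s ≤ C

/-- The rotation by a right angle `x ↦ x^⊥`. -/
def rot : Plane →L[ℝ] Plane :=
  LinearMap.toContinuousLinearMap
    { toFun := fun x => !₂[-(x 1), x 0]
      map_add' := fun x y => by ext i; fin_cases i <;> simp [add_comm]
      map_smul' := fun c x => by ext i; fin_cases i <;> simp }

@[simp] theorem rot_apply_zero (x : Plane) : rot x 0 = -(x 1) := rfl

@[simp] theorem rot_apply_one (x : Plane) : rot x 1 = x 0 := rfl

@[simp] theorem norm_rot (x : Plane) : ‖rot x‖ = ‖x‖ := by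
  simp [EuclideanSpace.norm_eq, Fin.sum_univ_two, add_comm]

theorem inner_rot_self (x : Plane) : inner ℝ x (rot x) = 0 := by
  simp only [PiLp.inner_apply, Fin.sum_univ_two, rot_apply_zero, rot_apply_one,
    RCLike.inner_apply, conj_trivial]
  ring

theorem trace_rot : LinearMap.trace ℝ Plane rot = 0 := by
  simp [LinearMap.trace_eq_sum_inner _ (EuclideanSpace.basisFun (Fin 2) ℝ), Fin.sum_univ_two,
    EuclideanSpace.inner_single_left]

/-- The vector field `P(|x|²) x^⊥`, circulating around the origin with radial profile `P`. -/
def swirlKernel (P : ℝ → ℝ) (x : Plane) : Plane := P (‖x‖ ^ 2) • rot x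

/-- The derivative of `swirlKernel P` at `x`, in terms of the derivative `P'` of the profile. -/
def swirlKernelDeriv (P P' : ℝ → ℝ) (x : Plane) : Plane →L[ℝ] Plane :=
  P (‖x‖ ^ 2) • rot + (P' (‖x‖ ^ 2) • (2 • innerSL ℝ x)).smulRight (rot x)

theorem hasFDerivAt_swirlKernel {P P' : ℝ → ℝ} {x : Plane}
    (hP : HasDerivAt P (P' (‖x‖ ^ 2)) (‖x‖ ^ 2)) :
    HasFDerivAt (swirlKernel P) (swirlKernelDeriv P P' x) x :=
  (hP.comp_hasFDerivAt x (hasStrictFDerivAt_norm_sq x).hasFDerivAt).smul rot.hasFDerivAt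

theorem trace_swirlKernelDeriv (P P' : ℝ → ℝ) (x : Plane) :
    LinearMap.trace ℝ Plane (swirlKernelDeriv P P' x) = 0 := by
  have hrank : LinearMap.trace ℝ Plane
      ((P' (‖x‖ ^ 2) • (2 • innerSL ℝ x)).smulRight (rot x) : Plane →L[ℝ] Plane) = 0 := by
    refine (LinearMap.trace_smulRight _ _).trans ?_
    simp [inner_rot_self]
  rw [swirlKernelDeriv, ContinuousLinearMap.toLinearMap_add, map_add, hrank,
    ContinuousLinearMap.toLinearMap_smul, map_smul, trace_rot, smul_zero, add_zero]

theorem norm_swirlKernelDeriv_le {P P' : ℝ → ℝ} {a b : ℝ} {x : Plane} (hP : |P (‖x‖ ^ 2)| ≤ a)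
    (hP' : ‖x‖ ^ 2 * |P' (‖x‖ ^ 2)| ≤ b) : ‖swirlKernelDeriv P P' x‖ ≤ a + 2 * b := by
  have ha : 0 ≤ a := (abs_nonneg _).trans hP
  have hb : 0 ≤ b := (mul_nonneg (sq_nonneg _) (abs_nonneg _)).trans hP'
  refine ContinuousLinearMap.opNorm_le_bound _ (by positivity) fun y => ?_
  have happly : swirlKernelDeriv P P' x y =
      P (‖x‖ ^ 2) • rot y + (P' (‖x‖ ^ 2) * (2 * inner ℝ x y)) • rot x := by
    simp [swirlKernelDeriv]
  calc ‖swirlKernelDeriv P P' x y‖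
      ≤ |P (‖x‖ ^ 2)| * ‖y‖ + |P' (‖x‖ ^ 2)| * (2 * |inner ℝ x y|) * ‖x‖ := by
        rw [happly]
        refine (norm_add_le _ _).trans_eq ?_
        simp only [norm_smul, norm_rot, norm_mul, Real.norm_eq_abs, abs_two]
    _ ≤ |P (‖x‖ ^ 2)| * ‖y‖ + |P' (‖x‖ ^ 2)| * (2 * (‖x‖ * ‖y‖)) * ‖x‖ := by
        gcongr; exact abs_real_inner_le_norm x y
    _ = (|P (‖x‖ ^ 2)| + 2 * (‖x‖ ^ 2 * |P' (‖x‖ ^ 2)|)) * ‖y‖ := by ring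
    _ ≤ (a + 2 * b) * ‖y‖ := by gcongr

theorem log_add_sq_sub_log_le {r ε : ℝ} (hr : 0 < r) (hε : 0 < ε) :
    Real.log (r ^ 2 + ε ^ 2) - Real.log (r ^ 2) ≤ 2 * (ε / r) := by
  have hsq : Real.log (r ^ 2 + ε ^ 2) ≤ 2 * Real.log (r + ε) := by
    rw [← Real.log_rpow (by positivity), Real.rpow_two]
    exact Real.log_le_log (by positivity) (by nlinarith [mul_pos hr hε])
  have hlin : Real.log (r + ε) - Real.log r ≤ ε / r := by
    rw [← Real.log_div (by positivity) hr.ne']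
    exact (Real.log_le_sub_one_of_pos (by positivity)).trans_eq (by field_simp; ring)
  rw [Real.log_pow, Nat.cast_ofNat]
  linarith

namespace IsLogProfile

variable {P P' : ℝ → ℝ} {C : ℝ} (h : IsLogProfile P P' C)
include h

theorem const_nonneg : 0 ≤ C :=
  (mul_nonneg (Real.sqrt_nonneg 1) (h.nonneg 1 one_pos)).trans (h.sqrt_mul_le 1 one_pos)

theorem antitoneOn : AntitoneOn P (Ioi 0) := by
  have := monotoneOn_Ioi_of_hasDerivAt_nonneg (fun s hs => (h.hasDerivAt s hs).fun_neg)
    fun s hs => neg_nonneg.2 (h.deriv_nonpos s hs)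
  exact fun s hs t ht hst => neg_le_neg_iff.1 (this hs ht hst)

theorem monotoneOn_add_log : MonotoneOn (fun s => P s + C * Real.log s) (Ioi 0) := by
  refine monotoneOn_Ioi_of_hasDerivAt_nonneg (fun s hs =>
    (h.hasDerivAt s hs).fun_add ((Real.hasDerivAt_log hs.ne').const_mul C)) fun s hs => ?_
  linarith [h.neg_div_le_deriv s hs, div_eq_mul_inv C s]

theorem le_one_sub_log {s : ℝ} (hs : 0 < s) (hs1 : s ≤ 1) : P s ≤ C * (1 - Real.log s) := by
  have hmono := h.monotoneOn_add_log (mem_Ioi.2 hs) (mem_Ioi.2 one_pos) hs1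
  have hone := h.le_div 1 one_pos
  simp only [Real.log_one, mul_zero, add_zero] at hmono
  linarith

theorem shift {δ : ℝ} (hδ : 0 ≤ δ) :
    IsLogProfile (fun s => P (s + δ)) (fun s => P' (s + δ)) C where
  hasDerivAt s hs := (h.hasDerivAt _ (by positivity)).comp_add_const s δ
  deriv_nonpos s hs := h.deriv_nonpos _ (by positivity)
  neg_div_le_deriv s hs := by
    refine le_trans (neg_le_neg ?_) (h.neg_div_le_deriv (s + δ) (by positivity))
    exact div_le_div_of_nonneg_left h.const_nonneg hs (by linarith)
  nonneg s hs := h.nonneg _ (by positivity)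
  le_div s hs := (h.le_div (s + δ) (by positivity)).trans
    (div_le_div_of_nonneg_left h.const_nonneg hs (by linarith))
  sqrt_mul_le s hs := by
    refine le_trans ?_ (h.sqrt_mul_le (s + δ) (by positivity))
    have := h.nonneg (s + δ) (by positivity)
    gcongr
    linarith

theorem norm_swirlKernel_le (x : Plane) : ‖swirlKernel P x‖ ≤ C := by
  rcases eq_or_ne x 0 with rfl | hx
  · simpa [swirlKernel] using h.const_nonneg
  have hr : 0 < ‖x‖ := norm_pos_iff.2 hx
  have hle := h.sqrt_mul_le (‖x‖ ^ 2) (by positivity)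
  rwa [Real.sqrt_sq hr.le, mul_comm, ← Real.norm_of_nonneg (h.nonneg (‖x‖ ^ 2) (by positivity)),
    ← norm_rot, ← norm_smul, norm_rot] at hle

theorem norm_swirlKernel_le_div {x : Plane} (hx : x ≠ 0) : ‖swirlKernel P x‖ ≤ C / ‖x‖ := by
  have : 0 < ‖x‖ := norm_pos_iff.2 hx
  have hr2 : 0 < ‖x‖ ^ 2 := by positivity
  rw [swirlKernel, norm_smul, norm_rot, Real.norm_of_nonneg (h.nonneg _ hr2)]
  calc P (‖x‖ ^ 2) * ‖x‖ ≤ C / ‖x‖ ^ 2 * ‖x‖ := by gcongr; exact h.le_div _ hr2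
    _ = C / ‖x‖ := by field_simp

theorem tendsto_swirlKernel : Tendsto (swirlKernel P) (cocompact Plane) (𝓝 0) := by
  refine squeeze_zero_norm' (a := fun x => C / ‖x‖) ?_
    (tendsto_const_nhds.div_atTop tendsto_norm_cocompact_atTop)
  filter_upwards [(isCompact_singleton (x := (0 : Plane))).compl_mem_cocompact] with x hx
    using h.norm_swirlKernel_le_div hx

theorem norm_swirlKernel_shift_sub_le {ε : ℝ} (hε : 0 < ε) (x : Plane) :
    ‖swirlKernel (fun s => P (s + ε ^ 2)) x - swirlKernel P x‖ ≤ 2 * C * ε := by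
  have hC := h.const_nonneg
  rcases eq_or_ne x 0 with rfl | hx
  · simp only [swirlKernel, map_zero, smul_zero, sub_zero, norm_zero]
    positivity
  have hr : 0 < ‖x‖ := norm_pos_iff.2 hx
  have hr2 : 0 < ‖x‖ ^ 2 := by positivity
  have hrε : 0 < ‖x‖ ^ 2 + ε ^ 2 := by positivity
  have hle : ‖x‖ ^ 2 ≤ ‖x‖ ^ 2 + ε ^ 2 := le_add_of_nonneg_right (sq_nonneg ε)
  have hmono : P (‖x‖ ^ 2) + C * Real.log (‖x‖ ^ 2) ≤
      P (‖x‖ ^ 2 + ε ^ 2) + C * Real.log (‖x‖ ^ 2 + ε ^ 2) :=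
    h.monotoneOn_add_log (mem_Ioi.2 hr2) (mem_Ioi.2 hrε) hle
  have hdrop : P (‖x‖ ^ 2) - P (‖x‖ ^ 2 + ε ^ 2) ≤ C * (2 * (ε / ‖x‖)) := by
    linarith [mul_le_mul_of_nonneg_left (log_add_sq_sub_log_le hr hε) hC]
  rw [swirlKernel, swirlKernel, ← sub_smul, norm_smul, norm_rot, Real.norm_eq_abs, abs_sub_comm,
    abs_of_nonneg (sub_nonneg.2 (h.antitoneOn (mem_Ioi.2 hr2) (mem_Ioi.2 hrε) hle))]
  calc _ ≤ C * (2 * (ε / ‖x‖)) * ‖x‖ := by gcongr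
    _ = 2 * C * ε := by field_simp

theorem hasFDerivAt_swirlKernel_shift {δ : ℝ} (hδ : 0 < δ) (x : Plane) :
    HasFDerivAt (swirlKernel fun s => P (s + δ))
      (swirlKernelDeriv (fun s => P (s + δ)) (fun s => P' (s + δ)) x) x :=
  hasFDerivAt_swirlKernel ((h.hasDerivAt _ (by positivity)).comp_add_const _ δ)

theorem norm_swirlKernelDeriv_shift_le {ε : ℝ} (hε : 0 < ε) (hε1 : ε ≤ 1) (x : Plane) :
    ‖swirlKernelDeriv (fun s => P (s + ε ^ 2)) (fun s => P' (s + ε ^ 2)) x‖ ≤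
      3 * C * (1 - Real.log ε) := by
  have hC := h.const_nonneg
  have hε2 : 0 < ε ^ 2 := by positivity
  have hrε : 0 < ‖x‖ ^ 2 + ε ^ 2 := by positivity
  have hP : |P (‖x‖ ^ 2 + ε ^ 2)| ≤ C * (1 - Real.log (ε ^ 2)) := by
    rw [abs_of_nonneg (h.nonneg _ hrε)]
    exact (h.antitoneOn (mem_Ioi.2 hε2) (mem_Ioi.2 hrε)
      (le_add_of_nonneg_left (sq_nonneg _))).trans
      (h.le_one_sub_log hε2 (pow_le_one₀ hε.le hε1))
  have hP' : ‖x‖ ^ 2 * |P' (‖x‖ ^ 2 + ε ^ 2)| ≤ C := by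
    rw [abs_of_nonpos (h.deriv_nonpos _ hrε)]
    calc ‖x‖ ^ 2 * -P' (‖x‖ ^ 2 + ε ^ 2)
        ≤ (‖x‖ ^ 2 + ε ^ 2) * (C / (‖x‖ ^ 2 + ε ^ 2)) := by
          refine mul_le_mul (by linarith) (neg_le.1 (h.neg_div_le_deriv _ hrε)) ?_ hrε.le
          exact neg_nonneg.2 (h.deriv_nonpos _ hrε)
      _ = C := by field_simp
  refine (norm_swirlKernelDeriv_le hP hP').trans ?_
  rw [Real.log_pow, Nat.cast_ofNat]
  linarith [mul_nonneg hC (neg_nonneg.2 (Real.log_nonpos hε.le hε1))]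

theorem norm_swirlKernel_shift_sub_self_le {ε : ℝ} (hε : 0 < ε) (hε1 : ε ≤ 1) (x y : Plane) :
    ‖swirlKernel (fun s => P (s + ε ^ 2)) x - swirlKernel (fun s => P (s + ε ^ 2)) y‖ ≤
      3 * C * (1 - Real.log ε) * ‖x - y‖ :=
  convex_univ.norm_image_sub_le_of_norm_hasFDerivWithin_le
    (fun z _ => (h.hasFDerivAt_swirlKernel_shift (by positivity) z).hasFDerivWithinAt)
    (fun z _ => h.norm_swirlKernelDeriv_shift_le hε hε1 z) (mem_univ y) (mem_univ x)

theorem continuous_swirlKernel : Continuous (swirlKernel P) := by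
  have hC := h.const_nonneg
  refine continuous_of_uniform_approx_of_continuous fun U hU => ?_
  obtain ⟨δ, hδ, hδU⟩ := Metric.mem_uniformity_dist.1 hU
  have hε : 0 < δ / (2 * C + 1) := by positivity
  refine ⟨_, continuous_iff_continuousAt.2 fun x =>
    (h.hasFDerivAt_swirlKernel_shift (δ := (δ / (2 * C + 1)) ^ 2) (by positivity) x).continuousAt,
    fun x => hδU ?_⟩
  rw [dist_comm, dist_eq_norm]
  calc _ ≤ 2 * C * (δ / (2 * C + 1)) := h.norm_swirlKernel_shift_sub_le hε x
    _ < (2 * C + 1) * (δ / (2 * C + 1)) := by gcongr; linarith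
    _ = δ := by field_simp

end IsLogProfile

section BlobProfile

/-- The radial profile of the blob kernel, as a function of the squared radius. -/
def blobProfile (α s : ℝ) : ℝ := blobCirculation (√s / α) / (2 * Real.pi * s)

/-- The derivative of `blobProfile α` on the positive half-line. -/
def blobProfileDeriv (α s : ℝ) : ℝ := blobShear (√s / α) / (4 * Real.pi * s ^ 2)

/-- A constant controlling the profile of the blob kernel. -/
def blobConst (α : ℝ) : ℝ := 1 / α ^ 2 + 1 / α + 1

variable {α : ℝ}

theorem hasDerivAt_blobProfile (hα : 0 < α) {s : ℝ} (hs : 0 < s) :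
    HasDerivAt (blobProfile α) (blobProfileDeriv α s) s := by
  have hcirc := (hasDerivAt_blobCirculation (div_pos (Real.sqrt_pos.2 hs) hα)).comp s
    ((Real.hasDerivAt_sqrt hs.ne').div_const α)
  refine (hcirc.fun_div ((hasDerivAt_id' s).const_mul (2 * Real.pi))
    (by positivity)).congr_deriv ?_
  have hsq : √s ^ 2 = s := Real.sq_sqrt hs.le
  have hsqrt : 0 < √s := Real.sqrt_pos.2 hs
  simp only [blobProfileDeriv, blobShear, Function.comp_apply]
  generalize besselMoment 0 (√s / α) = k
  generalize blobCirculation (√s / α) = c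
  generalize √s = r at *
  subst hsq
  field_simp
  ring

theorem neg_div_le_blobProfileDeriv (hα : 0 < α) {s : ℝ} (hs : 0 < s) :
    -(blobConst α / s) ≤ blobProfileDeriv α s := by
  have hshear := neg_sq_div_two_le_blobShear (div_pos (Real.sqrt_pos.2 hs) hα)
  rw [div_pow, Real.sq_sqrt hs.le] at hshear
  calc -(blobConst α / s) ≤ -(1 / α ^ 2 / s) := by
        unfold blobConst
        gcongr
        linarith [one_div_pos.2 hα]
    _ ≤ -(s / α ^ 2 / 2) / (4 * Real.pi * s ^ 2) := by
        rw [neg_div, neg_le_neg_iff, div_div, div_div, div_div,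
          div_le_div_iff₀ (by positivity) (by positivity)]
        nlinarith [Real.pi_gt_three, show 0 < α ^ 2 * s ^ 2 by positivity]
    _ ≤ blobProfileDeriv α s := by unfold blobProfileDeriv; gcongr

theorem isLogProfile_blobProfile (hα : 0 < α) :
    IsLogProfile (blobProfile α) (blobProfileDeriv α) (blobConst α) where
  hasDerivAt _ := hasDerivAt_blobProfile hα
  deriv_nonpos s hs := div_nonpos_of_nonpos_of_nonneg
    (blobShear_nonpos (div_pos (Real.sqrt_pos.2 hs) hα)) (by positivity)
  neg_div_le_deriv _ := neg_div_le_blobProfileDeriv hα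
  nonneg s hs := div_nonneg (blobCirculation_nonneg (div_pos (Real.sqrt_pos.2 hs) hα))
    (by positivity)
  le_div s hs := by
    have hcirc := blobCirculation_le_one (div_pos (Real.sqrt_pos.2 hs) hα)
    calc blobProfile α s ≤ 1 / (1 * s) := by
          unfold blobProfile
          gcongr
          linarith [Real.pi_gt_three]
      _ ≤ blobConst α / s := by
          rw [one_mul]
          gcongr
          unfold blobConst
          linarith [show 0 < 1 / α ^ 2 + 1 / α by positivity]
  sqrt_mul_le s hs := by
    have hsqrt : 0 < √s := Real.sqrt_pos.2 hs
    have hcirc := blobCirculation_le_self (div_pos hsqrt hα)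
    calc √s * blobProfile α s ≤ √s * ((√s / α) / (1 * s)) := by
          unfold blobProfile
          gcongr
          linarith [Real.pi_gt_three]
      _ = √s ^ 2 / s * (1 / α) := by field_simp
      _ = 1 / α := by rw [Real.sq_sqrt hs.le, div_self hs.ne', one_mul]
      _ ≤ blobConst α := by
          unfold blobConst
          linarith [show 0 < 1 / α ^ 2 by positivity]

theorem hasFDerivAt_norm {E : Type*} [NormedAddCommGroup E] [InnerProductSpace ℝ E] {x : E}
    (hx : x ≠ 0) : HasFDerivAt (fun y : E => ‖y‖) (‖x‖⁻¹ • innerSL ℝ x) x := by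
  have : 0 < ‖x‖ := norm_pos_iff.2 hx
  have hsqrt := (hasStrictFDerivAt_norm_sq x).hasFDerivAt.sqrt (by positivity)
  simp only [Real.sqrt_sq (norm_nonneg _)] at hsqrt
  refine hsqrt.congr_fderiv ?_
  rw [← Nat.cast_smul_eq_nsmul ℝ, smul_smul, Nat.cast_ofNat]
  congr 1
  field_simp

theorem hasGradientAt_greenFunction (hα : 0 < α) {x : Plane} (hx : x ≠ 0) :
    HasGradientAt (greenFunction α) (blobProfile α (‖x‖ ^ 2) • x) x := by
  have hr : 0 < ‖x‖ := norm_pos_iff.2 hx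
  have hradial : HasDerivAt (fun r => (besselMoment 0 (r / α) + Real.log r) / (2 * Real.pi))
      ((-besselMoment 1 (‖x‖ / α) * (1 / α) + ‖x‖⁻¹) / (2 * Real.pi)) ‖x‖ :=
    (((hasDerivAt_besselMoment 0 (div_pos hr hα)).comp ‖x‖
      ((hasDerivAt_id ‖x‖).div_const α)).add (Real.hasDerivAt_log hr.ne')).div_const _
  rw [besselMoment_zero] at hradial
  rw [hasGradientAt_iff_hasFDerivAt]
  refine (hradial.comp_hasFDerivAt x (hasFDerivAt_norm hx)).congr_fderiv ?_
  ext y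
  simp only [blobProfile, Real.sqrt_sq (norm_nonneg x), blobCirculation, FunLike.coe_smul,
    Pi.smul_apply, innerSL_apply_apply, smul_eq_mul, InnerProductSpace.toDual_apply_apply,
    real_inner_smul_left]
  field_simp
  ring

theorem blobKernel_eq_swirlKernel (hα : 0 < α) : blobKernel α = swirlKernel (blobProfile α) := by
  funext x
  unfold blobKernel swirlKernel
  split_ifs with hx
  · simp [hx]
  · rw [perpGradient, (hasGradientAt_greenFunction hα hx).gradient]
    ext i
    fin_cases i <;> simp

end BlobProfile

/-! ### Weakly divergence-free fields -/

theorem integrable_indicator_tsupport {E : Type*} [TopologicalSpace E] [MeasurableSpace E]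
    [OpensMeasurableSpace E] {μ : Measure E} [IsFiniteMeasureOnCompacts μ] {f : E → ℝ}
    (hf : HasCompactSupport f) (c : ℝ) : Integrable ((tsupport f).indicator fun _ => c) μ :=
  (integrable_indicator_iff (isClosed_tsupport f).measurableSet).2
    (integrableOn_const hf.measure_lt_top.ne)

section WeaklyDivFree

variable {E : Type*} [NormedAddCommGroup E] [NormedSpace ℝ E]

theorem norm_fderiv_apply_le_indicator {f : E → ℝ} {C : ℝ≥0} (hf : LipschitzWith C f) {w : E → E}
    {M : ℝ} (hw : ∀ x ∈ tsupport f, ‖w x‖ ≤ M) (x : E) :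
    ‖fderiv ℝ f x (w x)‖ ≤ (tsupport f).indicator (fun _ => C * M) x := by
  by_cases hx : x ∈ tsupport f
  · rw [indicator_of_mem hx]
    exact (fderiv ℝ f x).le_of_opNorm_le_of_le (norm_fderiv_le_of_lipschitz ℝ hf) (hw x hx)
  · simp [indicator_of_notMem hx, fderiv_of_notMem_tsupport ℝ hx]

variable [MeasurableSpace E]

/-- A vector field is divergence-free in the sense of distributions. The test functions are taken
Lipschitz rather than smooth, so that they may be transported by a Lipschitz flow; their
derivative exists almost everywhere by Rademacher's theorem. -/
def IsWeaklyDivFree (μ : Measure E) (w : E → E) : Prop :=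
  ∀ ⦃f : E → ℝ⦄ ⦃C : ℝ≥0⦄, LipschitzWith C f → HasCompactSupport f → ∫ x, fderiv ℝ f x (w x) ∂μ = 0

theorem IsWeaklyDivFree.isDivergenceFree {v : Plane → Plane}
    (hv : IsWeaklyDivFree volume v) : IsDivergenceFree v := fun φ hφ =>
  have ⟨_, hC⟩ := hφ.1.lipschitzWith_of_hasCompactSupport hφ.2 (by simp)
  hv hC hφ.2

variable [BorelSpace E] {μ : Measure E}

theorem IsWeaklyDivFree.comp_sub_right [μ.IsAddRightInvariant] {w : E → E}
    (hw : IsWeaklyDivFree μ w) (y : E) : IsWeaklyDivFree μ fun x => w (x - y) := by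
  intro f C hf hf'
  rw [← integral_add_right_eq_self _ y]
  simp only [add_sub_cancel_right, ← fderiv_comp_add_right]
  refine hw (C := C) ?_ (hf'.comp_homeomorph (Homeomorph.addRight y))
  simpa [Function.comp_def] using hf.comp (LipschitzWith.id.add (LipschitzWith.const y))

variable [FiniteDimensional ℝ E]

theorem stronglyMeasurable_fderiv_apply (f : E → ℝ) {Y : Type*} [MeasurableSpace Y] {g : Y → E}
    (hg : Measurable g) {w : Y → E} (hw : StronglyMeasurable w) :
    StronglyMeasurable fun y => fderiv ℝ f (g y) (w y) :=
  isBoundedBilinearMap_apply.continuous.comp_stronglyMeasurable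
    (((measurable_fderiv ℝ f).comp hg).stronglyMeasurable.prodMk hw)

theorem integrable_fderiv_apply [IsFiniteMeasureOnCompacts μ] {f : E → ℝ} {C : ℝ≥0}
    (hf : LipschitzWith C f) (hf' : HasCompactSupport f) {w : E → E} (hw : Continuous w) :
    Integrable (fun x => fderiv ℝ f x (w x)) μ :=
  have ⟨M, hM⟩ := hf'.exists_bound_of_continuousOn hw.continuousOn
  (integrable_indicator_tsupport hf' (C * M)).mono'
    (stronglyMeasurable_fderiv_apply f measurable_id hw.stronglyMeasurable).aestronglyMeasurable
    (ae_of_all _ (norm_fderiv_apply_le_indicator hf hM))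

theorem IsWeaklyDivFree.of_uniform_limit [IsFiniteMeasureOnCompacts μ] {v : E → E}
    (hv : Continuous v)
    (happrox : ∀ ε > 0, ∃ w, IsWeaklyDivFree μ w ∧ Continuous w ∧ ∀ x, ‖w x - v x‖ ≤ ε) :
    IsWeaklyDivFree μ v := by
  intro f C hf hf'
  have hbound (ε : ℝ) (hε : 0 < ε) :
      ‖∫ x, fderiv ℝ f x (v x) ∂μ‖ ≤ ε * ∫ x, (tsupport f).indicator (fun _ => (C : ℝ)) x ∂μ := by
    obtain ⟨w, hwdiv, hw, hwv⟩ := happrox ε hε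
    have hsplit : ∫ x, fderiv ℝ f x (v x) ∂μ = -∫ x, fderiv ℝ f x (w x - v x) ∂μ := by
      simp only [map_sub]
      rw [integral_sub (integrable_fderiv_apply hf hf' hw)
        (integrable_fderiv_apply hf hf' hv), hwdiv hf hf', zero_sub, neg_neg]
    rw [hsplit, norm_neg, ← integral_const_mul]
    refine norm_integral_le_of_norm_le ((integrable_indicator_tsupport hf' _).const_mul ε)
      (ae_of_all _ fun x => (norm_fderiv_apply_le_indicator hf (fun x _ => hwv x) x).trans_eq ?_)
    by_cases hx : x ∈ tsupport f <;> simp [hx, mul_comm]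
  have hlim : Tendsto (fun ε : ℝ => ε * ∫ x, (tsupport f).indicator (fun _ => (C : ℝ)) x ∂μ)
      (𝓝[>] 0) (𝓝 0) := by
    have hcont : Continuous fun ε : ℝ =>
      ε * ∫ x, (tsupport f).indicator (fun _ => (C : ℝ)) x ∂μ := by fun_prop
    simpa using (hcont.tendsto 0).mono_left nhdsWithin_le_nhds
  exact norm_le_zero_iff.1 (ge_of_tendsto hlim (eventually_mem_nhdsWithin.mono hbound))

theorem IsWeaklyDivFree.integral [IsFiniteMeasureOnCompacts μ] [SFinite μ] {Y : Type*}
    [MeasurableSpace Y] {ν : Measure Y} [IsFiniteMeasure ν] {w : Y → E → E}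
    (hw : ∀ y, IsWeaklyDivFree μ (w y)) (hmeas : StronglyMeasurable fun p : E × Y => w p.2 p.1)
    {M : ℝ} (hM : ∀ y x, ‖w y x‖ ≤ M) : IsWeaklyDivFree μ fun x => ∫ y, w y x ∂ν := by
  intro f C hf hf'
  have hint (x : E) : Integrable (fun y => w y x) ν :=
    .of_bound (hmeas.comp_measurable measurable_prodMk_left).aestronglyMeasurable M
      (ae_of_all _ fun y => hM y x)
  have hprod : Integrable (fun p : E × Y => fderiv ℝ f p.1 (w p.2 p.1)) (μ.prod ν) :=
    ((integrable_indicator_tsupport hf' (C * M)).comp_fst ν).mono'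
      (stronglyMeasurable_fderiv_apply f measurable_fst hmeas).aestronglyMeasurable
      (ae_of_all _ fun p => norm_fderiv_apply_le_indicator hf (fun x _ => hM p.2 x) p.1)
  calc ∫ x, fderiv ℝ f x (∫ y, w y x ∂ν) ∂μ
      = ∫ x, ∫ y, fderiv ℝ f x (w y x) ∂ν ∂μ := by
        simp only [ContinuousLinearMap.integral_comp_comm _ (hint _)]
    _ = ∫ y, ∫ x, fderiv ℝ f x (w y x) ∂μ ∂ν := integral_integral_swap hprod
    _ = 0 := by simp only [hw _ hf hf', integral_zero]

end WeaklyDivFree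

theorem isWeaklyDivFree_of_trace_eq_zero {E : Type*} [NormedAddCommGroup E]
    [InnerProductSpace ℝ E] [FiniteDimensional ℝ E] [MeasurableSpace E] [BorelSpace E]
    {μ : Measure E} [μ.IsAddHaarMeasure] {w : E → E} {w' : E → E →L[ℝ] E} {K : ℝ≥0}
    (hw : LipschitzWith K w) (hw' : ∀ x, HasFDerivAt w (w' x) x)
    (htrace : ∀ x, LinearMap.trace ℝ E (w' x) = 0) : IsWeaklyDivFree μ w := by
  intro f C hf hf'
  let e := stdOrthonormalBasis ℝ E
  have hcoord (i) : LipschitzWith (1 * K) fun x => inner ℝ (e i) (w x) :=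
    ((innerSL ℝ (e i)).lipschitz.weaken (by
      rw [← NNReal.coe_le_coe, coe_nnnorm, innerSL_apply_norm, e.norm_eq_one,
        NNReal.coe_one])).comp hw
  have hderiv (i) (x : E) :
      lineDeriv ℝ (fun x => inner ℝ (e i) (w x)) x (e i) = inner ℝ (e i) (w' x (e i)) :=
    (((innerSL ℝ (e i)).hasFDerivAt.comp x (hw' x)).hasLineDerivAt (e i)).lineDeriv
  have hint (i) : Integrable (fun x => inner ℝ (e i) (w' x (e i)) * f x) μ := by
    simp only [← hderiv]
    exact (hf.continuous.integrable_of_hasCompactSupport hf').mul_of_top_right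
      ((hcoord i).memLp_lineDeriv (e i))
  calc ∫ x, fderiv ℝ f x (w x) ∂μ
      = ∑ i, ∫ x, fderiv ℝ f x (inner ℝ (e i) (w x) • e i) ∂μ := by
        rw [← integral_finsetSum _ fun i _ =>
          integrable_fderiv_apply hf hf' ((hcoord i).continuous.fun_smul continuous_const)]
        simp only [← map_sum, e.sum_repr']
    _ = ∑ i, ∫ x, lineDeriv ℝ f x (e i) * inner ℝ (e i) (w x) ∂μ := by
        refine Finset.sum_congr rfl fun i _ => integral_congr_ae ?_
        filter_upwards [hf.ae_differentiableAt] with x hx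
        rw [hx.lineDeriv_eq_fderiv, map_smul, smul_eq_mul, mul_comm]
    _ = ∑ i, -∫ x, inner ℝ (e i) (w' x (e i)) * f x ∂μ := by
        refine Finset.sum_congr rfl fun i _ => ?_
        have hparts := (hcoord i).integral_lineDeriv_mul_eq hf hf' (μ := μ) (e i)
        simp only [hderiv, lineDeriv_neg, neg_mul, integral_neg] at hparts
        rw [hparts, neg_neg]
    _ = -∫ x, LinearMap.trace ℝ E (w' x) * f x ∂μ := by
        rw [Finset.sum_neg_distrib, ← integral_finsetSum _ fun i _ => hint i]
        simp only [LinearMap.trace_eq_sum_inner _ e, Finset.sum_mul]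
        rfl
    _ = 0 := by simp [htrace]

/-! ### Convolution kernels -/

/-- A convolution kernel: a continuous vector field vanishing at infinity. -/
structure IsKernel {E : Type*} [NormedAddCommGroup E] (k : E → E) : Prop where
  continuous : Continuous k
  tendsto_cocompact : Tendsto k (cocompact E) (𝓝 0)

/-- A kernel that can be approximated uniformly by divergence-free Lipschitz kernels, the Lipschitz
constant growing only logarithmically in the error. -/
structure IsOsgoodKernel {E : Type*} [NormedAddCommGroup E] [NormedSpace ℝ E] [MeasurableSpace E]
    (μ : Measure E) (k : E → E) : Prop extends IsKernel k where
  exists_approx : ∃ C ≥ 0, ∀ ε, 0 < ε → ε ≤ 1 → ∃ k', IsKernel k' ∧ IsWeaklyDivFree μ k' ∧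
    (∀ x y, ‖k' x - k' y‖ ≤ C * (1 - Real.log ε) * ‖x - y‖) ∧
    (∀ x, ‖k' x‖ ≤ C) ∧ ∀ x, ‖k' x - k x‖ ≤ C * ε

theorem IsOsgoodKernel.isWeaklyDivFree {E : Type*} [NormedAddCommGroup E] [NormedSpace ℝ E]
    [MeasurableSpace E] [BorelSpace E] [FiniteDimensional ℝ E] {μ : Measure E}
    [IsFiniteMeasureOnCompacts μ] {k : E → E} (hk : IsOsgoodKernel μ k) : IsWeaklyDivFree μ k := by
  obtain ⟨C, hC, happrox⟩ := hk.exists_approx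
  refine .of_uniform_limit hk.continuous fun ε hε => ?_
  obtain ⟨k', hk', hdiv, -, -, hsub⟩ :=
    happrox (min 1 (ε / (C + 1))) (lt_min one_pos (by positivity)) (min_le_left _ _)
  refine ⟨k', hdiv, hk'.continuous, fun x => (hsub x).trans ?_⟩
  calc C * min 1 (ε / (C + 1)) ≤ (C + 1) * (ε / (C + 1)) := by
        gcongr
        · linarith
        · exact min_le_right _ _
    _ = ε := by field_simp

theorem IsLogProfile.isKernel_swirlKernel {P P' : ℝ → ℝ} {C : ℝ} (h : IsLogProfile P P' C) :
    IsKernel (swirlKernel P) :=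
  ⟨h.continuous_swirlKernel, h.tendsto_swirlKernel⟩

theorem IsLogProfile.isOsgoodKernel_swirlKernel {P P' : ℝ → ℝ} {C : ℝ}
    (h : IsLogProfile P P' C) : IsOsgoodKernel volume (swirlKernel P) where
  toIsKernel := h.isKernel_swirlKernel
  exists_approx := by
    have hC := h.const_nonneg
    refine ⟨3 * C, by positivity, fun ε hε hε1 => ⟨swirlKernel fun s => P (s + ε ^ 2),
      (h.shift (sq_nonneg ε)).isKernel_swirlKernel, ?_,
      h.norm_swirlKernel_shift_sub_self_le hε hε1,
      fun x => ((h.shift (sq_nonneg ε)).norm_swirlKernel_le x).trans (by linarith),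
      fun x => (h.norm_swirlKernel_shift_sub_le hε x).trans (by gcongr; norm_num)⟩⟩
    refine isWeaklyDivFree_of_trace_eq_zero
      (LipschitzWith.of_dist_le' (K := 3 * C * (1 - Real.log ε)) fun x y => ?_)
      (h.hasFDerivAt_swirlKernel_shift (by positivity)) (trace_swirlKernelDeriv _ _)
    simpa only [dist_eq_norm] using h.norm_swirlKernel_shift_sub_self_le hε hε1 x y

theorem isOsgoodKernel_blobKernel {α : ℝ} (hα : 0 < α) : IsOsgoodKernel volume (blobKernel α) :=
  blobKernel_eq_swirlKernel hα ▸ (isLogProfile_blobProfile hα).isOsgoodKernel_swirlKernel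

/-! ### Integration against signed measures -/

instance isFiniteMeasure_variation {X : Type*} [MeasurableSpace X] (q : SignedMeasure X) :
    IsFiniteMeasure q.variation := by
  rw [← SignedMeasure.totalVariation_eq_variation]
  infer_instance

section SignedMeasure

variable {X : Type*} [MeasurableSpace X]

/-- The total variation norm of a signed measure. -/
def totalMass (q : SignedMeasure X) : ℝ := q.variation.real univ

theorem totalMass_nonneg (q : SignedMeasure X) : 0 ≤ totalMass q := measureReal_nonneg

variable {F : Type*} [NormedAddCommGroup F]

theorem integrable_of_continuous_of_bound [TopologicalSpace X] [OpensMeasurableSpace X]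
    [SecondCountableTopologyEither X F] (q : SignedMeasure X) {f : X → F} (hf : Continuous f)
    {C : ℝ} (hC : ∀ x, ‖f x‖ ≤ C) : q.Integrable f :=
  Integrable.of_bound hf.aestronglyMeasurable C (ae_of_all _ hC)

theorem posPart_le_variation (q : SignedMeasure X) :
    q.toJordanDecomposition.posPart ≤ q.variation := by
  rw [← SignedMeasure.totalVariation_eq_variation]
  exact Measure.le_add_right le_rfl

theorem negPart_le_variation (q : SignedMeasure X) :
    q.toJordanDecomposition.negPart ≤ q.variation := by
  rw [← SignedMeasure.totalVariation_eq_variation]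
  exact Measure.le_add_left le_rfl

variable [NormedSpace ℝ F]

theorem norm_vintegral_le (q : SignedMeasure X) {f : X → F} {C : ℝ} (hC0 : 0 ≤ C)
    (hC : ∀ x, ‖f x‖ ≤ C) : ‖∫ᵛ x, f x ∂<•q‖ ≤ totalMass q * C := by
  have hflip : ‖(ContinuousLinearMap.lsmul ℝ ℝ (E := F)).flip‖ ≤ 1 := by
    rw [ContinuousLinearMap.opNorm_flip]
    exact ContinuousLinearMap.opNorm_lsmul_le
  calc ‖∫ᵛ x, f x ∂<•q‖ ≤ C * ‖(ContinuousLinearMap.lsmul ℝ ℝ (E := F)).flip‖ * totalMass q :=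
        VectorMeasure.norm_integral_le_of_norm_le_const (ae_of_all _ hC)
    _ ≤ C * 1 * totalMass q := by gcongr; exact totalMass_nonneg q
    _ = totalMass q * C := by ring

theorem vintegral_eq_sub (q : SignedMeasure X) {f : X → F} (hf : q.Integrable f) :
    ∫ᵛ x, f x ∂<•q = ∫ x, f x ∂q.toJordanDecomposition.posPart -
      ∫ x, f x ∂q.toJordanDecomposition.negPart := by
  have hpos : (q.toJordanDecomposition.posPart.toSignedMeasure).Integrable f := by
    rw [VectorMeasure.Integrable, Measure.variation_toSignedMeasure]
    exact hf.mono_measure (posPart_le_variation q)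
  have hneg : (q.toJordanDecomposition.negPart.toSignedMeasure).Integrable f := by
    rw [VectorMeasure.Integrable, Measure.variation_toSignedMeasure]
    exact hf.mono_measure (negPart_le_variation q)
  conv_lhs => rw [← SignedMeasure.toSignedMeasure_toJordanDecomposition q]
  rw [JordanDecomposition.toSignedMeasure, VectorMeasure.integral_sub_vectorMeasure hpos hneg,
    VectorMeasure.integral_toSignedMeasure, VectorMeasure.integral_toSignedMeasure]

theorem vintegral_comp_clm {G : Type*} [NormedAddCommGroup G] [NormedSpace ℝ G]
    [CompleteSpace F] [CompleteSpace G] (q : SignedMeasure X) (L : F →L[ℝ] G) {f : X → F}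
    (hf : q.Integrable f) : ∫ᵛ x, L (f x) ∂<•q = L (∫ᵛ x, f x ∂<•q) := by
  rw [vintegral_eq_sub q hf, vintegral_eq_sub q (L.integrable_comp hf),
    L.integral_comp_comm (hf.mono_measure (posPart_le_variation q)),
    L.integral_comp_comm (hf.mono_measure (negPart_le_variation q)), map_sub]

theorem vintegral_map [TopologicalSpace X] [OpensMeasurableSpace X] {Y : Type*}
    [TopologicalSpace Y] [MeasurableSpace Y] [BorelSpace Y] [SecondCountableTopology F]
    (q : SignedMeasure X) {η : X → Y} (hη : Continuous η) {f : Y → F} (hf : Continuous f) {C : ℝ}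
    (hC : ∀ y, ‖f y‖ ≤ C) : ∫ᵛ y, f y ∂<•(VectorMeasure.map q η) = ∫ᵛ x, f (η x) ∂<•q :=
  VectorMeasure.integral_map hη.measurable hf.aestronglyMeasurable
    (integrable_of_continuous_of_bound q (hf.comp hη) fun x => hC (η x))

end SignedMeasure

section TestFunctions

variable {E : Type*} [NormedAddCommGroup E] [NormedSpace ℝ E] [FiniteDimensional ℝ E]

theorem exists_testFunction_dist_le {f : E → ℝ} (hf : Continuous f) (hf' : HasCompactSupport f)
    {ε : ℝ} (hε : 0 < ε) :
    ∃ g, IsTestFunction g ∧ tsupport g ⊆ Metric.cthickening 1 (tsupport f) ∧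
      ∀ x, dist (g x) (f x) ≤ ε := by
  obtain ⟨δ, hδ, hfδ⟩ :=
    Metric.uniformContinuous_iff.1 (hf'.uniformContinuous_of_continuous hf) ε hε
  obtain ⟨g, hg, hgf⟩ := hf.exists_contDiff_dist_le_of_forall_mem_ball_dist_le (lt_min hδ one_pos)
  have hsupp : tsupport g ⊆ Metric.cthickening 1 (tsupport f) := by
    refine closure_minimal (fun x hx => ?_) Metric.isClosed_cthickening
    by_contra hxf
    have hf0 (z : E) (hz : dist x z ≤ 1) : f z = 0 := by
      by_contra hz0
      exact hxf (Metric.mem_cthickening_of_dist_le x z 1 _ (subset_tsupport f hz0) hz)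
    refine hx ((dist_le_zero.1 (hgf x 0 fun y hy => ?_)).trans (hf0 x (by simp)))
    have hxy : dist x y ≤ 1 := by
      simpa [dist_comm] using (Metric.mem_ball.1 hy).le.trans (min_le_right _ _)
    rw [hf0 y hxy, hf0 x (by simp), dist_self]
  refine ⟨g, ⟨hg, hf'.isCompact.cthickening.of_isClosed_subset (isClosed_tsupport g) hsupp⟩, hsupp,
    fun x => hgf x ε fun y hy => (hfδ ((Metric.mem_ball.1 hy).trans_le (min_le_left _ _))).le⟩

variable [MeasurableSpace E] [BorelSpace E]

theorem measure_ext_of_testFunctions {μ ν : Measure E} [IsFiniteMeasureOnCompacts μ]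
    [IsFiniteMeasureOnCompacts ν]
    (h : ∀ φ : E → ℝ, IsTestFunction φ → ∫ x, φ x ∂μ = ∫ x, φ x ∂ν) : μ = ν := by
  refine Measure.ext_of_integral_eq_on_compactlySupported fun f => ?_
  have hf : Continuous (f : E → ℝ) := f.continuous
  have hK := f.hasCompactSupport.isCompact.cthickening (r := 1)
  choose g hg hsupp hgf using fun n : ℕ =>
    exists_testFunction_dist_le hf f.hasCompactSupport (Nat.one_div_pos_of_nat (α := ℝ) (n := n))
  have hlim (x : E) : Tendsto (fun n => g n x) atTop (𝓝 (f x)) :=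
    tendsto_iff_dist_tendsto_zero.2 <| squeeze_zero (fun _ => dist_nonneg) (fun n => hgf n x)
      tendsto_one_div_add_atTop_nhds_zero_nat
  obtain ⟨C, hC⟩ := f.hasCompactSupport.exists_bound_of_continuous hf
  have hbound (n : ℕ) (x : E) :
      ‖g n x‖ ≤ (Metric.cthickening 1 (tsupport f)).indicator (fun _ => C + 1) x := by
    by_cases hx : x ∈ Metric.cthickening 1 (tsupport f)
    · rw [indicator_of_mem hx]
      have hgf' : dist (g n x) (f x) ≤ 1 :=
        (hgf n x).trans (div_le_one_of_le₀ (by simp) (by positivity))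
      linarith [norm_le_norm_add_norm_sub' (g n x) (f x), hC x, dist_eq_norm (g n x) (f x)]
    · rw [image_eq_zero_of_notMem_tsupport fun h => hx (hsupp n h), norm_zero,
        indicator_of_notMem hx]
  have htendsto (κ : Measure E) [IsFiniteMeasureOnCompacts κ] :
      Tendsto (fun n => ∫ x, g n x ∂κ) atTop (𝓝 (∫ x, f x ∂κ)) :=
    tendsto_integral_of_dominated_convergence _
      (fun n => (hg n).1.continuous.aestronglyMeasurable)
      ((integrable_indicator_iff hK.isClosed.measurableSet).2
        (integrableOn_const hK.measure_lt_top.ne))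
      (fun n => ae_of_all _ (hbound n)) (ae_of_all _ hlim)
  exact tendsto_nhds_unique (htendsto μ) (by simpa only [h _ (hg _)] using htendsto ν)

theorem signedMeasure_ext_of_testFunctions {p q : SignedMeasure E}
    (h : ∀ φ : E → ℝ, IsTestFunction φ → ∫ᵛ x, φ x ∂<•p = ∫ᵛ x, φ x ∂<•q) : p = q := by
  have hcross : p.toJordanDecomposition.posPart + q.toJordanDecomposition.negPart =
      q.toJordanDecomposition.posPart + p.toJordanDecomposition.negPart := by
    refine measure_ext_of_testFunctions fun φ hφ => ?_
    obtain ⟨C, hC⟩ := hφ.2.exists_bound_of_continuous hφ.1.continuous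
    have ip := integrable_of_continuous_of_bound p hφ.1.continuous hC
    have iq := integrable_of_continuous_of_bound q hφ.1.continuous hC
    have heq := h φ hφ
    rw [vintegral_eq_sub p ip, vintegral_eq_sub q iq] at heq
    rw [integral_add_measure (ip.mono_measure (posPart_le_variation p))
      (iq.mono_measure (negPart_le_variation q)),
      integral_add_measure (iq.mono_measure (posPart_le_variation q))
      (ip.mono_measure (negPart_le_variation p))]
    linarith
  rw [← SignedMeasure.toSignedMeasure_toJordanDecomposition p,
    ← SignedMeasure.toSignedMeasure_toJordanDecomposition q, JordanDecomposition.toSignedMeasure,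
    JordanDecomposition.toSignedMeasure, sub_eq_sub_iff_add_eq_add,
    ← Measure.toSignedMeasure_add, ← Measure.toSignedMeasure_add]
  congr 1

end TestFunctions

/-! ### Weak-* continuous curves of signed measures -/

section ZeroAtInfty

variable {X F : Type*} [TopologicalSpace X] [NormedAddCommGroup F]

theorem norm_zeroAtInfty_apply_le (f : C₀(X, F)) (x : X) : ‖f x‖ ≤ ‖f‖ := by
  rw [← ZeroAtInftyContinuousMap.norm_toBCF_eq_norm]
  exact f.toBCF.norm_coe_le_norm x

theorem norm_zeroAtInfty_le {f : C₀(X, F)} {C : ℝ} (hC0 : 0 ≤ C) (hC : ∀ x, ‖f x‖ ≤ C) :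
    ‖f‖ ≤ C := by
  rw [← ZeroAtInftyContinuousMap.norm_toBCF_eq_norm]
  exact (BoundedContinuousFunction.norm_le hC0).2 hC

/-- Postcomposition of a function vanishing at infinity with a continuous linear map. -/
def compLeftZeroAtInfty {G : Type*} [NormedAddCommGroup G] [NormedSpace ℝ F] [NormedSpace ℝ G]
    (L : F →L[ℝ] G) (f : C₀(X, F)) : C₀(X, G) where
  toFun x := L (f x)
  continuous_toFun := by fun_prop
  zero_at_infty' := map_zero L ▸ (L.continuous.tendsto 0).comp f.zero_at_infty'

end ZeroAtInfty

section WeakStar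

variable {X : Type*} [TopologicalSpace X] [MeasurableSpace X]

/-- Continuity of a curve of signed measures in the weak-* topology of the dual of `C₀(X, ℝ)`. -/
def IsWeakStarContinuous {T : Type*} [TopologicalSpace T] (q : T → SignedMeasure X) : Prop :=
  ∀ f : C₀(X, ℝ), Continuous fun t => ∫ᵛ x, f x ∂<•(q t)

variable [OpensMeasurableSpace X] {F : Type*} [NormedAddCommGroup F]

theorem integrable_zeroAtInfty [SecondCountableTopologyEither X F] (q : SignedMeasure X)
    (f : C₀(X, F)) : q.Integrable f :=
  integrable_of_continuous_of_bound q f.continuous (norm_zeroAtInfty_apply_le f)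

/-- A signed measure, viewed as an element of the dual of `C₀(X, ℝ)`. -/
def pairing (q : SignedMeasure X) : C₀(X, ℝ) →L[ℝ] ℝ :=
  LinearMap.mkContinuous
    { toFun := fun f => ∫ᵛ x, f x ∂<•q
      map_add' := fun f g =>
        VectorMeasure.integral_fun_add (integrable_zeroAtInfty q f) (integrable_zeroAtInfty q g)
      map_smul' := fun c f => VectorMeasure.integral_fun_smul _ _ c f }
    (totalMass q) fun f => norm_vintegral_le q (norm_nonneg f) (norm_zeroAtInfty_apply_le f)

variable [NormedSpace ℝ F]

theorem norm_vintegral_le_norm_pairing [CompleteSpace F] [SecondCountableTopologyEither X F]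
    (q : SignedMeasure X) (f : C₀(X, F)) : ‖∫ᵛ x, f x ∂<•q‖ ≤ ‖pairing q‖ * ‖f‖ := by
  obtain ⟨L, hL, hLf⟩ := exists_dual_vector'' ℝ (∫ᵛ x, f x ∂<•q)
  let g := compLeftZeroAtInfty L f
  have hg : ‖g‖ ≤ ‖f‖ := norm_zeroAtInfty_le (norm_nonneg f) fun x =>
    (L.le_of_opNorm_le hL _).trans <| by simpa using norm_zeroAtInfty_apply_le f x
  calc ‖∫ᵛ x, f x ∂<•q‖ = pairing q g :=
        hLf.symm.trans (vintegral_comp_clm q L (integrable_zeroAtInfty q f)).symm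
    _ ≤ ‖pairing q‖ * ‖g‖ := (le_abs_self _).trans ((pairing q).le_opNorm g)
    _ ≤ ‖pairing q‖ * ‖f‖ := by gcongr

namespace IsWeakStarContinuous

variable {T : Type*} [TopologicalSpace T] {q : T → SignedMeasure X}

theorem exists_norm_pairing_le (hq : IsWeakStarContinuous q) {K : Set T} (hK : IsCompact K) :
    ∃ M, 0 ≤ M ∧ ∀ t ∈ K, ‖pairing (q t)‖ ≤ M := by
  have hpt (f : C₀(X, ℝ)) : ∃ C, ∀ t : K, ‖pairing (q t) f‖ ≤ C := by
    obtain ⟨C, hC⟩ := hK.exists_bound_of_continuousOn (hq f).continuousOn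
    exact ⟨C, fun t => hC t t.2⟩
  obtain ⟨M, hM⟩ := banach_steinhaus hpt
  exact ⟨max M 0, le_max_right _ _, fun t ht => (hM ⟨t, ht⟩).trans (le_max_left _ _)⟩

theorem continuous_vintegral_const [FiniteDimensional ℝ F] (hq : IsWeakStarContinuous q)
    (f : C₀(X, F)) : Continuous fun t => ∫ᵛ x, f x ∂<•(q t) := by
  let e := (Module.finBasis ℝ F).equivFunL
  have : CompleteSpace F := FiniteDimensional.complete ℝ F
  refine e.toHomeomorph.comp_continuous_iff.1 (continuous_pi fun i => ?_)
  let L : F →L[ℝ] ℝ := (ContinuousLinearMap.proj i : (_ → ℝ) →L[ℝ] ℝ).comp (e : F →L[ℝ] _)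
  have hL (t : T) : L (∫ᵛ x, f x ∂<•(q t)) = ∫ᵛ x, L (f x) ∂<•(q t) :=
    (vintegral_comp_clm _ L (integrable_zeroAtInfty _ f)).symm
  exact (hq (compLeftZeroAtInfty L f)).congr fun t => (hL t).symm

theorem continuous_vintegral [FiniteDimensional ℝ F] [WeaklyLocallyCompactSpace T]
    (hq : IsWeakStarContinuous q) {S : Type*} [TopologicalSpace S] {τ : S → T} (hτ : Continuous τ)
    {g : S → C₀(X, F)} (hg : Continuous g) :
    Continuous fun s => ∫ᵛ x, g s x ∂<•(q (τ s)) := by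
  have : CompleteSpace F := FiniteDimensional.complete ℝ F
  refine continuous_iff_continuousAt.2 fun s₀ => ?_
  obtain ⟨K, hK, hKs⟩ := exists_compact_mem_nhds (τ s₀)
  obtain ⟨M, -, hM⟩ := hq.exists_norm_pairing_le hK
  have hsub : Tendsto (fun s => ∫ᵛ x, (g s - g s₀) x ∂<•(q (τ s))) (𝓝 s₀) (𝓝 0) := by
    have hlim : Tendsto (fun s => M * ‖g s - g s₀‖) (𝓝 s₀) (𝓝 0) := by
      simpa using ((tendsto_iff_norm_sub_tendsto_zero.1 (hg.tendsto s₀)).const_mul M)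
    refine squeeze_zero_norm' ?_ hlim
    filter_upwards [hτ.continuousAt.eventually_mem hKs] with s hs
    exact (norm_vintegral_le_norm_pairing _ _).trans (by gcongr; exact hM _ hs)
  have hconst := ((hq.continuous_vintegral_const (g s₀)).comp hτ).tendsto s₀
  refine (hsub.add hconst).congr' (.of_forall fun s => ?_) |>.trans (by simp)
  simp only [Function.comp_apply, ZeroAtInftyContinuousMap.coe_sub, Pi.sub_apply]
  rw [VectorMeasure.integral_fun_sub (integrable_zeroAtInfty _ _) (integrable_zeroAtInfty _ _),
    sub_add_cancel]

end IsWeakStarContinuous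

end WeakStar

/-! ### Velocities -/

section Velocity

variable {E : Type*} [NormedAddCommGroup E]

namespace IsKernel

variable {k k' : E → E}

/-- The vector field `y ↦ k (x - y)`, whose integral against a measure is its velocity at `x`. -/
def translate (hk : IsKernel k) (x : E) : C₀(E, E) where
  toFun y := k (x - y)
  continuous_toFun := hk.continuous.comp (by fun_prop)
  zero_at_infty' :=
    hk.tendsto_cocompact.comp (Homeomorph.subLeft x).isClosedEmbedding.tendsto_cocompact

theorem exists_bound (hk : IsKernel k) : ∃ C, 0 ≤ C ∧ ∀ x, ‖k x‖ ≤ C := by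
  refine ⟨‖hk.translate 0‖, norm_nonneg _, fun x => ?_⟩
  simpa [translate] using norm_zeroAtInfty_apply_le (hk.translate 0) (-x)

theorem uniformContinuous (hk : IsKernel k) : UniformContinuous k :=
  ZeroAtInftyContinuousMap.uniformContinuous (⟨⟨k, hk.continuous⟩, hk.tendsto_cocompact⟩ : C₀(E, E))

theorem continuous_translate (hk : IsKernel k) : Continuous hk.translate := by
  refine continuous_iff_continuousAt.2 fun x₀ => Metric.tendsto_nhds.2 fun ε hε => ?_
  obtain ⟨δ, hδ, hδε⟩ := Metric.uniformContinuous_iff.1 hk.uniformContinuous (ε / 2) (by positivity)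
  filter_upwards [Metric.ball_mem_nhds x₀ hδ] with x hx
  rw [dist_eq_norm]
  refine (norm_zeroAtInfty_le (half_pos hε).le fun y => ?_).trans_lt (half_lt_self hε)
  have hy : dist (x - y) (x₀ - y) < δ := by simpa using hx
  exact (dist_eq_norm (k (x - y)) (k (x₀ - y))) ▸ (hδε hy).le

end IsKernel

variable [NormedSpace ℝ E] [MeasurableSpace E]

/-- The convolution of a kernel with a signed measure. -/
def velocity (k : E → E) (q : SignedMeasure E) (x : E) : E :=
  ∫ᵛ y, k (x - y) ∂<•q

variable [BorelSpace E] [FiniteDimensional ℝ E]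

namespace IsKernel

variable {k k' : E → E}

theorem norm_velocity_le (hk : IsKernel k) (q : SignedMeasure E) {C : ℝ} (hC0 : 0 ≤ C)
    (hC : ∀ x, ‖k x‖ ≤ C) (x : E) : ‖velocity k q x‖ ≤ ‖pairing q‖ * C := by
  refine (norm_vintegral_le_norm_pairing q (hk.translate x)).trans ?_
  gcongr
  exact norm_zeroAtInfty_le hC0 fun _ => hC _

theorem norm_velocity_sub_le (hk : IsKernel k) (hk' : IsKernel k') (q : SignedMeasure E) {x x' : E}
    {C : ℝ} (hC0 : 0 ≤ C) (hC : ∀ y, ‖k (x - y) - k' (x' - y)‖ ≤ C) :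
    ‖velocity k q x - velocity k' q x'‖ ≤ ‖pairing q‖ * C := by
  have hsub : velocity k q x - velocity k' q x' =
      ∫ᵛ y, (hk.translate x - hk'.translate x') y ∂<•q :=
    (VectorMeasure.integral_fun_sub (integrable_zeroAtInfty q (hk.translate x))
      (integrable_zeroAtInfty q (hk'.translate x'))).symm
  rw [hsub]
  refine (norm_vintegral_le_norm_pairing q _).trans ?_
  gcongr
  exact norm_zeroAtInfty_le hC0 fun y => hC y

theorem continuous_velocity {T : Type*} [TopologicalSpace T] [WeaklyLocallyCompactSpace T]
    (hk : IsKernel k) {q : T → SignedMeasure E} (hq : IsWeakStarContinuous q) :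
    Continuous (Function.uncurry fun t x => velocity k (q t) x) :=
  hq.continuous_vintegral (g := fun p : T × E => hk.translate p.2) continuous_fst
    (hk.continuous_translate.comp continuous_snd)

theorem isWeaklyDivFree_velocity {μ : Measure E} [IsFiniteMeasureOnCompacts μ] [SFinite μ]
    [μ.IsAddRightInvariant] (hk : IsKernel k) (hdiv : IsWeaklyDivFree μ k)
    (q : SignedMeasure E) : IsWeaklyDivFree μ (velocity k q) := by
  obtain ⟨C, -, hC⟩ := hk.exists_bound
  have hmeas : Continuous fun p : E × E => k (p.1 - p.2) := hk.continuous.comp (by fun_prop)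
  have hdivν (ν : Measure E) [IsFiniteMeasure ν] :
      IsWeaklyDivFree μ fun x => ∫ y, k (x - y) ∂ν :=
    .integral (fun y => hdiv.comp_sub_right y) hmeas.stronglyMeasurable fun y x => hC _
  have hcontν (ν : Measure E) [IsFiniteMeasure ν] : Continuous fun x => ∫ y, k (x - y) ∂ν :=
    continuous_of_dominated
      (fun x => (hmeas.comp (Continuous.prodMk_right x)).aestronglyMeasurable)
      (fun x => ae_of_all _ fun y => hC _) (integrable_const C)
      (ae_of_all _ fun y => hmeas.comp (Continuous.prodMk_left y))
  intro f K hf hf'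
  have hjordan (x : E) : velocity k q x = ∫ y, k (x - y) ∂q.toJordanDecomposition.posPart -
      ∫ y, k (x - y) ∂q.toJordanDecomposition.negPart :=
    vintegral_eq_sub q (integrable_zeroAtInfty q (hk.translate x))
  simp only [hjordan, map_sub]
  rw [integral_sub (integrable_fderiv_apply hf hf' (hcontν _))
    (integrable_fderiv_apply hf hf' (hcontν _)), hdivν _ hf hf', hdivν _ hf hf', sub_zero]

end IsKernel

end Velocity

/-! ### The Osgood modulus -/

/-- The solution at time `c` of `B' = B (1 - log B)`, `B(0) = r`. -/
def osgoodModulus (c r : ℝ) : ℝ := Real.exp (1 - (1 - Real.log r) * Real.exp (-c))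

theorem osgoodModulus_pos (c r : ℝ) : 0 < osgoodModulus c r := Real.exp_pos _

theorem osgoodModulus_zero {r : ℝ} (hr : 0 < r) : osgoodModulus 0 r = r := by
  simp [osgoodModulus, Real.exp_log hr]

theorem osgoodModulus_le_osgoodModulus {c c' r : ℝ} (hr : 0 < r) (hr1 : r ≤ 1) (hc : c ≤ c') :
    osgoodModulus c r ≤ osgoodModulus c' r := by
  have := Real.log_nonpos hr.le hr1
  unfold osgoodModulus
  gcongr
  linarith

theorem hasDerivAt_osgoodModulus (c r : ℝ) : HasDerivAt (fun c => osgoodModulus c r)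
    (osgoodModulus c r * (1 - Real.log (osgoodModulus c r))) c := by
  refine ((((hasDerivAt_neg c).exp).const_mul (1 - Real.log r)).const_sub 1).exp.congr_deriv ?_
  rw [osgoodModulus, Real.log_exp]
  ring

theorem tendsto_one_sub_log_mul_osgoodModulus (c : ℝ) :
    Tendsto (fun r => (1 - Real.log r) * osgoodModulus c r) (𝓝[>] 0) (𝓝 0) := by
  have hlog : Tendsto (fun r => (1 - Real.log r) * Real.exp (-c)) (𝓝[>] 0) atTop :=
    (tendsto_atTop_add_const_left _ _ <| tendsto_neg_atBot_atTop.comp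
      Real.tendsto_log_nhdsGT_zero).atTop_mul_const (Real.exp_pos (-c))
  have h := ((Real.tendsto_pow_mul_exp_neg_atTop_nhds_zero 1).comp hlog).const_mul
    (Real.exp 1 * Real.exp c)
  rw [mul_zero] at h
  refine h.congr fun r => ?_
  have hc : Real.exp c * Real.exp (-c) = 1 := by rw [← Real.exp_add, add_neg_cancel, Real.exp_zero]
  simp only [Function.comp_apply, osgoodModulus, sub_eq_add_neg (1 : ℝ), Real.exp_add, pow_one]
  linear_combination (1 + -Real.log r) * Real.exp 1 *
    Real.exp (-((1 + -Real.log r) * Real.exp (-c))) * hc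

theorem tendsto_osgoodModulus (c : ℝ) : Tendsto (osgoodModulus c) (𝓝[>] 0) (𝓝 0) := by
  refine squeeze_zero' (.of_forall fun r => (osgoodModulus_pos c r).le) ?_
    (tendsto_one_sub_log_mul_osgoodModulus c)
  filter_upwards [Ioo_mem_nhdsGT (zero_lt_one' ℝ)] with r hr
  have := Real.log_nonpos hr.1.le hr.2.le
  exact le_mul_of_one_le_left (osgoodModulus_pos c r).le (by linarith)

/-! ### Log-Lipschitz and Osgood vector fields -/

section Osgood

variable {E : Type*} [NormedAddCommGroup E]

/-- The field `v` is log-Lipschitz, uniformly in the time interval `[-T, T]`; taking `ε = ‖x - y‖`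
recovers the usual modulus of continuity `r (1 - log r)`. -/
def LogLipOn (v : ℝ → E → E) (M T : ℝ) : Prop :=
  ∀ t ∈ Icc (-T) T, ∀ x y, ∀ ε, 0 < ε → ε ≤ 1 →
    ‖v t x - v t y‖ ≤ M * ((1 - Real.log ε) * ‖x - y‖ + ε)

theorem LogLipOn.exists_norm_sub_le {v : ℝ → E → E} {M T : ℝ} (h : LogLipOn v M T)
    (hM : 0 ≤ M) {δ : ℝ} (hδ : 0 < δ) :
    ∃ η > 0, ∀ t ∈ Icc (-T) T, ∀ x y, ‖x - y‖ ≤ η → ‖v t x - v t y‖ ≤ δ := by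
  set ε := min 1 (δ / (2 * (M + 1)))
  have hε : 0 < ε := by positivity
  have hlog := Real.log_nonpos hε.le (min_le_left _ _)
  have hMε : (M + 1) * ε ≤ δ / 2 := by
    have := (le_div_iff₀' (by positivity)).1 (min_le_right 1 (δ / (2 * (M + 1))))
    linarith
  refine ⟨ε / (1 - Real.log ε), div_pos hε (by linarith), fun t ht x y hxy => ?_⟩
  have hxy' := (le_div_iff₀' (by linarith)).1 hxy
  calc ‖v t x - v t y‖ ≤ M * ((1 - Real.log ε) * ‖x - y‖ + ε) := h t ht x y ε hε (min_le_left _ _)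
    _ ≤ M * (ε + ε) := by gcongr
    _ ≤ δ := by linarith

/-- Continuous, locally in time bounded vector fields that are approximated up to `ε` by Lipschitz
fields with constant of order `log (1 / ε)`. -/
structure IsOsgoodField (v : ℝ → E → E) : Prop where
  continuous : Continuous (Function.uncurry v)
  exists_approx : ∀ T, ∃ M, 0 ≤ M ∧ ∀ ε, 0 < ε → ε ≤ 1 → ∃ w : ℝ → E → E,
    Continuous (Function.uncurry w) ∧ ∀ t ∈ Icc (-T) T,
      (∀ x y, ‖w t x - w t y‖ ≤ M * (1 - Real.log ε) * ‖x - y‖) ∧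
      ∀ x, ‖w t x‖ ≤ M ∧ ‖w t x - v t x‖ ≤ M * ε

/-- Continuous vector fields that are bounded and Lipschitz in space, locally uniformly in time. -/
structure IsLipschitzField (v : ℝ → E → E) : Prop where
  continuous : Continuous (Function.uncurry v)
  exists_bound : ∀ T, ∃ M, 0 ≤ M ∧ ∀ t ∈ Icc (-T) T,
    (∀ x y, ‖v t x - v t y‖ ≤ M * ‖x - y‖) ∧ ∀ x, ‖v t x‖ ≤ M

theorem IsLipschitzField.isOsgoodField {v : ℝ → E → E} (hv : IsLipschitzField v) :
    IsOsgoodField v := by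
  refine ⟨hv.continuous, fun T => ?_⟩
  obtain ⟨M, hM, h⟩ := hv.exists_bound T
  refine ⟨M, hM, fun ε hε hε1 =>
    ⟨v, hv.continuous, fun t ht => ⟨fun x y => ?_, fun x => ⟨(h t ht).2 x, ?_⟩⟩⟩⟩
  · refine ((h t ht).1 x y).trans ?_
    have := Real.log_nonpos hε.le hε1
    gcongr
    exact le_mul_of_one_le_right hM (by linarith)
  · simpa using mul_nonneg hM hε.le

namespace IsOsgoodField

variable {v : ℝ → E → E}

theorem exists_logLipOn (hv : IsOsgoodField v) (T : ℝ) :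
    ∃ M, 0 ≤ M ∧ LogLipOn v M T ∧ ∀ t ∈ Icc (-T) T, ∀ x, ‖v t x‖ ≤ M := by
  obtain ⟨M, hM, H⟩ := hv.exists_approx T
  refine ⟨2 * M, by positivity, fun t ht x y ε hε hε1 => ?_, fun t ht x => ?_⟩
  · obtain ⟨w, -, hw⟩ := H ε hε hε1
    obtain ⟨hlip, hwv⟩ := hw t ht
    have hlog := Real.log_nonpos hε.le hε1
    have : 0 ≤ M * ((1 - Real.log ε) * ‖x - y‖) :=
      mul_nonneg hM (mul_nonneg (by linarith) (norm_nonneg _))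
    calc ‖v t x - v t y‖ = ‖(w t x - w t y) - (w t x - v t x) + (w t y - v t y)‖ := by
          congr 1; abel
      _ ≤ M * (1 - Real.log ε) * ‖x - y‖ + M * ε + M * ε :=
          norm_add_le_of_le (norm_sub_le_of_le (hlip x y) (hwv x).2) (hwv y).2
      _ ≤ 2 * M * ((1 - Real.log ε) * ‖x - y‖ + ε) := by linarith
  · obtain ⟨w, -, hw⟩ := H 1 one_pos le_rfl
    obtain ⟨hwM, hwv⟩ := (hw t ht).2 x
    calc ‖v t x‖ = ‖w t x - (w t x - v t x)‖ := by congr 1; abel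
      _ ≤ M + M * 1 := norm_sub_le_of_le hwM hwv
      _ = 2 * M := by ring

end IsOsgoodField

/-! ### Stability of integral curves of log-Lipschitz fields -/

variable [NormedSpace ℝ E]

/-- The bound on `f'` is only used with `ε = ‖f t‖` at a first time where `‖f t‖` meets the
barrier `osgoodModulus ((2 * C + 1) * (t - a)) r`, whose derivative is strictly larger there. -/
theorem norm_le_osgoodModulus_of_le {f f' : ℝ → E} {a b C r : ℝ} (hab : a ≤ b) (hC : 0 ≤ C)
    (hr : 0 < r) (hr1 : r ≤ 1) (hB : osgoodModulus ((2 * C + 1) * (b - a)) r ≤ 1)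
    (hf : ∀ t ∈ Icc a b, HasDerivWithinAt f (f' t) (Icc a b) t) (ha : ‖f a‖ ≤ r)
    (hbd : ∀ t ∈ Icc a b, ∀ ε, r ≤ ε → ε ≤ 1 →
      ‖f' t‖ ≤ C * ((1 - Real.log ε) * ‖f t‖ + ε)) :
    ‖f b‖ ≤ osgoodModulus ((2 * C + 1) * (b - a)) r := by
  set B : ℝ → ℝ := fun t => osgoodModulus ((2 * C + 1) * (t - a)) r with hBdef
  have hBderiv (t : ℝ) : HasDerivAt B (B t * (1 - Real.log (B t)) * (2 * C + 1)) t := by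
    have hlin : HasDerivAt (fun t => (2 * C + 1) * (t - a)) (2 * C + 1) t := by
      simpa using ((hasDerivAt_id t).sub_const a).const_mul (2 * C + 1)
    exact (hasDerivAt_osgoodModulus _ r).comp t hlin
  have hrB : ∀ t ∈ Ico a b, r ≤ B t := fun t ht =>
    (osgoodModulus_zero hr).symm.trans_le <| osgoodModulus_le_osgoodModulus hr hr1 <|
      mul_nonneg (by positivity) (sub_nonneg.2 ht.1)
  have hB1 : ∀ t ∈ Ico a b, B t ≤ 1 := fun t ht => by
    refine (osgoodModulus_le_osgoodModulus hr hr1 ?_).trans hB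
    gcongr
    exact ht.2.le
  refine image_norm_le_of_norm_deriv_right_lt_deriv_boundary
    (fun t ht => (hf t ht).continuousWithinAt)
    (fun t ht => (hf t (Ico_subset_Icc_self ht)).mono_of_mem_nhdsWithin
      (Icc_mem_nhdsGE_of_mem ht))
    (by simpa [hBdef, osgoodModulus_zero hr] using ha) hBderiv (fun t ht heq => ?_)
    (right_mem_Icc.2 hab)
  have hpos : 0 < B t := osgoodModulus_pos _ _
  have hlog : Real.log (B t) ≤ 0 := Real.log_nonpos hpos.le (hB1 t ht)
  have h := hbd t (Ico_subset_Icc_self ht) (B t) (hrB t ht) (hB1 t ht)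
  rw [heq] at h
  calc ‖f' t‖ ≤ C * ((1 - Real.log (B t)) * B t + B t) := h
    _ ≤ C * (2 * ((1 - Real.log (B t)) * B t)) := by
        gcongr
        nlinarith
    _ < B t * (1 - Real.log (B t)) * (2 * C + 1) := by
        have : 0 < B t * (1 - Real.log (B t)) := mul_pos hpos (by linarith)
        linarith

theorem norm_le_osgoodModulus {f f' : ℝ → E} {T t₀ C r : ℝ} (ht₀ : t₀ ∈ Icc (-T) T)
    (hC : 0 ≤ C) (hr : 0 < r) (hr1 : r ≤ 1) (hB : osgoodModulus ((2 * C + 1) * (2 * T)) r ≤ 1)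
    (hf : ∀ t ∈ Icc (-T) T, HasDerivWithinAt f (f' t) (Icc (-T) T) t) (ha : ‖f t₀‖ ≤ r)
    (hbd : ∀ t ∈ Icc (-T) T, ∀ ε, r ≤ ε → ε ≤ 1 →
      ‖f' t‖ ≤ C * ((1 - Real.log ε) * ‖f t‖ + ε)) :
    ∀ t ∈ Icc (-T) T, ‖f t‖ ≤ osgoodModulus ((2 * C + 1) * (2 * T)) r := by
  intro t ht
  have hmono : ∀ d ≤ 2 * T, osgoodModulus ((2 * C + 1) * d) r ≤
      osgoodModulus ((2 * C + 1) * (2 * T)) r := fun d hd =>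
    osgoodModulus_le_osgoodModulus hr hr1 (by gcongr)
  rcases le_total t₀ t with h | h
  · have hle := hmono (t - t₀) (by linarith [ht.2, ht₀.1])
    have hsub : Icc t₀ t ⊆ Icc (-T) T := Icc_subset_Icc ht₀.1 ht.2
    exact (norm_le_osgoodModulus_of_le h hC hr hr1 (hle.trans hB)
      (fun s hs => (hf s (hsub hs)).mono hsub) ha (fun s hs => hbd s (hsub hs))).trans hle
  · have hle := hmono (-t - -t₀) (by linarith [ht.1, ht₀.2])
    have hmem : MapsTo (fun s => -s) (Icc (-t₀) (-t)) (Icc (-T) T) := fun s hs =>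
      ⟨by linarith [hs.2, ht.1], by linarith [hs.1, ht₀.2]⟩
    have hrev := norm_le_osgoodModulus_of_le (f := fun s => f (-s)) (f' := fun s => -f' (-s))
      (neg_le_neg h) hC hr hr1 (hle.trans hB)
      (fun s hs => by
        simpa [Function.comp_def] using
          (hf (-s) (hmem hs)).scomp s (hasDerivAt_neg s).hasDerivWithinAt hmem)
      (by simpa using ha)
      (fun s hs ε hrε hε1 => by simpa using hbd (-s) (hmem hs) ε hrε hε1)
    rw [neg_neg] at hrev
    exact hrev.trans hle

/-- The curve `γ` solves the differential equation of `v` on `s` up to an error `r`. -/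
def IsApproxIntegralCurveOn (γ : ℝ → E) (v : ℝ → E → E) (s : Set ℝ) (r : ℝ) : Prop :=
  ∃ γ' : ℝ → E, ∀ t ∈ s, HasDerivWithinAt γ (γ' t) s t ∧ ‖γ' t - v t (γ t)‖ ≤ r

namespace IsApproxIntegralCurveOn

variable {γ : ℝ → E} {v : ℝ → E → E} {s : Set ℝ} {r : ℝ}

theorem mono (hγ : IsApproxIntegralCurveOn γ v s r) {s' : Set ℝ} {r' : ℝ} (hs : s' ⊆ s)
    (hr : r ≤ r') : IsApproxIntegralCurveOn γ v s' r' :=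
  let ⟨γ', h⟩ := hγ
  ⟨γ', fun t ht => ⟨(h t (hs ht)).1.mono hs, (h t (hs ht)).2.trans hr⟩⟩

theorem hasDerivAt (hγ : IsApproxIntegralCurveOn γ v s r) {t : ℝ} (hs : s ∈ 𝓝 t) :
    HasDerivAt γ (deriv γ t) t ∧ ‖deriv γ t - v t (γ t)‖ ≤ r := by
  obtain ⟨γ', h⟩ := hγ
  obtain ⟨hderiv, hle⟩ := h t (mem_of_mem_nhds hs)
  rw [(hderiv.hasDerivAt hs).deriv]
  exact ⟨hderiv.hasDerivAt hs, hle⟩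

end IsApproxIntegralCurveOn

theorem isApproxIntegralCurveOn_of_norm_sub_le {γ : ℝ → E} {v w : ℝ → E → E} {s : Set ℝ} {r : ℝ}
    (hγ : IsIntegralCurveOn γ w s) (hwv : ∀ t ∈ s, ∀ x, ‖w t x - v t x‖ ≤ r) :
    IsApproxIntegralCurveOn γ v s r :=
  ⟨fun t => w t (γ t), fun t ht => ⟨hγ t ht, hwv t ht _⟩⟩

theorem isApproxIntegralCurveOn_of_isIntegralCurve {γ : ℝ → E} {v : ℝ → E → E} (s : Set ℝ) {r : ℝ}
    (hr : 0 ≤ r) (hγ : IsIntegralCurve γ v) : IsApproxIntegralCurveOn γ v s r :=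
  isApproxIntegralCurveOn_of_norm_sub_le (hγ.isIntegralCurveOn s) fun t _ x => by simpa using hr

namespace LogLipOn

variable {v : ℝ → E → E} {M T : ℝ}

theorem norm_integralCurve_sub_le (h : LogLipOn v M T) (hM : 0 ≤ M) {r : ℝ} (hr : 0 < r)
    (hr1 : r ≤ 1) (hB : osgoodModulus ((2 * (M + 2) + 1) * (2 * T)) r ≤ 1) {x y : ℝ → E} {t₀ : ℝ}
    (ht₀ : t₀ ∈ Icc (-T) T) (hx : IsApproxIntegralCurveOn x v (Icc (-T) T) r)
    (hy : IsApproxIntegralCurveOn y v (Icc (-T) T) r) (h₀ : ‖x t₀ - y t₀‖ ≤ r) :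
    ∀ t ∈ Icc (-T) T, ‖x t - y t‖ ≤ osgoodModulus ((2 * (M + 2) + 1) * (2 * T)) r := by
  obtain ⟨x', hx⟩ := hx
  obtain ⟨y', hy⟩ := hy
  refine norm_le_osgoodModulus (f := fun t => x t - y t) (f' := fun t => x' t - y' t) ht₀
    (by positivity) hr hr1 hB (fun t ht => (hx t ht).1.sub (hy t ht).1) h₀
    fun t ht ε hrε hε1 => ?_
  have hlog := Real.log_nonpos (hr.le.trans hrε) hε1
  have hd : 0 ≤ (1 - Real.log ε) * ‖x t - y t‖ := mul_nonneg (by linarith) (norm_nonneg _)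
  calc ‖x' t - y' t‖
      = ‖(x' t - v t (x t)) - (y' t - v t (y t)) + (v t (x t) - v t (y t))‖ := by congr 1; abel
    _ ≤ r + r + M * ((1 - Real.log ε) * ‖x t - y t‖ + ε) :=
        norm_add_le_of_le (norm_sub_le_of_le (hx t ht).2 (hy t ht).2)
          (h t ht _ _ ε (hr.trans_le hrε) hε1)
    _ ≤ (M + 2) * ((1 - Real.log ε) * ‖x t - y t‖ + ε) := by linarith

theorem exists_norm_integralCurve_sub_le (h : LogLipOn v M T) (hM : 0 ≤ M) {δ : ℝ} (hδ : 0 < δ) :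
    ∃ r > 0, ∀ x y : ℝ → E, ∀ t₀ ∈ Icc (-T) T,
      IsApproxIntegralCurveOn x v (Icc (-T) T) r → IsApproxIntegralCurveOn y v (Icc (-T) T) r →
      ‖x t₀ - y t₀‖ ≤ r → ∀ t ∈ Icc (-T) T, ‖x t - y t‖ ≤ δ := by
  obtain ⟨r, hB, hr⟩ := (((tendsto_osgoodModulus ((2 * (M + 2) + 1) * (2 * T))).eventually
    (ge_mem_nhds (lt_min hδ one_pos))).and (Ioo_mem_nhdsGT (zero_lt_one' ℝ))).exists
  exact ⟨r, hr.1, fun x y t₀ ht₀ hx hy h₀ t ht =>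
    (h.norm_integralCurve_sub_le hM hr.1 hr.2.le (hB.trans (min_le_right _ _)) ht₀ hx hy h₀
      t ht).trans (hB.trans (min_le_left _ _))⟩

end LogLipOn

/-! ### The flow of an Osgood field -/

theorem exists_isIntegralCurveOn_of_lipschitz [CompleteSpace E] {w : ℝ → E → E} {T t₀ M L : ℝ}
    (hM : 0 ≤ M) (hL : 0 ≤ L) (hw : Continuous (Function.uncurry w))
    (hwL : ∀ t ∈ Icc (-T) T, ∀ x y, ‖w t x - w t y‖ ≤ L * ‖x - y‖)
    (hwM : ∀ t ∈ Icc (-T) T, ∀ x, ‖w t x‖ ≤ M) (ht₀ : t₀ ∈ Icc (-T) T) (x₀ : E) :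
    ∃ x : ℝ → E, x t₀ = x₀ ∧ IsIntegralCurveOn x w (Icc (-T) T) := by
  have hT : 0 ≤ T := by linarith [ht₀.1, ht₀.2]
  have hPL : IsPicardLindelof w (⟨t₀, ht₀⟩ : Icc (-T) T) x₀ (⟨M, hM⟩ * ⟨2 * T, by positivity⟩) 0
      ⟨M, hM⟩ ⟨L, hL⟩ := by
    refine ⟨fun t ht => ?_, fun x _ => ?_, fun t ht x _ => hwM t ht x, ?_⟩
    · exact (LipschitzWith.of_dist_le_mul fun x y => by
        rw [dist_eq_norm, dist_eq_norm]; exact hwL t ht x y).lipschitzOnWith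
    · exact (hw.comp (continuous_id.prodMk continuous_const)).continuousOn
    · change M * max (T - t₀) (t₀ - -T) ≤ M * (2 * T) - 0
      rw [sub_zero]
      gcongr
      exact max_le (by linarith [ht₀.1]) (by linarith [ht₀.2])
  exact hPL.exists_eq_forall_mem_Icc_hasDerivWithinAt₀

namespace IsOsgoodField

variable {v : ℝ → E → E}

theorem integralCurve_unique (hv : IsOsgoodField v) {x y : ℝ → E} {t₀ : ℝ}
    (hx : IsIntegralCurve x v) (hy : IsIntegralCurve y v) (h₀ : x t₀ = y t₀) : x = y := by
  funext t
  obtain ⟨M, hM, hlog, -⟩ := hv.exists_logLipOn (max |t₀| |t|)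
  refine sub_eq_zero.1 (norm_le_zero_iff.1 (le_of_forall_pos_le_add fun δ hδ => ?_))
  obtain ⟨r, hr, hstab⟩ := hlog.exists_norm_integralCurve_sub_le hM hδ
  rw [zero_add]
  exact hstab x y t₀ (abs_le.1 (le_max_left _ _))
    (isApproxIntegralCurveOn_of_isIntegralCurve _ hr.le hx)
    (isApproxIntegralCurveOn_of_isIntegralCurve _ hr.le hy) (by simpa [h₀] using hr.le)
    t (abs_le.1 (le_max_right _ _))

theorem exists_isApproxIntegralCurveOn [CompleteSpace E] (hv : IsOsgoodField v) {T t₀ r : ℝ}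
    (ht₀ : t₀ ∈ Icc (-T) T) (hr : 0 < r) (x₀ : E) :
    ∃ x : ℝ → E, x t₀ = x₀ ∧ IsApproxIntegralCurveOn x v (Icc (-T) T) r := by
  obtain ⟨M, hM, H⟩ := hv.exists_approx T
  have hε : 0 < min 1 (r / (M + 1)) := by positivity
  have hMε : M * min 1 (r / (M + 1)) ≤ r := by
    have := (le_div_iff₀' (by positivity)).1 (min_le_right 1 (r / (M + 1)))
    linarith
  obtain ⟨w, hwc, hw⟩ := H _ hε (min_le_left _ _)
  have hlog := Real.log_nonpos hε.le (min_le_left _ _)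
  obtain ⟨x, hx₀, hx⟩ := exists_isIntegralCurveOn_of_lipschitz hM
    (mul_nonneg hM (by linarith)) hwc (fun t ht => (hw t ht).1)
    (fun t ht x => ((hw t ht).2 x).1) ht₀ x₀
  exact ⟨x, hx₀, isApproxIntegralCurveOn_of_norm_sub_le hx
    fun t ht x => ((hw t ht).2 x).2.trans hMε⟩

theorem uniformCauchySeqOn_of_isApproxIntegralCurveOn (hv : IsOsgoodField v) {x : ℕ → ℝ → E}
    {T t₀ : ℝ} (ht₀ : t₀ ∈ Icc (-T) T) {x₀ : E} (hx₀ : ∀ n, x n t₀ = x₀)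
    (hx : ∀ r > 0, ∀ᶠ n in atTop, IsApproxIntegralCurveOn (x n) v (Icc (-T) T) r) :
    UniformCauchySeqOn x atTop (Icc (-T) T) := by
  obtain ⟨M, hM, hlog, -⟩ := hv.exists_logLipOn T
  rw [Metric.uniformCauchySeqOn_iff]
  intro δ hδ
  obtain ⟨r, hr, hstab⟩ := hlog.exists_norm_integralCurve_sub_le hM (half_pos hδ)
  obtain ⟨N, hN⟩ := eventually_atTop.1 (hx r hr)
  refine ⟨N, fun m hm n hn t ht => ?_⟩
  rw [dist_eq_norm]
  exact (hstab _ _ t₀ ht₀ (hN m hm) (hN n hn) (by simpa [hx₀] using hr.le) t ht).trans_lt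
    (half_lt_self hδ)

theorem isIntegralCurve_of_tendstoUniformlyOn (hv : IsOsgoodField v) {x : ℕ → ℝ → E} {y : ℝ → E}
    (hx : ∀ T, ∀ r > 0, ∀ᶠ n in atTop, IsApproxIntegralCurveOn (x n) v (Icc (-T) T) r)
    (hxy : ∀ T, TendstoUniformlyOn x y atTop (Icc (-T) T)) : IsIntegralCurve y v := by
  intro t₀
  set T := |t₀| + 1
  have ht₀ : t₀ ∈ Ioo (-T) T := abs_lt.1 (lt_add_one _)
  have hderiv : ∀ r > 0, ∀ᶠ n in atTop, ∀ t ∈ Ioo (-T) T,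
      HasDerivAt (x n) (deriv (x n) t) t ∧ ‖deriv (x n) t - v t (x n t)‖ ≤ r := fun r hr =>
    (hx T r hr).mono fun n hn t ht => hn.hasDerivAt (Icc_mem_nhds ht.1 ht.2)
  refine hasDerivAt_of_tendstoUniformlyOn (f := x) (f' := fun n t => deriv (x n) t)
    (g' := fun t => v t (y t)) (l := atTop) isOpen_Ioo ?_
    ((hderiv 1 one_pos).mono fun n hn t ht => (hn t ht).1)
    (fun t ht => (hxy T).tendsto_at (Ioo_subset_Icc_self ht)) ht₀
  obtain ⟨M, hM, hlog, -⟩ := hv.exists_logLipOn T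
  rw [Metric.tendstoUniformlyOn_iff]
  intro δ hδ
  obtain ⟨η, hη, hvη⟩ := hlog.exists_norm_sub_le hM (half_pos hδ)
  filter_upwards [hderiv (δ / 3) (by positivity), Metric.tendstoUniformlyOn_iff.1 (hxy T) η hη]
    with n hn hxyn t ht
  have ht' := Ioo_subset_Icc_self ht
  have hvxy := hvη t ht' (y t) (x n t) (by rw [← dist_eq_norm]; exact (hxyn t ht').le)
  rw [dist_comm, dist_eq_norm]
  calc ‖deriv (x n) t - v t (y t)‖
      = ‖(deriv (x n) t - v t (x n t)) - (v t (y t) - v t (x n t))‖ := by congr 1; abel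
    _ ≤ δ / 3 + δ / 2 := norm_sub_le_of_le (hn t ht).2 hvxy
    _ < δ := by linarith

variable [CompleteSpace E]

theorem exists_isIntegralCurve (hv : IsOsgoodField v) (t₀ : ℝ) (x₀ : E) :
    ∃ x : ℝ → E, x t₀ = x₀ ∧ IsIntegralCurve x v := by
  have ht₀ (n : ℕ) : t₀ ∈ Icc (-(|t₀| + n)) (|t₀| + n) :=
    abs_le.1 (le_add_of_nonneg_right n.cast_nonneg)
  choose x hx₀ hx using fun n : ℕ => hv.exists_isApproxIntegralCurveOn (ht₀ n)
    (Nat.one_div_pos_of_nat (α := ℝ) (n := n)) x₀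
  have hxT : ∀ T, ∀ r > 0, ∀ᶠ n in atTop, IsApproxIntegralCurveOn (x n) v (Icc (-T) T) r := by
    intro T r hr
    filter_upwards [tendsto_one_div_add_atTop_nhds_zero_nat.eventually (ge_mem_nhds hr),
      eventually_ge_atTop ⌈T⌉₊] with n hnr hnT
    have hTn : T ≤ |t₀| + n := (Nat.ceil_le.1 hnT).trans (le_add_of_nonneg_left (abs_nonneg _))
    exact (hx n).mono (Icc_subset_Icc (neg_le_neg hTn) hTn) hnr
  have hcauchy (T : ℝ) : UniformCauchySeqOn x atTop (Icc (-max |t₀| T) (max |t₀| T)) :=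
    hv.uniformCauchySeqOn_of_isApproxIntegralCurveOn (abs_le.1 (le_max_left _ _)) hx₀ (hxT _)
  set y : ℝ → E := fun t => limUnder atTop fun n => x n t
  have hy (t : ℝ) : Tendsto (fun n => x n t) atTop (𝓝 (y t)) :=
    ((hcauchy |t|).cauchySeq (abs_le.1 (le_max_right _ _))).tendsto_limUnder
  refine ⟨y, tendsto_nhds_unique (hy t₀) (by simp [hx₀]),
    hv.isIntegralCurve_of_tendstoUniformlyOn hxT fun T => ?_⟩
  exact ((hcauchy T).tendstoUniformlyOn_of_tendsto fun t _ => hy t).mono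
    (Icc_subset_Icc (neg_le_neg (le_max_right _ _)) (le_max_right _ _))

/-- The flow of `v` from time `s` to time `t`. -/
def flow (hv : IsOsgoodField v) (s t : ℝ) (x : E) : E :=
  (hv.exists_isIntegralCurve s x).choose t

@[simp] theorem flow_self (hv : IsOsgoodField v) (s : ℝ) (x : E) : hv.flow s s x = x :=
  (hv.exists_isIntegralCurve s x).choose_spec.1

theorem isIntegralCurve_flow (hv : IsOsgoodField v) (s : ℝ) (x : E) :
    IsIntegralCurve (fun t => hv.flow s t x) v :=
  (hv.exists_isIntegralCurve s x).choose_spec.2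

theorem flow_eq (hv : IsOsgoodField v) {y : ℝ → E} (hy : IsIntegralCurve y v) (s t : ℝ) :
    hv.flow s t (y s) = y t :=
  congr_fun (hv.integralCurve_unique (hv.isIntegralCurve_flow s (y s)) hy
    (hv.flow_self s (y s))) t

@[simp] theorem flow_flow (hv : IsOsgoodField v) (r s t : ℝ) (x : E) :
    hv.flow s t (hv.flow r s x) = hv.flow r t x :=
  hv.flow_eq (hv.isIntegralCurve_flow r x) s t

theorem norm_flow_sub_flow_le (hv : IsOsgoodField v) {M T : ℝ}
    (hM : ∀ t ∈ Icc (-T) T, ∀ x, ‖v t x‖ ≤ M) (r : ℝ) {s t : ℝ} (hs : s ∈ Icc (-T) T)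
    (ht : t ∈ Icc (-T) T) (x : E) : ‖hv.flow r t x - hv.flow r s x‖ ≤ M * |t - s| :=
  (convex_Icc (-T) T).norm_image_sub_le_of_norm_hasDerivWithin_le
    (fun τ _ => (hv.isIntegralCurve_flow r x τ).hasDerivWithinAt) (fun τ hτ => hM τ hτ _) hs ht

theorem exists_norm_flow_sub_le (hv : IsOsgoodField v) (T : ℝ) {δ : ℝ} (hδ : 0 < δ) :
    ∃ r > 0, ∀ s ∈ Icc (-T) T, ∀ x y, ‖x - y‖ ≤ r →
      ∀ t ∈ Icc (-T) T, ‖hv.flow s t x - hv.flow s t y‖ ≤ δ := by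
  obtain ⟨M, hM, hlog, -⟩ := hv.exists_logLipOn T
  obtain ⟨r, hr, hstab⟩ := hlog.exists_norm_integralCurve_sub_le hM hδ
  have happrox (s : ℝ) (x : E) :=
    isApproxIntegralCurveOn_of_isIntegralCurve (Icc (-T) T) hr.le (hv.isIntegralCurve_flow s x)
  exact ⟨r, hr, fun s hs x y hxy =>
    hstab _ _ s hs (happrox s x) (happrox s y) (by simpa using hxy)⟩

theorem exists_flow_modulus (hv : IsOsgoodField v) (T : ℝ) : ∃ κ : ℝ → ℝ,
    Tendsto (fun r => (1 - Real.log r) * κ r) (𝓝[>] 0) (𝓝 0) ∧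
    ∀ᶠ r in 𝓝[>] 0, ∀ s ∈ Icc (-T) T, ∀ x y, ‖x - y‖ ≤ r →
      ∀ t ∈ Icc (-T) T, ‖hv.flow s t x - hv.flow s t y‖ ≤ κ r := by
  obtain ⟨M, hM, hlog, -⟩ := hv.exists_logLipOn T
  refine ⟨_, tendsto_one_sub_log_mul_osgoodModulus ((2 * (M + 2) + 1) * (2 * T)), ?_⟩
  filter_upwards [(tendsto_osgoodModulus _).eventually (ge_mem_nhds one_pos),
    Ioo_mem_nhdsGT (zero_lt_one' ℝ)] with r hB hr s hs x y hxy
  have happrox (x : E) := isApproxIntegralCurveOn_of_isIntegralCurve (Icc (-T) T) hr.1.le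
    (hv.isIntegralCurve_flow s x)
  exact hlog.norm_integralCurve_sub_le hM hr.1 hr.2.le hB hs (happrox x) (happrox y)
    (by simpa using hxy)

theorem continuous_flow (hv : IsOsgoodField v) (s : ℝ) :
    Continuous (Function.uncurry (hv.flow s)) := by
  rw [continuous_iff_continuousAt]
  rintro ⟨t₀, x₀⟩
  rw [ContinuousAt, Metric.tendsto_nhds]
  intro δ hδ
  set T := max |s| (|t₀| + 1)
  obtain ⟨r, hr, hflow⟩ := hv.exists_norm_flow_sub_le T (half_pos hδ)
  have hspace : ∀ᶠ p : ℝ × E in 𝓝 (t₀, x₀), dist p.2 x₀ < r :=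
    continuous_snd.continuousAt.eventually (Metric.ball_mem_nhds _ hr)
  have htime : ∀ᶠ p : ℝ × E in 𝓝 (t₀, x₀), |p.1| < |t₀| + 1 :=
    (continuous_abs.comp continuous_fst).continuousAt.eventually (gt_mem_nhds (by simp))
  have hcurve : ∀ᶠ p : ℝ × E in 𝓝 (t₀, x₀),
      dist (hv.flow s p.1 x₀) (hv.flow s t₀ x₀) < δ / 2 :=
    ((hv.isIntegralCurve_flow s x₀).continuous.comp continuous_fst).continuousAt.eventually
      (Metric.ball_mem_nhds _ (half_pos hδ))
  filter_upwards [hspace, htime, hcurve] with p hp₂ hp₁ hp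
  rw [dist_eq_norm] at hp₂
  have hp₀ := hflow s (abs_le.1 (le_max_left _ _)) p.2 x₀ hp₂.le p.1
    (abs_le.1 (hp₁.le.trans (le_max_right _ _)))
  rw [← dist_eq_norm] at hp₀
  calc dist (hv.flow s p.1 p.2) (hv.flow s t₀ x₀)
      ≤ dist (hv.flow s p.1 p.2) (hv.flow s p.1 x₀) +
        dist (hv.flow s p.1 x₀) (hv.flow s t₀ x₀) := dist_triangle _ _ _
    _ < δ := by linarith

theorem continuous_flow_right (hv : IsOsgoodField v) (s t : ℝ) : Continuous (hv.flow s t) :=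
  (hv.continuous_flow s).comp (continuous_const.prodMk continuous_id)

/-- The flow from time `s` to time `t`, as a homeomorphism. -/
def flowHomeo (hv : IsOsgoodField v) (s t : ℝ) : E ≃ₜ E where
  toFun := hv.flow s t
  invFun := hv.flow t s
  left_inv x := by simp
  right_inv x := by simp
  continuous_toFun := hv.continuous_flow_right s t
  continuous_invFun := hv.continuous_flow_right t s

end IsOsgoodField

end Osgood

/-! ### Volume-preserving flows -/

theorem norm_sub_le_indicator_cthickening {E : Type*} [NormedAddCommGroup E] {f : E → ℝ} {C : ℝ≥0}
    (hf : LipschitzWith C f) {x y : E} {d r : ℝ} (hxy : ‖x - y‖ ≤ d) (hdr : d ≤ r) :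
    ‖f x - f y‖ ≤ (Metric.cthickening r (tsupport f)).indicator (fun _ => C * d) x := by
  by_cases hx : x ∈ Metric.cthickening r (tsupport f)
  · rw [indicator_of_mem hx]
    exact hf.norm_sub_le_of_le hxy
  · have hfar (z : E) (hz : dist x z ≤ r) : f z = 0 := by
      by_contra hne
      exact hx (Metric.mem_cthickening_of_dist_le x z r _ (subset_tsupport f hne) hz)
    have hy : dist x y ≤ r := (dist_eq_norm x y).trans_le (hxy.trans hdr)
    simp [indicator_of_notMem hx, hfar y hy, hfar x (dist_self x ▸ dist_nonneg.trans hy)]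

namespace IsOsgoodField

variable {E : Type*} [NormedAddCommGroup E] [NormedSpace ℝ E] [CompleteSpace E] {v : ℝ → E → E}

theorem tendsto_flow_diag (hv : IsOsgoodField v) (t : ℝ) (x : E) :
    Tendsto (fun p : ℝ × ℝ => hv.flow p.1 p.2 x) (𝓝 (t, t)) (𝓝 x) := by
  obtain ⟨M, -, -, hM⟩ := hv.exists_logLipOn (|t| + 1)
  have hlim : Tendsto (fun p : ℝ × ℝ => M * |p.2 - p.1|) (𝓝 (t, t)) (𝓝 0) := by
    have hcont : Continuous fun p : ℝ × ℝ => M * |p.2 - p.1| := by fun_prop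
    simpa using hcont.tendsto (t, t)
  have hIoo : Ioo (-(|t| + 1)) (|t| + 1) ∈ 𝓝 t :=
    Ioo_mem_nhds (by linarith [neg_abs_le t]) (by linarith [le_abs_self t])
  refine tendsto_iff_norm_sub_tendsto_zero.2
    (squeeze_zero' (.of_forall fun _ => norm_nonneg _) ?_ hlim)
  filter_upwards [prod_mem_nhds hIoo hIoo] with p hp
  simpa using
    hv.norm_flow_sub_flow_le hM p.1 (Ioo_subset_Icc_self hp.1) (Ioo_subset_Icc_self hp.2) x

theorem hasDerivAt_flow_left_self (hv : IsOsgoodField v) (t : ℝ) (x : E) :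
    HasDerivAt (fun s => hv.flow s t x) (-(v t x)) t := by
  have hlim : Tendsto (fun p : ℝ × ℝ => v p.2 (hv.flow p.1 p.2 x)) (𝓝 (t, t)) (𝓝 (v t x)) :=
    (hv.continuous.tendsto (t, x)).comp
      ((continuous_snd.tendsto (t, t)).prodMk_nhds (hv.tendsto_flow_diag t x))
  refine hasDerivAt_iff_isLittleO.2 (Asymptotics.isLittleO_iff.2 fun c hc => ?_)
  obtain ⟨δ, hδ, hnear⟩ := Metric.eventually_nhds_iff_ball.1
    (hlim.eventually (Metric.closedBall_mem_nhds _ hc))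
  filter_upwards [Metric.ball_mem_nhds t hδ] with s hs
  have hmean := (convex_uIcc t s).norm_image_sub_le_of_norm_hasDerivWithin_le
    (f := fun τ => hv.flow s τ x - τ • v t x) (C := c)
    (fun τ _ => ((hv.isIntegralCurve_flow s x τ).sub
      ((hasDerivAt_id τ).smul_const (v t x))).hasDerivWithinAt)
    (fun τ hτ => ?_) right_mem_uIcc left_mem_uIcc
  · rw [hv.flow_self, ← norm_neg (s - t), neg_sub] at *
    convert hmean using 2
    simp only [smul_neg]
    module
  · have hτ' : dist τ t < δ := (Real.dist_right_le_of_mem_uIcc (uIcc_comm t s ▸ hτ)).trans_lt hs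
    simpa [dist_eq_norm] using hnear (s, τ) (by simpa [Prod.dist_eq] using ⟨hs, hτ'⟩)

section Haar

variable [FiniteDimensional ℝ E] [MeasurableSpace E] [BorelSpace E] {μ : Measure E}

theorem hasDerivAt_integral_comp_flow_left_self [μ.IsAddHaarMeasure] (hv : IsOsgoodField v) {t : ℝ}
    (hdiv : IsWeaklyDivFree μ (v t)) {f : E → ℝ} {C : ℝ≥0} (hf : LipschitzWith C f)
    (hf' : HasCompactSupport f) : HasDerivAt (fun s => ∫ x, f (hv.flow s t x) ∂μ) 0 t := by
  obtain ⟨M, hM, -, hvM⟩ := hv.exists_logLipOn (|t| + 1)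
  have hmove (s : ℝ) (hs : s ∈ Metric.ball t 1) (x : E) : ‖hv.flow s t x - x‖ ≤ M * ‖s - t‖ := by
    have hs' : |s - t| < 1 := hs
    have := abs_sub_abs_le_abs_sub s t
    simpa [abs_sub_comm] using hv.norm_flow_sub_flow_le hvM s (s := s) (t := t)
      (abs_le.1 (by linarith)) (abs_le.1 (by linarith)) x
  set K := Metric.cthickening M (tsupport f)
  have hK : IsCompact K := hf'.isCompact.cthickening
  have hdom (x : E) (s : ℝ) (hs : s ∈ Metric.ball t 1) :
      ‖f (hv.flow s t x) - f (hv.flow t t x)‖ ≤ K.indicator (fun _ => C * M) x * ‖s - t‖ := by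
    rw [hv.flow_self, norm_sub_rev]
    refine (norm_sub_le_indicator_cthickening hf (norm_sub_rev _ x ▸ hmove s hs x)
      (mul_le_of_le_one_right hM (Metric.mem_ball.1 hs).le)).trans_eq ?_
    change K.indicator _ x = _
    by_cases hx : x ∈ K
    · rw [indicator_of_mem hx, indicator_of_mem hx, mul_assoc, Real.norm_eq_abs, Real.dist_eq]
    · rw [indicator_of_notMem hx, indicator_of_notMem hx, zero_mul]
  have hvt : Continuous (v t) := hv.continuous.comp (Continuous.prodMk_right t)
  obtain ⟨hint, hderiv⟩ := hasFDerivAt_integral_of_dominated_loc_of_lip' (𝕜 := ℝ) (μ := μ)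
    (F := fun s x => f (hv.flow s t x))
    (F' := fun x => ContinuousLinearMap.toSpanSingleton ℝ (fderiv ℝ f x (-(v t x))))
    (Metric.ball_mem_nhds t one_pos)
    (fun s _ => (hf.continuous.comp (hv.continuous_flow_right s t)).aestronglyMeasurable)
    (by simpa only [hv.flow_self] using hf.continuous.integrable_of_hasCompactSupport hf')
    ((ContinuousLinearMap.toSpanSingletonCLE (𝕜 := ℝ) (E := ℝ)).continuous.comp_stronglyMeasurable
      (stronglyMeasurable_fderiv_apply f measurable_id
        hvt.neg.stronglyMeasurable)).aestronglyMeasurable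
    (ae_of_all _ hdom)
    ((integrable_indicator_iff hK.isClosed.measurableSet).2
      (integrableOn_const hK.measure_lt_top.ne))
    (hf.ae_differentiableAt.mono fun x hx =>
      (hx.hasFDerivAt.comp_hasDerivAt_of_eq t (hv.hasDerivAt_flow_left_self t x)
        (hv.flow_self t x).symm).hasFDerivAt)
  have := hderiv.hasDerivAt
  rw [ContinuousLinearMap.integral_apply hint] at this
  simpa [integral_neg, hdiv hf hf'] using this

end Haar

end IsOsgoodField

namespace IsLipschitzField

variable {E : Type*} [NormedAddCommGroup E] [NormedSpace ℝ E] [CompleteSpace E] {v : ℝ → E → E}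

theorem exists_lipschitzWith_flow (hv : IsLipschitzField v) {s t : ℝ} (hst : s ≤ t) :
    ∃ K, LipschitzWith K (hv.isOsgoodField.flow s t) := by
  obtain ⟨M, hM, hlip⟩ := hv.exists_bound (max |s| |t|)
  have hcurve (x : E) := hv.isOsgoodField.isIntegralCurve_flow s x
  lift M to ℝ≥0 using hM
  refine ⟨Real.toNNReal (Real.exp (M * (t - s))), LipschitzWith.of_dist_le_mul fun x y => ?_⟩
  rw [Real.coe_toNNReal _ (Real.exp_pos _).le, mul_comm]
  refine dist_le_of_trajectories_ODE_of_mem (v := v) (K := M) (s := fun _ => univ)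
    (fun τ hτ => ?_) (fun τ _ => (hcurve x τ).continuousAt.continuousWithinAt)
    (fun τ _ => (hcurve x τ).hasDerivWithinAt) (fun _ _ => mem_univ _)
    (fun τ _ => (hcurve y τ).continuousAt.continuousWithinAt)
    (fun τ _ => (hcurve y τ).hasDerivWithinAt) (fun _ _ => mem_univ _) ?_ t ⟨hst, le_rfl⟩
  · have hτT : τ ∈ Icc (-max |s| |t|) (max |s| |t|) :=
      abs_le.1 (abs_le_max_abs_abs hτ.1 hτ.2.le)
    refine (LipschitzWith.of_dist_le_mul fun x y => ?_).lipschitzOnWith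
    simpa only [dist_eq_norm] using (hlip τ hτT).1 x y
  · simp only [hv.isOsgoodField.flow_self, le_refl]

variable [FiniteDimensional ℝ E] [MeasurableSpace E] [BorelSpace E] {μ : Measure E}
  [μ.IsAddHaarMeasure]

theorem measurePreserving_flow (hv : IsLipschitzField v) (hdiv : ∀ t, IsWeaklyDivFree μ (v t))
    {s t : ℝ} (hst : s ≤ t) : MeasurePreserving (hv.isOsgoodField.flow s t) μ μ := by
  set hv' := hv.isOsgoodField
  have hcont := hv'.continuous_flow_right s t
  have : IsFiniteMeasureOnCompacts (μ.map (hv'.flow s t)) :=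
    Measure.IsFiniteMeasureOnCompacts.map μ (hv'.flowHomeo s t)
  refine ⟨hcont.measurable, measure_ext_of_testFunctions fun φ hφ => ?_⟩
  obtain ⟨C, hC⟩ := hφ.1.lipschitzWith_of_hasCompactSupport hφ.2 (by simp)
  have hderiv (r : ℝ) (hr : r ≤ t) : HasDerivAt (fun s => ∫ x, φ (hv'.flow s t x) ∂μ) 0 r := by
    obtain ⟨K, hK⟩ := hv.exists_lipschitzWith_flow hr
    have := hv'.hasDerivAt_integral_comp_flow_left_self (hdiv r) (hC.comp hK)
      (hφ.2.comp_homeomorph (hv'.flowHomeo r t))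
    simpa only [Function.comp_apply, hv'.flow_flow] using this
  have hconst := constant_of_has_deriv_right_zero
    (fun r hr => (hderiv r hr.2).continuousAt.continuousWithinAt)
    (fun r hr => (hderiv r hr.2.le).hasDerivWithinAt) t ⟨hst, le_rfl⟩
  rw [integral_map hcont.aemeasurable hφ.1.continuous.aestronglyMeasurable, ← hconst]
  simp only [hv'.flow_self]

end IsLipschitzField

section Volume

variable {E : Type*} [NormedAddCommGroup E] [NormedSpace ℝ E] [FiniteDimensional ℝ E]
  [MeasurableSpace E] [BorelSpace E] {μ : Measure E}

theorem measurePreserving_of_forall_exists_dist_le [IsFiniteMeasureOnCompacts μ] (Φ : E ≃ₜ E)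
    (h : ∀ δ, 0 < δ → δ ≤ 1 → ∃ Ψ, MeasurePreserving Ψ μ μ ∧ ∀ x, dist (Ψ x) (Φ x) ≤ δ) :
    MeasurePreserving Φ μ μ := by
  have := Measure.IsFiniteMeasureOnCompacts.map μ Φ
  refine ⟨Φ.measurable, measure_ext_of_testFunctions fun φ hφ => ?_⟩
  obtain ⟨C, hC⟩ := hφ.1.lipschitzWith_of_hasCompactSupport hφ.2 (by simp)
  have hφΦ : Integrable (fun x => φ (Φ x)) μ :=
    (hφ.1.continuous.comp Φ.continuous).integrable_of_hasCompactSupport (hφ.2.comp_homeomorph Φ)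
  have hφμ : Integrable φ μ := hφ.1.continuous.integrable_of_hasCompactSupport hφ.2
  set K := Φ ⁻¹' Metric.cthickening 1 (tsupport φ)
  have hK : IsCompact K := Φ.isClosedEmbedding.isCompact_preimage hφ.2.isCompact.cthickening
  have hbound (δ : ℝ) (hδ : 0 < δ) (hδ1 : δ ≤ 1) :
      ‖∫ x, φ (Φ x) ∂μ - ∫ x, φ x ∂μ‖ ≤ C * δ * μ.real K := by
    obtain ⟨Ψ, hΨ, hΨΦ⟩ := h δ hδ hδ1
    have hφΨ : Integrable (fun x => φ (Ψ x)) μ := hΨ.integrable_comp_of_integrable hφμ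
    have hint : ∫ x, φ (Ψ x) ∂μ = ∫ x, φ x ∂μ := by
      rw [← integral_map hΨ.aemeasurable hφ.1.continuous.aestronglyMeasurable, hΨ.map_eq]
    rw [← hint, ← integral_sub hφΦ hφΨ]
    refine (norm_integral_le_of_norm_le ((integrable_indicator_iff hK.isClosed.measurableSet).2
      (integrableOn_const hK.measure_lt_top.ne)) (ae_of_all _ fun x =>
        norm_sub_le_indicator_cthickening hC
          ((dist_eq_norm _ _).symm.trans_le (dist_comm (Ψ x) _ ▸ hΨΦ x)) hδ1)).trans_eq ?_
    rw [integral_indicator_const _ hK.isClosed.measurableSet, smul_eq_mul, mul_comm]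
  have hlim : Tendsto (fun δ : ℝ => C * δ * μ.real K) (𝓝[>] 0) (𝓝 0) := by
    have hcont : Continuous fun δ : ℝ => C * δ * μ.real K := by fun_prop
    simpa using (hcont.tendsto 0).mono_left nhdsWithin_le_nhds
  have hle := ge_of_tendsto hlim (by
    filter_upwards [Ioc_mem_nhdsGT one_pos] with δ hδ using hbound δ hδ.1 hδ.2)
  rw [integral_map Φ.measurable.aemeasurable hφ.1.continuous.aestronglyMeasurable]
  exact sub_eq_zero.1 (norm_le_zero_iff.1 hle)

variable {k : E → E} {q : ℝ → SignedMeasure E}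

theorem IsKernel.isLipschitzField_velocity (hk : IsKernel k) {C : ℝ}
    (hlip : ∀ x y, ‖k x - k y‖ ≤ C * ‖x - y‖) (hq : IsWeakStarContinuous q) :
    IsLipschitzField fun t x => velocity k (q t) x := by
  refine ⟨hk.continuous_velocity hq, fun T => ?_⟩
  obtain ⟨B, hB, hkB⟩ := hk.exists_bound
  obtain ⟨Q, hQ, hqQ⟩ := hq.exists_norm_pairing_le (isCompact_Icc (a := -T) (b := T))
  refine ⟨Q * max |C| B, by positivity, fun t ht => ⟨fun x y => ?_, fun x => ?_⟩⟩
  · refine (hk.norm_velocity_sub_le hk (q t) (C := |C| * ‖x - y‖) (by positivity)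
      fun z => ?_).trans ?_
    · refine (hlip _ _).trans ?_
      rw [sub_sub_sub_cancel_right]
      gcongr
      exact le_abs_self C
    · rw [mul_assoc]
      gcongr
      exacts [hqQ t ht, le_max_left _ _]
  · refine (hk.norm_velocity_le (q t) hB hkB x).trans ?_
    gcongr
    exacts [hqQ t ht, le_max_right _ _]

namespace IsOsgoodKernel

theorem isOsgoodField_velocity (hk : IsOsgoodKernel μ k) (hq : IsWeakStarContinuous q) :
    IsOsgoodField fun t x => velocity k (q t) x := by
  refine ⟨hk.continuous_velocity hq, fun T => ?_⟩
  obtain ⟨C, hC, happrox⟩ := hk.exists_approx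
  obtain ⟨Q, hQ, hqQ⟩ := hq.exists_norm_pairing_le (isCompact_Icc (a := -T) (b := T))
  refine ⟨Q * C, by positivity, fun ε hε hε1 => ?_⟩
  obtain ⟨k', hk', -, hlip, hbound, hclose⟩ := happrox ε hε hε1
  have hlog := Real.log_nonpos hε.le hε1
  have hL : 0 ≤ C * (1 - Real.log ε) := mul_nonneg hC (by linarith)
  refine ⟨fun t x => velocity k' (q t) x, hk'.continuous_velocity hq, fun t ht =>
    ⟨fun x y => ?_, fun x => ⟨?_, ?_⟩⟩⟩
  · refine (hk'.norm_velocity_sub_le hk' (q t) (mul_nonneg hL (norm_nonneg (x - y)))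
      fun z => (hlip _ _).trans_eq (by rw [sub_sub_sub_cancel_right])).trans ?_
    rw [mul_assoc Q, mul_assoc Q]
    gcongr
    exact hqQ t ht
  · refine (hk'.norm_velocity_le (q t) hC hbound x).trans ?_
    gcongr
    exact hqQ t ht
  · refine (hk'.norm_velocity_sub_le hk.toIsKernel (q t) (by positivity)
      fun z => hclose _).trans ?_
    rw [mul_assoc]
    gcongr
    exact hqQ t ht

theorem measurePreserving_flow_of_le [μ.IsAddHaarMeasure]
    (hk : IsOsgoodKernel μ k) (hq : IsWeakStarContinuous q) {s t : ℝ} (hst : s ≤ t) :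
    MeasurePreserving ((hk.isOsgoodField_velocity hq).flowHomeo s t) μ μ := by
  set hv := hk.isOsgoodField_velocity hq
  refine measurePreserving_of_forall_exists_dist_le _ fun δ hδ _ => ?_
  set T := max |s| |t|
  have hs : s ∈ Icc (-T) T := abs_le.1 (le_max_left _ _)
  have ht : t ∈ Icc (-T) T := abs_le.1 (le_max_right _ _)
  obtain ⟨M, hM, hlog, -⟩ := hv.exists_logLipOn T
  obtain ⟨r, hr, hstab⟩ := hlog.exists_norm_integralCurve_sub_le hM hδ
  obtain ⟨Q, hQ, hqQ⟩ := hq.exists_norm_pairing_le (isCompact_Icc (a := -T) (b := T))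
  obtain ⟨C, hC, happrox⟩ := hk.exists_approx
  obtain ⟨k', hk', hdiv, hlip, -, hclose⟩ :=
    happrox (min 1 (r / (Q * C + 1))) (by positivity) (min_le_left _ _)
  have hv' := hk'.isLipschitzField_velocity hlip hq
  refine ⟨_, hv'.measurePreserving_flow (fun t => hk'.isWeaklyDivFree_velocity hdiv (q t)) hst,
    fun x => (dist_eq_norm _ _).trans_le ?_⟩
  refine hstab _ _ s hs
    (isApproxIntegralCurveOn_of_norm_sub_le
      ((hv'.isOsgoodField.isIntegralCurve_flow s x).isIntegralCurveOn _) fun τ hτ y => ?_)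
    (isApproxIntegralCurveOn_of_isIntegralCurve _ hr.le (hv.isIntegralCurve_flow s x))
    (by simp [hr.le]) t ht
  refine (hk'.norm_velocity_sub_le hk.toIsKernel (q τ) (by positivity) fun z => hclose _).trans ?_
  calc ‖pairing (q τ)‖ * (C * min 1 (r / (Q * C + 1)))
      ≤ Q * (C * (r / (Q * C + 1))) := by
        gcongr
        exacts [hqQ τ hτ, min_le_right _ _]
    _ = Q * C / (Q * C + 1) * r := by ring
    _ ≤ r := mul_le_of_le_one_left hr.le (div_le_one_of_le₀ (by linarith) (by positivity))

theorem measurePreserving_flow [μ.IsAddHaarMeasure] (hk : IsOsgoodKernel μ k)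
    (hq : IsWeakStarContinuous q) (s t : ℝ) :
    MeasurePreserving ((hk.isOsgoodField_velocity hq).flowHomeo s t) μ μ :=
  (le_total s t).elim (hk.measurePreserving_flow_of_le hq) fun hts =>
    (hk.measurePreserving_flow_of_le hq hts).symm
      ((hk.isOsgoodField_velocity hq).flowHomeo t s).toMeasurableEquiv

end IsOsgoodKernel

end Volume

/-! ### The equation for the displacement -/

theorem norm_add_displacement_sub_le {E : Type*} [NormedAddCommGroup E] (w w' : E →ᵇ E) (x : E) :
    ‖x + w x - (x + w' x)‖ ≤ ‖w - w'‖ := by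
  rw [add_sub_add_left_eq_sub]
  exact (w - w').norm_coe_le_norm x

section Displacement

variable {E : Type*} [NormedAddCommGroup E] [NormedSpace ℝ E] [MeasurableSpace E]

/-- The velocity at `x` once every particle `y` of `q` has moved to `y + w y`. -/
def displacedVelocity (k : E → E) (q : SignedMeasure E) (w : E →ᵇ E) (x : E) : E :=
  ∫ᵛ y, k (x - (y + w y)) ∂<•q

theorem norm_displacedVelocity_le {k : E → E} (q : SignedMeasure E) {C : ℝ} (hC : ∀ x, ‖k x‖ ≤ C)
    (w : E →ᵇ E) (x : E) : ‖displacedVelocity k q w x‖ ≤ totalMass q * C :=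
  norm_vintegral_le q ((norm_nonneg _).trans (hC 0)) fun _ => hC _

variable [BorelSpace E] [FiniteDimensional ℝ E]

namespace IsKernel

variable {k k' : E → E}

theorem velocity_map (hk : IsKernel k) (q : SignedMeasure E) {η : E → E} (hη : Continuous η)
    (x : E) : velocity k (VectorMeasure.map q η) x = ∫ᵛ y, k (x - η y) ∂<•q := by
  obtain ⟨C, -, hC⟩ := hk.exists_bound
  exact vintegral_map q hη (hk.continuous.comp (by fun_prop)) fun y => hC _

theorem norm_displacedVelocity_sub_le (hk : IsKernel k) (hk' : IsKernel k') (q : SignedMeasure E)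
    {w w' : E →ᵇ E} {x x' : E} {C : ℝ}
    (hC : ∀ z z', ‖z - z'‖ ≤ ‖x - x'‖ + ‖w - w'‖ → ‖k z - k' z'‖ ≤ C) :
    ‖displacedVelocity k q w x - displacedVelocity k' q w' x'‖ ≤ totalMass q * C := by
  have hint {k : E → E} (hk : IsKernel k) (w : E →ᵇ E) (x : E) :
      q.Integrable fun y => k (x - (y + w y)) :=
    have ⟨_, _, hB⟩ := hk.exists_bound
    integrable_of_continuous_of_bound q (hk.continuous.comp (by fun_prop)) fun y => hB _
  have hmove (y : E) : ‖x - (y + w y) - (x' - (y + w' y))‖ ≤ ‖x - x'‖ + ‖w - w'‖ := by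
    rw [show x - (y + w y) - (x' - (y + w' y)) = x - x' - (w - w') y by
      rw [BoundedContinuousFunction.sub_apply]; abel]
    exact (norm_sub_le _ _).trans (by gcongr; exact (w - w').norm_coe_le_norm y)
  rw [displacedVelocity, displacedVelocity,
    ← VectorMeasure.integral_fun_sub (hint hk w x) (hint hk' w' x')]
  exact norm_vintegral_le q ((norm_nonneg _).trans (hC _ _ (hmove 0))) fun y => hC _ _ (hmove y)

theorem exists_norm_displacedVelocity_sub_le (hk : IsKernel k) (q : SignedMeasure E) {ε : ℝ}
    (hε : 0 < ε) : ∃ δ, 0 < δ ∧ ∀ (w w' : E →ᵇ E) (x x' : E), ‖x - x'‖ + ‖w - w'‖ < δ →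
      ‖displacedVelocity k q w x - displacedVelocity k q w' x'‖ ≤ ε := by
  have hq := totalMass_nonneg q
  obtain ⟨δ, hδ, hkδ⟩ := Metric.uniformContinuous_iff.1 hk.uniformContinuous
    (ε / (totalMass q + 1)) (by positivity)
  refine ⟨δ, hδ, fun w w' x x' h => (hk.norm_displacedVelocity_sub_le hk q fun z z' hz =>
    (dist_eq_norm _ _).symm.trans_le (hkδ ((dist_eq_norm z z').trans_lt (hz.trans_lt h))).le).trans
      ?_⟩
  rw [mul_div_left_comm]
  exact mul_le_of_le_one_right hε.le (div_le_one_of_le₀ (by linarith) (by positivity))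

theorem continuous_displacedVelocity (hk : IsKernel k) (q : SignedMeasure E) (w : E →ᵇ E) :
    Continuous (displacedVelocity k q w) := by
  refine Metric.continuous_iff'.2 fun x ε hε => ?_
  obtain ⟨δ, hδ, h⟩ := hk.exists_norm_displacedVelocity_sub_le q (half_pos hε)
  filter_upwards [Metric.ball_mem_nhds x hδ] with y hy
  rw [dist_eq_norm]
  exact (h w w y x (by simpa [← dist_eq_norm] using hy)).trans_lt (half_lt_self hε)

/-- The displaced velocity as a bounded continuous vector field. -/
def displacedField (hk : IsKernel k) (q : SignedMeasure E) (w : E →ᵇ E) : E →ᵇ E :=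
  BoundedContinuousFunction.ofNormedAddCommGroup (displacedVelocity k q w)
    (hk.continuous_displacedVelocity q w) (totalMass q * hk.exists_bound.choose)
    (norm_displacedVelocity_le q hk.exists_bound.choose_spec.2 w)

/-- The displaced velocity of the particle starting at `x`, as a function of `x`. The displacement
`w t x = η t x - x` of the flow map `η` is an integral curve of this field on `E →ᵇ E`. -/
def particleField (hk : IsKernel k) (q : SignedMeasure E) (w : E →ᵇ E) : E →ᵇ E :=
  (hk.displacedField q w).compContinuous ⟨fun x => x + w x, continuous_id.add w.continuous⟩

theorem continuous_displacedField (hk : IsKernel k) (q : SignedMeasure E) :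
    Continuous (hk.displacedField q) := by
  refine Metric.continuous_iff'.2 fun w ε hε => ?_
  obtain ⟨δ, hδ, h⟩ := hk.exists_norm_displacedVelocity_sub_le q (half_pos hε)
  filter_upwards [Metric.ball_mem_nhds w hδ] with w' hw
  refine ((BoundedContinuousFunction.dist_le (half_pos hε).le).2 fun x => ?_).trans_lt
    (half_lt_self hε)
  rw [dist_eq_norm]
  exact h w' w x x (by simpa [← dist_eq_norm] using hw)

theorem continuous_particleField (hk : IsKernel k) (q : SignedMeasure E) :
    Continuous (hk.particleField q) := by
  refine Metric.continuous_iff'.2 fun w ε hε => ?_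
  obtain ⟨δ, hδ, h⟩ := hk.exists_norm_displacedVelocity_sub_le q (half_pos hε)
  filter_upwards [Metric.ball_mem_nhds w (half_pos hδ)] with w' hw
  refine ((BoundedContinuousFunction.dist_le (half_pos hε).le).2 fun x => ?_).trans_lt
    (half_lt_self hε)
  rw [dist_eq_norm]
  rw [Metric.mem_ball, dist_eq_norm] at hw
  exact h w' w (x + w' x) (x + w x) (by linarith [norm_add_displacement_sub_le w' w x])

end IsKernel

theorem IsOsgoodKernel.isOsgoodField_particleField {μ : Measure E} {k : E → E}
    (hk : IsOsgoodKernel μ k) (q : SignedMeasure E) :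
    IsOsgoodField fun (_ : ℝ) w => hk.particleField q w := by
  have hq := totalMass_nonneg q
  obtain ⟨C, hC, happrox⟩ := hk.exists_approx
  refine ⟨(hk.continuous_particleField q).comp continuous_snd, fun T =>
    ⟨2 * totalMass q * C, by positivity, fun ε hε hε1 => ?_⟩⟩
  obtain ⟨k', hk', -, hlip, hbound, hclose⟩ := happrox ε hε hε1
  have hlog : 0 ≤ 1 - Real.log ε := by linarith [Real.log_nonpos hε.le hε1]
  have hqC : 0 ≤ totalMass q * C := by positivity
  have hqCε : 0 ≤ totalMass q * C * ε := by positivity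
  refine ⟨fun _ w => hk'.particleField q w, (hk'.continuous_particleField q).comp continuous_snd,
    fun t _ => ⟨fun w w' => ?_, fun w => ⟨?_, ?_⟩⟩⟩
  · refine (BoundedContinuousFunction.norm_le (by positivity)).2 fun x => ?_
    have hmove := add_le_add_left (norm_add_displacement_sub_le w w' x) ‖w - w'‖
    exact (hk'.norm_displacedVelocity_sub_le hk' q fun z z' hz => (hlip z z').trans
      (mul_le_mul_of_nonneg_left (hz.trans hmove) (by positivity))).trans_eq (by ring)
  · refine (BoundedContinuousFunction.norm_le (by positivity)).2 fun x => ?_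
    exact (norm_displacedVelocity_le q hbound w _).trans (by linarith)
  · refine (BoundedContinuousFunction.norm_le (by positivity)).2 fun x => ?_
    refine (hk'.norm_displacedVelocity_sub_le hk.toIsKernel q (C := C * ε) fun z z' hz => ?_).trans
      (by linarith)
    obtain rfl : z = z' := sub_eq_zero.1 (norm_le_zero_iff.1 (by simpa using hz))
    exact hclose z

end Displacement

/-! ### The transport equation -/

section ParametricIntegral

variable {X F : Type*} [TopologicalSpace X] [MeasurableSpace X] [NormedAddCommGroup F]
  [NormedSpace ℝ F]

theorem hasCompactSupport_vintegral {q : ℝ → SignedMeasure X} {ψ : ℝ × X → F}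
    (hψ : HasCompactSupport ψ) (η : ℝ → X → X) :
    HasCompactSupport fun t => ∫ᵛ x, ψ (t, η t x) ∂<•(q t) :=
  .intro (hψ.isCompact.image continuous_fst) fun t ht => by
    have h (x : X) : ψ (t, η t x) = 0 :=
      image_eq_zero_of_notMem_tsupport fun hx => ht (mem_image_of_mem Prod.fst hx)
    simp only [h, VectorMeasure.integral_zero]

variable [OpensMeasurableSpace X] [SecondCountableTopologyEither X F]

theorem continuous_vintegral_comp (q : SignedMeasure X) {ψ : ℝ × X → F} (hψ : Continuous ψ) {C : ℝ}
    (hC : ∀ p, ‖ψ p‖ ≤ C) {η : ℝ → X → X} (hη : ∀ t, Continuous (η t))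
    (hηt : ∀ x, Continuous fun t => η t x) : Continuous fun t => ∫ᵛ x, ψ (t, η t x) ∂<•q := by
  refine VectorMeasure.continuous_of_dominated (bound := fun _ => C)
    (fun t => (hψ.comp (by fun_prop)).aestronglyMeasurable)
    (fun t => .of_forall fun x => hC _) (integrable_const _) (.of_forall fun x => ?_)
  exact hψ.comp (by fun_prop)

theorem hasDerivAt_vintegral (q : SignedMeasure X) {f f' : ℝ → X → F} {t B C : ℝ}
    (hf : ∀ s, Continuous (f s)) (hf' : Continuous (f' t)) (hB : ∀ s x, ‖f s x‖ ≤ B)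
    (hC : ∀ᶠ s in 𝓝 t, ∀ x, ‖f' s x‖ ≤ C)
    (hderiv : ∀ s x, HasDerivAt (fun s => f s x) (f' s x) s) :
    HasDerivAt (fun s => ∫ᵛ x, f s x ∂<•q) (∫ᵛ x, f' t x ∂<•q) t := by
  have hμ (μ : Measure X) [IsFiniteMeasure μ] :
      HasDerivAt (fun s => ∫ x, f s x ∂μ) (∫ x, f' t x ∂μ) t :=
    (hasDerivAt_integral_of_dominated_loc_of_deriv_le (bound := fun _ => C) hC
      (.of_forall fun s => (hf s).aestronglyMeasurable)
      (.of_bound (hf t).aestronglyMeasurable B (ae_of_all _ (hB t))) hf'.aestronglyMeasurable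
      (ae_of_all _ fun x s hs => hs x) (integrable_const _)
      (ae_of_all _ fun x s _ => hderiv s x)).2
  rw [vintegral_eq_sub q (integrable_of_continuous_of_bound q hf' hC.self_of_nhds)]
  simpa only [fun s => vintegral_eq_sub q (integrable_of_continuous_of_bound q (hf s) (hB s))]
    using (hμ _).fun_sub (hμ _)

end ParametricIntegral

section Map

variable {X : Type*} [TopologicalSpace X] [MeasurableSpace X] [BorelSpace X] {η : ℝ → X → X}

theorem continuous_vintegral_map (q : SignedMeasure X) (hη : ∀ t, Continuous (η t))
    (hηt : ∀ x, Continuous fun t => η t x) (f : X →ᵇ ℝ) :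
    Continuous fun t => ∫ᵛ x, f x ∂<•(VectorMeasure.map q (η t)) := by
  have hmap (t : ℝ) : ∫ᵛ x, f x ∂<•(VectorMeasure.map q (η t)) = ∫ᵛ x, f (η t x) ∂<•q :=
    vintegral_map q (hη t) f.continuous f.norm_coe_le_norm
  simp only [hmap]
  exact continuous_vintegral_comp q (ψ := fun p => f p.2) (by fun_prop)
    (fun p => f.norm_coe_le_norm p.2) hη hηt

end Map

section TransportSolution

variable {E : Type*} [NormedAddCommGroup E] [NormedSpace ℝ E]

/-- The derivative `∂ₜ φ + u · grad φ` of `φ` along the trajectories of `u`. -/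
def materialDerivative (u : ℝ → E → E) (φ : ℝ × E → ℝ) (p : ℝ × E) : ℝ :=
  fderiv ℝ φ p (1, u p.1 p.2)

variable {u : ℝ → E → E} {φ : ℝ × E → ℝ}

theorem continuous_materialDerivative (hu : Continuous (Function.uncurry u))
    (hφ : IsTestFunction φ) : Continuous (materialDerivative u φ) :=
  (hφ.1.continuous_fderiv (by simp)).clm_apply (continuous_const.prodMk hu)

theorem hasCompactSupport_materialDerivative (u : ℝ → E → E) (hφ : HasCompactSupport φ) :
    HasCompactSupport (materialDerivative u φ) :=
  (hφ.fderiv ℝ).mono fun p hp h => hp (by simp [materialDerivative, h])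

theorem hasDerivAt_comp_integralCurve {γ : ℝ → E} (hγ : IsIntegralCurve γ u)
    (hφ : IsTestFunction φ) (t : ℝ) :
    HasDerivAt (fun s => φ (s, γ s)) (materialDerivative u φ (t, γ t)) t :=
  (hφ.1.differentiable (by simp)).differentiableAt.hasFDerivAt.comp_hasDerivAt t
    ((hasDerivAt_id t).prodMk (hγ t))

variable [MeasurableSpace E]

/-- `q` is a weak solution of the transport equation `∂ₜ q + u · grad q = 0`. -/
def IsTransportSolution (u : ℝ → E → E) (q : ℝ → SignedMeasure E) : Prop :=
  ∀ φ : ℝ × E → ℝ, IsTestFunction φ → ∫ t, ∫ᵛ x, materialDerivative u φ (t, x) ∂<•(q t) = 0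

theorem isTransportSolution_map [BorelSpace E] (q : SignedMeasure E) {η : ℝ → E → E}
    (hη : ∀ t, Continuous (η t)) (hu : Continuous (Function.uncurry u))
    (hηu : ∀ x, IsIntegralCurve (fun t => η t x) u) :
    IsTransportSolution u fun t => VectorMeasure.map q (η t) := fun φ hφ => by
  have hηt (x : E) : Continuous fun t => η t x :=
    continuous_iff_continuousAt.2 fun t => (hηu x t).continuousAt
  have hD := continuous_materialDerivative hu hφ
  have hDc := hasCompactSupport_materialDerivative u hφ.2
  obtain ⟨B, hB⟩ := hφ.2.exists_bound_of_continuous hφ.1.continuous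
  obtain ⟨C, hC⟩ := hDc.exists_bound_of_continuous hD
  have hmap (t : ℝ) : ∫ᵛ x, materialDerivative u φ (t, x) ∂<•(VectorMeasure.map q (η t)) =
      ∫ᵛ x, materialDerivative u φ (t, η t x) ∂<•q :=
    vintegral_map q (hη t) (hD.comp (Continuous.prodMk_right t)) fun x => hC _
  simp only [hmap]
  have hderiv (t : ℝ) := hasDerivAt_vintegral q (f := fun t x => φ (t, η t x)) (t := t)
    (fun s => hφ.1.continuous.comp (by fun_prop)) (hD.comp (by fun_prop)) (fun s x => hB _)
    (.of_forall fun s x => hC (s, η s x)) fun s x => hasDerivAt_comp_integralCurve (hηu x) hφ s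
  exact integral_eq_zero_of_hasDerivAt_of_integrable hderiv
    ((continuous_vintegral_comp q hD hC hη hηt).integrable_of_hasCompactSupport
      (hasCompactSupport_vintegral hDc η))
    ((continuous_vintegral_comp q hφ.1.continuous hB hη hηt).integrable_of_hasCompactSupport
      (hasCompactSupport_vintegral hφ.2 η))

end TransportSolution

/-! ### Duality with test functions -/

section DuBoisReymond

theorem eq_of_forall_integral_deriv_mul_eq_zero {d : ℝ → ℝ} (hd : Continuous d)
    (h : ∀ χ : ℝ → ℝ, IsTestFunction χ → ∫ t, deriv χ t * d t = 0) (s t : ℝ) : d s = d t := by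
  let ρ (n : ℕ) : ContDiffBump (0 : ℝ) := ⟨1 / (n + 1) / 2, 1 / (n + 1), by positivity,
    half_lt_self (by positivity)⟩
  let dρ (n : ℕ) : ℝ → ℝ :=
    convolution ((ρ n).normed volume) d (ContinuousLinearMap.lsmul ℝ ℝ) volume
  have hderiv (n : ℕ) (x : ℝ) : HasDerivAt (dρ n) 0 x := by
    have hρ : ContDiff ℝ ∞ ((ρ n).normed volume) := (ρ n).contDiff_normed
    refine ((ρ n).hasCompactSupport_normed.hasDerivAt_convolution_left _ (hρ.of_le (by simp))
      hd.locallyIntegrable x).congr_deriv ?_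
    have hzero := h (fun y => (ρ n).normed volume (x - y))
      ⟨hρ.comp (contDiff_const.sub contDiff_id),
        (ρ n).hasCompactSupport_normed.comp_homeomorph (.subLeft x)⟩
    rw [convolution_eq_swap]
    simpa [deriv_comp_const_sub, integral_neg] using hzero
  have hlim (x : ℝ) : Tendsto (fun n => dρ n x) atTop (𝓝 (d x)) :=
    ContDiffBump.convolution_tendsto_right_of_continuous
      tendsto_one_div_add_atTop_nhds_zero_nat hd x
  refine tendsto_nhds_unique (hlim s) ((hlim t).congr fun n => ?_)
  exact is_const_of_deriv_eq_zero (fun x => (hderiv n x).differentiableAt)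
    (fun x => (hderiv n x).deriv) t s

theorem hasDerivAt_of_forall_integral_eq_zero {a b : ℝ → ℝ} (ha : Continuous a) (hb : Continuous b)
    (h : ∀ χ : ℝ → ℝ, IsTestFunction χ → ∫ t, (deriv χ t * a t + χ t * b t) = 0) (t : ℝ) :
    HasDerivAt a (b t) t := by
  set B : ℝ → ℝ := fun t => ∫ s in (0 : ℝ)..t, b s
  have hB (t : ℝ) : HasDerivAt B (b t) t := (hb.integral_hasStrictDerivAt 0 t).hasDerivAt
  have hBc : Continuous B := continuous_iff_continuousAt.2 fun t => (hB t).continuousAt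
  have hconst := eq_of_forall_integral_deriv_mul_eq_zero (ha.sub hBc) fun χ hχ => by
    have hint {c : ℝ → ℝ} (hc : Continuous c) : Integrable fun t => deriv χ t * c t + χ t * b t :=
      (((hχ.1.continuous_deriv (by simp)).mul hc).integrable_of_hasCompactSupport
        hχ.2.deriv.mul_right).add
        ((hχ.1.continuous.mul hb).integrable_of_hasCompactSupport hχ.2.mul_right)
    have hparts : ∫ t, (deriv χ t * B t + χ t * b t) = 0 :=
      integral_eq_zero_of_hasDerivAt_of_integrable (f := fun t => χ t * B t)
        (fun t => ((hχ.1.differentiable (by simp) t).hasDerivAt).mul (hB t)) (hint hBc)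
        ((hχ.1.continuous.mul hBc).integrable_of_hasCompactSupport hχ.2.mul_right)
    have hsub := integral_sub (hint ha) (hint hBc)
    rw [h χ hχ, hparts, sub_zero] at hsub
    rw [← hsub]
    exact integral_congr_ae (.of_forall fun t => by simp only [Pi.sub_apply]; ring)
  have haB : a = fun t => B t + (a 0 - B 0) := funext fun t => by
    have := hconst t 0
    simp only [Pi.sub_apply] at this
    linarith
  rw [haB]
  exact (hB t).add_const _

theorem hasDerivAt_diag {A : ℝ → ℝ → ℝ} {A₁ A₂ : ℝ × ℝ → ℝ} (hA₁ : Continuous A₁)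
    (hA₂ : Continuous A₂) (h₁ : ∀ s τ, HasDerivAt (fun s => A s τ) (A₁ (s, τ)) s)
    (h₂ : ∀ s τ, HasDerivAt (A s) (A₂ (s, τ)) τ) (t : ℝ) :
    HasDerivAt (fun t => A t t) (A₁ (t, t) + A₂ (t, t)) t := by
  have hA := hasStrictFDerivAt_uncurry_coprod (u := (t, t))
    (f₁ := fun s τ => ContinuousLinearMap.toSpanSingleton ℝ (A₁ (s, τ)))
    (f₂ := fun s τ => ContinuousLinearMap.toSpanSingleton ℝ (A₂ (s, τ)))
    (.of_forall fun p => (h₁ p.1 p.2).hasFDerivAt) (.of_forall fun p => (h₂ p.1 p.2).hasFDerivAt)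
    (ContinuousLinearMap.toSpanSingletonCLE.continuous.comp hA₁).continuousAt
    (ContinuousLinearMap.toSpanSingletonCLE.continuous.comp hA₂).continuousAt
  refine (hA.hasFDerivAt.comp_hasDerivAt (f := fun t => (t, t)) t
    ((hasDerivAt_id' t).prodMk (hasDerivAt_id' t))).congr_deriv ?_
  simp [Function.HasUncurry.uncurry]

end DuBoisReymond

section TransportDuality

variable {E : Type*} [NormedAddCommGroup E]

variable {F S T : Type*} [NormedAddCommGroup F] [TopologicalSpace S] {f : S → E → F} {c : S → E}
  {K : Set E}

theorem eventually_forall_dist_lt_of_translate_support (hf : Continuous (Function.uncurry f))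
    (hc : Continuous c) [ProperSpace E] (hK : IsCompact K) (hfK : ∀ s x, x - c s ∉ K → f s x = 0)
    (s₀ : S) {ε : ℝ} (hε : 0 < ε) : ∀ᶠ s in 𝓝 s₀, ∀ x, dist (f s x) (f s₀ x) < ε := by
  set K' : Set E := (fun p : E × E => p.1 + p.2) '' (K ×ˢ Metric.closedBall (c s₀) 1)
  have hK' : IsCompact K' := (hK.prod (isCompact_closedBall _ _)).image continuous_add
  have hnear := hK'.mem_uniformity_of_prod (s := univ) (q := s₀) (f := f) hf.continuousOn
    (mem_univ _) (Metric.dist_mem_uniformity hε)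
  obtain ⟨V, hV, hVε⟩ := hnear
  rw [nhdsWithin_univ] at hV
  filter_upwards [hV, hc.tendsto s₀ (Metric.closedBall_mem_nhds _ one_pos)] with s hs hcs x
  by_cases hx : x ∈ K'
  · exact hVε s hs x hx
  · have hzero {s : S} (hs : c s ∈ Metric.closedBall (c s₀) 1) : f s x = 0 :=
      hfK s x fun h => hx ⟨(x - c s, c s), ⟨h, hs⟩, sub_add_cancel x _⟩
    rw [hzero hcs, hzero (Metric.mem_closedBall_self zero_le_one), dist_self]
    exact hε

theorem continuous_vintegral_of_translate_support [NormedSpace ℝ F] [FiniteDimensional ℝ F]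
    [TopologicalSpace T] [WeaklyLocallyCompactSpace T] [ProperSpace E] [MeasurableSpace E]
    [BorelSpace E] {q : T → SignedMeasure E} (hq : IsWeakStarContinuous q) {τ : S → T}
    (hτ : Continuous τ) (hf : Continuous (Function.uncurry f)) (hc : Continuous c)
    (hK : IsCompact K) (hfK : ∀ s x, x - c s ∉ K → f s x = 0) :
    Continuous fun s => ∫ᵛ x, f s x ∂<•(q (τ s)) := by
  have hfs (s : S) : HasCompactSupport (f s) :=
    .intro (hK.image (continuous_add_const (c s))) fun x hx =>
      hfK s x fun h => hx ⟨x - c s, h, sub_add_cancel x _⟩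
  let g (s : S) : C₀(E, F) :=
    ⟨⟨f s, hf.comp (Continuous.prodMk_right s)⟩, (hfs s).is_zero_at_infty⟩
  have hg : Continuous g := by
    refine continuous_iff_continuousAt.2 fun s₀ => Metric.tendsto_nhds.2 fun ε hε => ?_
    filter_upwards [eventually_forall_dist_lt_of_translate_support hf hc hK hfK s₀
      (half_pos hε)] with s hs
    rw [dist_eq_norm]
    refine (norm_zeroAtInfty_le (half_pos hε).le fun x => ?_).trans_lt (half_lt_self hε)
    change ‖f s x - f s₀ x‖ ≤ ε / 2
    exact (dist_eq_norm (f s x) (f s₀ x)).symm.trans_le (hs x).le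
  have hgf (s : S) : ⇑(g s) = f s := rfl
  have hcont := hq.continuous_vintegral hτ hg
  simp only [hgf] at hcont
  exact hcont

variable [NormedSpace ℝ E]

theorem IsTestFunction.mul_prod {χ : ℝ → ℝ} {f : E → ℝ} (hχ : IsTestFunction χ)
    (hf : IsTestFunction f) : IsTestFunction fun p : ℝ × E => χ p.1 * f p.2 := by
  refine ⟨(hχ.1.comp contDiff_fst).mul (hf.1.comp contDiff_snd),
    HasCompactSupport.intro (hχ.2.isCompact.prod hf.2.isCompact) fun p hp => ?_⟩
  rw [mem_prod, not_and_or] at hp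
  rcases hp with h | h <;> simp [image_eq_zero_of_notMem_tsupport h]

theorem materialDerivative_mul_prod {χ : ℝ → ℝ} {f : E → ℝ} (hχ : IsTestFunction χ)
    (hf : IsTestFunction f) (u : ℝ → E → E) (t : ℝ) (x : E) :
    materialDerivative u (fun p => χ p.1 * f p.2) (t, x) =
      deriv χ t * f x + χ t * fderiv ℝ f x (u t x) := by
  have h : HasFDerivAt (fun p : ℝ × E => χ p.1 * f p.2) _ (t, x) :=
    ((hχ.1.differentiable (by simp) t).hasFDerivAt.comp (t, x) hasFDerivAt_fst).mul
      ((hf.1.differentiable (by simp) x).hasFDerivAt.comp (t, x) hasFDerivAt_snd)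
  rw [materialDerivative, h.fderiv]
  simp [mul_comm, add_comm]

variable {u : ℝ → E → E} {g : E → ℝ}

theorem fderiv_eq_zero_of_notMem_tsupport {x : E} (hx : x ∉ tsupport g) : fderiv ℝ g x = 0 :=
  image_eq_zero_of_notMem_tsupport fun h => hx (tsupport_fderiv_subset ℝ h)

variable [MeasurableSpace E] [BorelSpace E]

theorem integrable_fderiv_comp_sub (q : SignedMeasure E) (hg : IsTestFunction g) (c : E)
    {w : E → E} (hw : Continuous w) : q.Integrable fun x => fderiv ℝ g (x - c) (w x) := by
  have hDg : Continuous (fderiv ℝ g) := hg.1.continuous_fderiv (by simp)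
  have hc : Continuous fun x => fderiv ℝ g (x - c) (w x) := by fun_prop
  have hsupp : HasCompactSupport fun x => fderiv ℝ g (x - c) (w x) :=
    .intro (hg.2.isCompact.image (continuous_add_const c)) fun x hx => by
      rw [fderiv_eq_zero_of_notMem_tsupport fun h => hx ⟨x - c, h, sub_add_cancel _ _⟩, zero_apply]
  obtain ⟨C, hC⟩ := hsupp.exists_bound_of_continuous hc
  exact integrable_of_continuous_of_bound q hc hC

theorem hasDerivAt_vintegral_comp_sub (q : SignedMeasure E) (hg : IsTestFunction g) {γ v : ℝ → E}
    (hγ : ∀ t, HasDerivAt γ (v t) t) (hv : Continuous v) (t : ℝ) :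
    HasDerivAt (fun t => ∫ᵛ x, g (x - γ t) ∂<•q) (∫ᵛ x, fderiv ℝ g (x - γ t) (-v t) ∂<•q) t := by
  have hDg : Continuous (fderiv ℝ g) := hg.1.continuous_fderiv (by simp)
  obtain ⟨B, hB⟩ := hg.2.exists_bound_of_continuous hg.1.continuous
  obtain ⟨C, hC⟩ := (hg.2.fderiv ℝ).exists_bound_of_continuous hDg
  refine hasDerivAt_vintegral q (f := fun t x => g (x - γ t))
    (f' := fun t x => fderiv ℝ g (x - γ t) (-v t)) (C := C * (‖v t‖ + 1))
    (fun t => hg.1.continuous.comp (by fun_prop)) (by fun_prop) (fun t x => hB _) ?_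
    fun t x => ((hg.1.differentiable (by simp)).differentiableAt.hasFDerivAt).comp_hasDerivAt t
      ((hγ t).const_sub x)
  filter_upwards [hv.norm.continuousAt.eventually_lt continuousAt_const (lt_add_one _)] with s hs x
  refine ((fderiv ℝ g _).le_of_opNorm_le (hC _) _).trans ?_
  have : 0 ≤ C := (norm_nonneg _).trans (hC 0)
  rw [norm_neg]
  gcongr

variable [FiniteDimensional ℝ E]

theorem continuous_vintegral_fderiv_comp_sub {q : T → SignedMeasure E} [TopologicalSpace T]
    [WeaklyLocallyCompactSpace T] (hq : IsWeakStarContinuous q) (hg : IsTestFunction g)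
    {τ : S → T} (hτ : Continuous τ) (hc : Continuous c) {w : S → E → E}
    (hw : Continuous (Function.uncurry w)) :
    Continuous fun s => ∫ᵛ x, fderiv ℝ g (x - c s) (w s x) ∂<•(q (τ s)) := by
  have hDg : Continuous (fderiv ℝ g) := hg.1.continuous_fderiv (by simp)
  have hf : Continuous (Function.uncurry fun s x => fderiv ℝ g (x - c s) (w s x)) := by fun_prop
  exact continuous_vintegral_of_translate_support hq hτ hf hc hg.2.isCompact fun s x hx => by
    simp only [fderiv_eq_zero_of_notMem_tsupport hx, zero_apply]

variable {q : ℝ → SignedMeasure E}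

theorem hasDerivAt_vintegral_testFunction (hu : Continuous (Function.uncurry u))
    (hq : IsWeakStarContinuous q) (hqu : IsTransportSolution u q) (hg : IsTestFunction g) (t : ℝ) :
    HasDerivAt (fun t => ∫ᵛ x, g x ∂<•(q t)) (∫ᵛ x, fderiv ℝ g x (u t x) ∂<•(q t)) t := by
  have hD := continuous_vintegral_fderiv_comp_sub hq hg continuous_id'
    (continuous_const (y := (0 : E))) hu
  simp only [sub_zero] at hD
  refine hasDerivAt_of_forall_integral_eq_zero
    (continuous_vintegral_of_translate_support (f := fun _ => g) hq continuous_id'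
      (hg.1.continuous.comp continuous_snd) (continuous_const (y := (0 : E))) hg.2.isCompact
      fun _ x hx => image_eq_zero_of_notMem_tsupport (by simpa using hx)) hD (fun χ hχ => ?_) t
  rw [← hqu _ (hχ.mul_prod hg)]
  refine integral_congr_ae (.of_forall fun t => ?_)
  simp only [materialDerivative_mul_prod hχ hg]
  have hsmul (a : ℝ) (f : E → ℝ) : ∫ᵛ x, a * f x ∂<•(q t) = a * ∫ᵛ x, f x ∂<•(q t) :=
    VectorMeasure.integral_fun_smul _ _ a f
  obtain ⟨C, hC⟩ := hg.2.exists_bound_of_continuous hg.1.continuous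
  have hint := integrable_fderiv_comp_sub (q t) hg 0 (w := u t) (by fun_prop)
  simp only [sub_zero] at hint
  rw [VectorMeasure.integral_fun_add, hsmul, hsmul]
  · exact Integrable.const_mul (integrable_of_continuous_of_bound (q t) hg.1.continuous hC) _
  · exact Integrable.const_mul hint _

theorem hasDerivAt_vintegral_translate (hu : Continuous (Function.uncurry u))
    (hq : IsWeakStarContinuous q) (hqu : IsTransportSolution u q) (hg : IsTestFunction g)
    {γ : ℝ → E} (hγ : IsIntegralCurve γ u) (t : ℝ) :
    HasDerivAt (fun t => ∫ᵛ x, g (x - γ t) ∂<•(q t))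
      (∫ᵛ x, fderiv ℝ g (x - γ t) (u t x - u t (γ t)) ∂<•(q t)) t := by
  have hγc : Continuous γ := continuous_iff_continuousAt.2 fun t => (hγ t).continuousAt
  have hs (s τ : ℝ) : HasDerivAt (fun s => ∫ᵛ x, g (x - γ τ) ∂<•(q s))
      (∫ᵛ x, fderiv ℝ g (x - γ τ) (u s x) ∂<•(q s)) s := by
    simpa only [fderiv_comp_sub] using hasDerivAt_vintegral_testFunction hu hq hqu
      (g := fun x => g (x - γ τ)) ⟨hg.1.comp (contDiff_id.sub contDiff_const),
        hg.2.comp_homeomorph (.subRight (γ τ))⟩ s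
  have hD {w : ℝ × ℝ → E → E} (hw : Continuous (Function.uncurry w)) :=
    continuous_vintegral_fderiv_comp_sub hq hg continuous_fst (hγc.comp continuous_snd) hw
  refine (hasDerivAt_diag (hD (w := fun p x => u p.1 x) (by fun_prop))
    (hD (w := fun p _ => -u p.2 (γ p.2)) (by fun_prop)) hs
    (fun s => hasDerivAt_vintegral_comp_sub (q s) hg hγ (by fun_prop)) t).congr_deriv ?_
  have hint (w : E → E) (hw : Continuous w) := integrable_fderiv_comp_sub (q t) hg (γ t) hw
  refine (VectorMeasure.integral_fun_add (hint _ (by fun_prop))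
    (hint _ (by fun_prop))).symm.trans ?_
  simp only [← map_add, sub_eq_add_neg]

end TransportDuality

/-! ### Mollification and the commutator -/

section Mollifier

variable {E : Type*} [NormedAddCommGroup E] [NormedSpace ℝ E] [MeasurableSpace E]
  {μ : Measure E}

theorem IsWeaklyDivFree.integral_fderiv_comp_sub_left {g : E → ℝ} (hg : IsTestFunction g)
    {w : E → E} (hw : IsWeaklyDivFree μ w) (x : E) :
    ∫ y, fderiv ℝ g (x - y) (w y) ∂μ = 0 := by
  have hgx : IsTestFunction fun y => g (x - y) :=
    ⟨hg.1.comp (contDiff_const.sub contDiff_id), hg.2.comp_homeomorph (.subLeft x)⟩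
  obtain ⟨C, hC⟩ := hgx.1.lipschitzWith_of_hasCompactSupport hgx.2 (by simp)
  have hderiv (y : E) : fderiv ℝ (fun y => g (x - y)) y = -fderiv ℝ g (x - y) := by
    have h : HasFDerivAt (fun y => g (x - y))
        ((fderiv ℝ g (x - y)).comp (-ContinuousLinearMap.id ℝ E)) y :=
      (hg.1.differentiable (by simp) (x - y)).hasFDerivAt.comp y ((hasFDerivAt_id y).const_sub x)
    rw [h.fderiv, ContinuousLinearMap.comp_neg, ContinuousLinearMap.comp_id]
  simpa [hderiv, integral_neg] using hw hC hgx.2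

variable [FiniteDimensional ℝ E]

variable (μ) in
/-- The smooth bump function of integral one on the unit ball from which `mollifier` is built. -/
def unitBump : E → ℝ :=
  ContDiffBump.normed (c := (0 : E)) ⟨1 / 2, 1, by norm_num, by norm_num⟩ μ

variable (μ) in
/-- The standard mollifier at scale `r`: a nonnegative smooth function of integral one supported in
the ball of radius `r`. -/
def mollifier (r : ℝ) (x : E) : ℝ := (r ^ Module.finrank ℝ E)⁻¹ * unitBump μ (r⁻¹ • x)

variable {r : ℝ}

theorem mollifier_nonneg (hr : 0 ≤ r) (x : E) : 0 ≤ mollifier μ r x :=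
  mul_nonneg (by positivity) (ContDiffBump.nonneg_normed _ _)

variable [BorelSpace E] [μ.IsAddHaarMeasure]

variable (μ) in
theorem isTestFunction_unitBump : IsTestFunction (unitBump μ) :=
  ⟨ContDiffBump.contDiff_normed _, ContDiffBump.hasCompactSupport_normed _⟩

theorem support_mollifier_subset (hr : 0 < r) :
    Function.support (mollifier μ r) ⊆ Metric.ball 0 r := fun x hx => by
  have hx' : r⁻¹ • x ∈ Function.support (unitBump μ) := fun h => hx (by simp [mollifier, h])
  rw [unitBump, ContDiffBump.support_normed_eq, mem_ball_zero_iff, norm_smul, norm_inv,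
    Real.norm_of_nonneg hr.le, inv_mul_lt_iff₀ hr, mul_one] at hx'
  exact mem_ball_zero_iff.2 hx'

theorem isTestFunction_mollifier (hr : 0 < r) : IsTestFunction (mollifier μ r) :=
  ⟨contDiff_const.mul ((isTestFunction_unitBump μ).1.comp (contDiff_const_smul _)),
    .of_support_subset_isCompact (isCompact_closedBall 0 r)
      ((support_mollifier_subset hr).trans Metric.ball_subset_closedBall)⟩

theorem integral_mollifier (hr : 0 < r) : ∫ x, mollifier μ r x ∂μ = 1 := by
  simp only [mollifier]
  rw [integral_const_mul, Measure.integral_comp_inv_smul_of_nonneg _ _ hr.le, unitBump,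
    ContDiffBump.integral_normed, smul_eq_mul, mul_one, inv_mul_cancel₀ (by positivity)]

variable (μ) in
theorem exists_norm_fderiv_mollifier_le : ∃ G, ∀ r > 0, ∀ x : E,
    ‖fderiv ℝ (mollifier μ r) x‖ ≤ G / r ^ (Module.finrank ℝ E + 1) := by
  have hρ := isTestFunction_unitBump μ
  obtain ⟨G, hG⟩ := (hρ.2.fderiv ℝ).exists_bound_of_continuous (hρ.1.continuous_fderiv (by simp))
  refine ⟨G, fun r hr x => ?_⟩
  have hderiv : HasFDerivAt (mollifier μ r) ((r ^ Module.finrank ℝ E)⁻¹ •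
      (fderiv ℝ (unitBump μ) (r⁻¹ • x)).comp (r⁻¹ • ContinuousLinearMap.id ℝ E)) x :=
    ((hρ.1.differentiable (by simp) _).hasFDerivAt.comp x
      ((hasFDerivAt_id x).const_smul r⁻¹)).const_mul _
  rw [hderiv.fderiv, ContinuousLinearMap.comp_smul, ContinuousLinearMap.comp_id, norm_smul,
    norm_smul, norm_inv, norm_inv, norm_pow, Real.norm_of_nonneg hr.le, ← mul_assoc, ← mul_inv,
    ← pow_succ, div_eq_inv_mul]
  gcongr
  exact hG _

theorem norm_integral_mul_mollifier_sub_le (hr : 0 < r) {ψ : E → ℝ} (hψ : Continuous ψ) {κ : ℝ}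
    {x : E} (hκ : ∀ y, ‖y - x‖ ≤ r → ‖ψ y - ψ x‖ ≤ κ) :
    ‖∫ y, ψ y * mollifier μ r (x - y) ∂μ - ψ x‖ ≤ κ := by
  have h := dist_convolution_le (μ := μ) ((norm_nonneg _).trans (hκ x (by simpa using hr.le)))
    (support_mollifier_subset hr) (mollifier_nonneg hr.le) (integral_mollifier hr)
    hψ.aestronglyMeasurable fun y hy => (dist_eq_norm _ _).trans_le
      (hκ y ((dist_eq_norm y x).symm.trans_le (Metric.mem_ball.1 hy).le))
  rw [convolution_lsmul_swap, dist_eq_norm] at h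
  simpa only [smul_eq_mul, mul_comm (ψ _)] using h

theorem IsTestFunction.integral_fderiv_comp_sub_left {g : E → ℝ} (hg : IsTestFunction g)
    (x c : E) : ∫ y, fderiv ℝ g (x - y) c ∂μ = 0 := by
  rw [integral_sub_left_eq_self (fun y => fderiv ℝ g y c)]
  have hDg : Continuous (fderiv ℝ g) := hg.1.continuous_fderiv (by simp)
  have hDgc : Integrable (fun y => fderiv ℝ g y c) μ :=
    Continuous.integrable_of_hasCompactSupport (by fun_prop) (hg.2.fderiv_apply ℝ c)
  simpa using integral_mul_fderiv_eq_neg_fderiv_mul_of_integrable (μ := μ) (f := fun _ => (1 : ℝ))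
    (g := g) (v := c) (by simp) (by simpa using hDgc)
    (by simpa using hg.1.continuous.integrable_of_hasCompactSupport hg.2)
    (fun _ _ => by fun_prop) fun y _ => hg.1.differentiable (by simp) y

/-- Since `w` is divergence free, `ψ y` may be replaced by `ψ y - ψ x`. -/
theorem norm_integral_commutator_le {g ψ : E → ℝ} {w : E → E} (hg : IsTestFunction g)
    (hψ : Continuous ψ) (hwc : Continuous w) (hw : IsWeaklyDivFree μ w) {r κ G L : ℝ}
    (hgr : Function.support g ⊆ Metric.ball 0 r) (hG : ∀ x, ‖fderiv ℝ g x‖ ≤ G) {x : E}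
    (hκ : ∀ y, ‖y - x‖ ≤ r → ‖ψ y - ψ x‖ ≤ κ) (hL : ∀ y, ‖y - x‖ ≤ r → ‖w x - w y‖ ≤ L) :
    ‖∫ y, ψ y * fderiv ℝ g (x - y) (w x - w y) ∂μ‖ ≤
      κ * (G * L) * μ.real (Metric.closedBall x r) := by
  have hDg : Continuous (fderiv ℝ g) := hg.1.continuous_fderiv (by simp)
  have hDgx : HasCompactSupport fun y => fderiv ℝ g (x - y) :=
    (hg.2.fderiv ℝ).comp_homeomorph (.subLeft x)
  have hint {f : E → ℝ} {u : E → E} (hf : Continuous f) (hu : Continuous u) :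
      Integrable (fun y => f y * fderiv ℝ g (x - y) (u y)) μ :=
    Continuous.integrable_of_hasCompactSupport (by fun_prop)
      (hDgx.mono fun y hy h => hy (by simp [h]))
  have hcancel : ∫ y, ψ x * fderiv ℝ g (x - y) (w x - w y) ∂μ = 0 := by
    have hone {u : E → E} (hu : Continuous u) :
        Integrable (fun y => fderiv ℝ g (x - y) (u y)) μ := by
      simpa using hint (f := fun _ => 1) continuous_const hu
    simp only [map_sub]
    rw [integral_const_mul, integral_sub (hone continuous_const) (hone hwc),
      hg.integral_fderiv_comp_sub_left, hw.integral_fderiv_comp_sub_left hg, sub_zero, mul_zero]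
  have hzero (y : E) (hy : y ∉ Metric.closedBall x r) :
      (ψ y - ψ x) * fderiv ℝ g (x - y) (w x - w y) = 0 := by
    have hxy : x - y ∉ tsupport g := fun h => hy <| by
      have := Metric.closure_ball_subset_closedBall (closure_mono hgr h)
      rwa [mem_closedBall_zero_iff, ← dist_eq_norm, dist_comm] at this
    rw [fderiv_eq_zero_of_notMem_tsupport hxy, zero_apply, mul_zero]
  rw [← sub_zero (∫ y, _ ∂μ), ← hcancel, ← integral_sub (hint hψ (by fun_prop))
    (hint continuous_const (by fun_prop))]
  simp only [← sub_mul]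
  rw [← setIntegral_eq_integral_of_forall_compl_eq_zero hzero]
  refine norm_setIntegral_le_of_norm_le_const measure_closedBall_lt_top fun y hy => ?_
  rw [Metric.mem_closedBall, dist_eq_norm] at hy
  have hκ0 := (norm_nonneg _).trans (hκ y hy)
  rw [norm_mul]
  gcongr
  · exact hκ y hy
  · exact (fderiv ℝ g _).le_of_opNorm_le_of_le (hG _) (hL y hy)

end Mollifier

/-! ### Uniqueness for the transport equation -/

section CompactlySupportedIntegrals

theorem hasCompactSupport_mul_of_translate_support {E : Type*} [NormedAddCommGroup E] {ψ : E → ℝ}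
    (hψ : HasCompactSupport ψ) {H : E → E → ℝ} {K : Set E} (hK : IsCompact K)
    (hHK : ∀ y x, x - y ∉ K → H y x = 0) :
    HasCompactSupport (Function.uncurry fun y x => ψ y * H y x) := by
  refine .intro ((hψ.isCompact.prod hK).image (f := fun p : E × E => (p.1, p.2 + p.1))
    (by fun_prop)) fun p hp => ?_
  by_cases hp₁ : p.1 ∈ tsupport ψ
  · have hp₂ : p.2 - p.1 ∉ K := fun h => hp ⟨(p.1, p.2 - p.1), ⟨hp₁, h⟩, by simp⟩
    exact mul_eq_zero_of_right _ (hHK _ _ hp₂)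
  · exact mul_eq_zero_of_left (image_eq_zero_of_notMem_tsupport hp₁) _

theorem norm_vintegral_le_norm_pairing_mul {X : Type*} [TopologicalSpace X] [MeasurableSpace X]
    [OpensMeasurableSpace X] (q : SignedMeasure X) {f : X → ℝ} (hf : Continuous f)
    (hfc : HasCompactSupport f) {C : ℝ} (hC0 : 0 ≤ C) (hC : ∀ x, ‖f x‖ ≤ C) :
    ‖∫ᵛ x, f x ∂<•q‖ ≤ ‖pairing q‖ * C :=
  (norm_vintegral_le_norm_pairing q ⟨⟨f, hf⟩, hfc.is_zero_at_infty⟩).trans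
    (by gcongr; exact norm_zeroAtInfty_le hC0 hC)

variable {X Y : Type*} [TopologicalSpace X] [TopologicalSpace Y] [MeasurableSpace X]
  {μ : Measure X} {F : X → Y → ℝ}

theorem hasCompactSupport_integral [R1Space Y] (hFc : HasCompactSupport (Function.uncurry F)) :
    HasCompactSupport fun y => ∫ x, F x y ∂μ :=
  .intro (hFc.isCompact.image continuous_snd) fun y hy => by
    have hzero (x : X) : F x y = 0 := image_eq_zero_of_notMem_tsupport
      (f := Function.uncurry F) (x := (x, y)) fun h => hy (mem_image_of_mem Prod.snd h)
    simp only [hzero, integral_zero]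

variable [OpensMeasurableSpace X] [IsFiniteMeasureOnCompacts μ]

theorem continuous_integral (hF : Continuous (Function.uncurry F))
    (hFc : HasCompactSupport (Function.uncurry F)) : Continuous fun y => ∫ x, F x y ∂μ := by
  rw [← continuousOn_univ]
  exact continuousOn_integral_of_compact_support (hFc.isCompact.image continuous_fst)
    (hF.comp continuous_swap).continuousOn fun y x _ hx => image_eq_zero_of_notMem_tsupport
      (f := Function.uncurry F) (x := (x, y)) fun h => hx (mem_image_of_mem Prod.fst h)

theorem hasDerivAt_integral_mul {φ : X → ℝ}
    (hφ : Continuous φ) (hφc : HasCompactSupport φ) {A A' : ℝ → X → ℝ} (hA : ∀ t, Continuous (A t))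
    (hA' : Continuous (Function.uncurry A')) (h : ∀ t x, HasDerivAt (fun t => A t x) (A' t x) t)
    (t : ℝ) : HasDerivAt (fun t => ∫ x, φ x * A t x ∂μ) (∫ x, φ x * A' t x ∂μ) t := by
  obtain ⟨C, hC⟩ := (isCompact_Icc.prod hφc.isCompact).exists_bound_of_continuousOn
    (s := Icc (t - 1) (t + 1) ×ˢ tsupport φ) hA'.continuousOn
  refine (hasDerivAt_integral_of_dominated_loc_of_deriv_le (bound := fun x => ‖φ x‖ * C)
    (F := fun t x => φ x * A t x) (F' := fun t x => φ x * A' t x)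
    (Icc_mem_nhds (sub_one_lt t) (lt_add_one t)) (.of_forall fun s => ?_) ?_ ?_
    (ae_of_all _ fun x s hs => ?_) ?_ (ae_of_all _ fun x s _ => (h s x).const_mul (φ x))).2
  · exact (hφ.mul (hA s)).aestronglyMeasurable
  · exact (hφ.mul (hA t)).integrable_of_hasCompactSupport hφc.mul_right
  · exact (hφ.mul (hA'.comp (.prodMk_right t))).aestronglyMeasurable
  · rw [norm_mul]
    by_cases hx : x ∈ tsupport φ
    · gcongr
      exact hC (s, x) ⟨hs, hx⟩
    · simp [image_eq_zero_of_notMem_tsupport hx]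
  · exact (hφ.norm.integrable_of_hasCompactSupport hφc.norm).mul_const C

variable [MeasurableSpace Y] [OpensMeasurableSpace Y]

theorem integral_vintegral_swap [R1Space X] [R1Space Y] (q : SignedMeasure Y)
    (hF : Continuous (Function.uncurry F)) (hFc : HasCompactSupport (Function.uncurry F)) :
    ∫ x, ∫ᵛ y, F x y ∂<•q ∂μ = ∫ᵛ y, ∫ x, F x y ∂μ ∂<•q := by
  obtain ⟨B, hB⟩ := hFc.exists_bound_of_continuous hF
  obtain ⟨C, hC⟩ := (hasCompactSupport_integral (μ := μ) hFc).exists_bound_of_continuous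
    (continuous_integral hF hFc)
  have hsub (x : X) : ∫ᵛ y, F x y ∂<•q = ∫ y, F x y ∂q.toJordanDecomposition.posPart -
      ∫ y, F x y ∂q.toJordanDecomposition.negPart :=
    vintegral_eq_sub q (integrable_of_continuous_of_bound q (hF.comp (.prodMk_right x))
      fun y => hB (x, y))
  have hint (ν : Measure Y) [IsFiniteMeasure ν] : Integrable (fun x => ∫ y, F x y ∂ν) μ :=
    have hFs : Continuous (Function.uncurry fun y x => F x y) := hF.comp continuous_swap
    have hFcs : HasCompactSupport (Function.uncurry fun y x => F x y) :=
      hFc.comp_homeomorph (.prodComm Y X)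
    (continuous_integral hFs hFcs).integrable_of_hasCompactSupport
      (hasCompactSupport_integral hFcs)
  simp only [hsub]
  rw [integral_sub (hint _) (hint _), integral_integral_swap_of_hasCompactSupport hF hFc,
    integral_integral_swap_of_hasCompactSupport hF hFc, vintegral_eq_sub q
    (integrable_of_continuous_of_bound q (continuous_integral hF hFc) hC)]

end CompactlySupportedIntegrals

namespace IsOsgoodField

variable {E : Type*} [NormedAddCommGroup E] [NormedSpace ℝ E] [FiniteDimensional ℝ E]
  [MeasurableSpace E] {μ : Measure E} {v : ℝ → E → E} {φ : E → ℝ}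

variable [BorelSpace E]

theorem integral_mul_comp_flow (hv : IsOsgoodField v) {t : ℝ}
    (hmp : MeasurePreserving (hv.flowHomeo 0 t) μ μ) (φ f : E → ℝ) :
    ∫ x, φ x * f (hv.flow 0 t x) ∂μ = ∫ y, φ (hv.flow t 0 y) * f y ∂μ := by
  have h := hmp.integral_comp (hv.flowHomeo 0 t).measurableEmbedding
    fun y => φ (hv.flow t 0 y) * f y
  simpa [flowHomeo] using h

theorem integral_mul_vintegral_comp_flow [μ.IsAddHaarMeasure] (hv : IsOsgoodField v) {t : ℝ}
    (hmp : MeasurePreserving (hv.flowHomeo 0 t) μ μ) (p : SignedMeasure E) (hφ : Continuous φ)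
    (hφc : HasCompactSupport φ) {H : E → E → ℝ} (hH : Continuous (Function.uncurry H)) {K : Set E}
    (hK : IsCompact K) (hHK : ∀ y x, x - y ∉ K → H y x = 0) :
    ∫ x, φ x * ∫ᵛ z, H (hv.flow 0 t x) z ∂<•p ∂μ =
      ∫ᵛ z, ∫ y, φ (hv.flow t 0 y) * H y z ∂μ ∂<•p := by
  have hsmul (a : ℝ) (f : E → ℝ) : ∫ᵛ x, a * f x ∂<•p = a * ∫ᵛ x, f x ∂<•p :=
    VectorMeasure.integral_fun_smul _ _ a f
  have hψ := hφ.comp (hv.continuous_flow_right t 0)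
  rw [hv.integral_mul_comp_flow hmp φ fun y => ∫ᵛ z, H y z ∂<•p]
  simp only [← hsmul]
  exact integral_vintegral_swap p (F := fun y z => φ (hv.flow t 0 y) * H y z)
    ((hψ.comp continuous_fst).mul hH)
    (hasCompactSupport_mul_of_translate_support (hφc.comp_homeomorph (hv.flowHomeo t 0)) hK hHK)

theorem hasDerivAt_integral_mul_vintegral_comp_flow [IsFiniteMeasureOnCompacts μ]
    (hv : IsOsgoodField v) {q : ℝ → SignedMeasure E} (hq : IsWeakStarContinuous q)
    (hqv : IsTransportSolution v q) (hφ : Continuous φ) (hφc : HasCompactSupport φ) {g : E → ℝ}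
    (hg : IsTestFunction g) (t : ℝ) :
    HasDerivAt (fun t => ∫ x, φ x * ∫ᵛ z, g (z - hv.flow 0 t x) ∂<•(q t) ∂μ)
      (∫ x, φ x * ∫ᵛ z, fderiv ℝ g (z - hv.flow 0 t x) (v t z - v t (hv.flow 0 t x)) ∂<•(q t) ∂μ)
      t := by
  have hvc := hv.continuous
  have hflow := hv.continuous_flow 0
  refine hasDerivAt_integral_mul hφ hφc (fun s => ?_) ?_ (fun s x =>
    hasDerivAt_vintegral_translate hv.continuous hq hqv hg (hv.isIntegralCurve_flow 0 x) s) t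
  · exact continuous_vintegral_of_translate_support hq (continuous_const (y := s))
      (hg.1.continuous.comp (by fun_prop)) (hv.continuous_flow_right 0 s) hg.2.isCompact
      fun x z hz => image_eq_zero_of_notMem_tsupport hz
  · exact continuous_vintegral_fderiv_comp_sub hq hg (S := ℝ × E) continuous_fst hflow
      (w := fun p z => v p.1 z - v p.1 (hv.flow 0 p.1 p.2)) (by fun_prop)

end IsOsgoodField

namespace IsOsgoodField

variable {E : Type*} [NormedAddCommGroup E] [NormedSpace ℝ E] [FiniteDimensional ℝ E]
  [MeasurableSpace E] [BorelSpace E] {μ : Measure E} [μ.IsAddHaarMeasure] {v : ℝ → E → E}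
  {φ : E → ℝ}

theorem norm_integral_mul_vintegral_commutator_le (hv : IsOsgoodField v) {t : ℝ}
    (hmp : MeasurePreserving (hv.flowHomeo 0 t) μ μ) (hdiv : IsWeaklyDivFree μ (v t))
    (p : SignedMeasure E) (hφ : Continuous φ) (hφc : HasCompactSupport φ) {g : E → ℝ}
    (hg : IsTestFunction g) {r κ G L : ℝ} (hr : 0 ≤ r) (hgr : Function.support g ⊆ Metric.ball 0 r)
    (hG : ∀ x, ‖fderiv ℝ g x‖ ≤ G)
    (hκ : ∀ x y, ‖x - y‖ ≤ r → ‖φ (hv.flow t 0 x) - φ (hv.flow t 0 y)‖ ≤ κ)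
    (hL : ∀ x y, ‖x - y‖ ≤ r → ‖v t x - v t y‖ ≤ L) :
    ‖∫ x, φ x * ∫ᵛ z, fderiv ℝ g (z - hv.flow 0 t x) (v t z - v t (hv.flow 0 t x)) ∂<•p ∂μ‖ ≤
      ‖pairing p‖ * (κ * (G * L) * (r ^ Module.finrank ℝ E * μ.real (Metric.closedBall 0 1))) := by
  have hvt : Continuous (v t) := hv.continuous.comp (.prodMk_right t)
  have hDg : Continuous (fderiv ℝ g) := hg.1.continuous_fderiv (by simp)
  have hψ := hφ.comp (hv.continuous_flow_right t 0)
  have hH : Continuous (Function.uncurry fun y z => fderiv ℝ g (z - y) (v t z - v t y)) := by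
    fun_prop
  have hHK (y z : E) (hz : z - y ∉ tsupport g) : fderiv ℝ g (z - y) (v t z - v t y) = 0 := by
    rw [fderiv_eq_zero_of_notMem_tsupport hz, zero_apply]
  have hFc := hasCompactSupport_mul_of_translate_support
    (hφc.comp_homeomorph (hv.flowHomeo t 0)) hg.2.isCompact hHK
  have hF := (hψ.comp continuous_fst).mul hH
  rw [hv.integral_mul_vintegral_comp_flow hmp p hφ hφc hH hg.2.isCompact hHK]
  have hκ0 : 0 ≤ κ := (norm_nonneg _).trans (hκ 0 0 (by simpa using hr))
  have hG0 : 0 ≤ G := (norm_nonneg _).trans (hG 0)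
  have hL0 : 0 ≤ L := (norm_nonneg _).trans (hL 0 0 (by simpa using hr))
  refine norm_vintegral_le_norm_pairing_mul p (continuous_integral hF hFc)
    (hasCompactSupport_integral hFc) (by positivity) fun z => ?_
  rw [← Measure.addHaar_real_closedBall' μ z hr]
  exact norm_integral_commutator_le hg hψ hvt hdiv hgr hG (fun y => hκ y z)
    fun y hy => hL z y ((norm_sub_rev z y).trans_le hy)

theorem norm_integral_mul_vintegral_mollifier_sub_le (hv : IsOsgoodField v) {t : ℝ}
    (hmp : MeasurePreserving (hv.flowHomeo 0 t) μ μ) (p : SignedMeasure E) (hφ : Continuous φ)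
    (hφc : HasCompactSupport φ) {r κ : ℝ} (hr : 0 < r)
    (hκ : ∀ x y, ‖x - y‖ ≤ r → ‖φ (hv.flow t 0 x) - φ (hv.flow t 0 y)‖ ≤ κ) :
    ‖∫ x, φ x * ∫ᵛ z, mollifier μ r (z - hv.flow 0 t x) ∂<•p ∂μ -
      ∫ᵛ z, φ (hv.flow t 0 z) ∂<•p‖ ≤ ‖pairing p‖ * κ := by
  have hg := isTestFunction_mollifier (μ := μ) hr
  have hgc : Continuous (mollifier μ r) := hg.1.continuous
  have hψ : Continuous fun y => φ (hv.flow t 0 y) := hφ.comp (hv.continuous_flow_right t 0)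
  have hψc : HasCompactSupport fun y => φ (hv.flow t 0 y) :=
    hφc.comp_homeomorph (hv.flowHomeo t 0)
  have hH : Continuous (Function.uncurry fun y z => mollifier μ r (z - y)) := by fun_prop
  have hHK (y z : E) (hz : z - y ∉ tsupport (mollifier μ r)) : mollifier μ r (z - y) = 0 :=
    image_eq_zero_of_notMem_tsupport hz
  have hFc := hasCompactSupport_mul_of_translate_support hψc hg.2.isCompact hHK
  have hF := (hψ.comp continuous_fst).mul hH
  have hFi := continuous_integral (μ := μ) hF hFc
  have hFic := hasCompactSupport_integral (μ := μ) hFc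
  have hint {f : E → ℝ} (hf : Continuous f) (hfc : HasCompactSupport f) : p.Integrable f :=
    have ⟨_, hC⟩ := hfc.exists_bound_of_continuous hf
    integrable_of_continuous_of_bound p hf hC
  rw [hv.integral_mul_vintegral_comp_flow hmp p hφ hφc hH hg.2.isCompact hHK,
    ← VectorMeasure.integral_fun_sub (hint hFi hFic) (hint hψ hψc)]
  exact norm_vintegral_le_norm_pairing_mul p (hFi.sub hψ) (hFic.sub hψc)
    ((norm_nonneg _).trans (hκ 0 0 (by simpa using hr.le)))
    fun z => norm_integral_mul_mollifier_sub_le hr hψ fun y => hκ y z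

theorem norm_integral_mul_vintegral_mollifier_sub_initial_le (hv : IsOsgoodField v)
    (hmp : ∀ t, MeasurePreserving (hv.flowHomeo 0 t) μ μ) (hdiv : ∀ t, IsWeaklyDivFree μ (v t))
    {q : ℝ → SignedMeasure E} (hq : IsWeakStarContinuous q) (hqv : IsTransportSolution v q)
    (hφ : Continuous φ) (hφc : HasCompactSupport φ) {T M P G r κ : ℝ} (hM : 0 ≤ M)
    (hlog : LogLipOn v M T) (hP : ∀ s ∈ Icc (-T) T, ‖pairing (q s)‖ ≤ P)
    (hG : ∀ x, ‖fderiv ℝ (mollifier μ r) x‖ ≤ G / r ^ (Module.finrank ℝ E + 1))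
    (hr : 0 < r) (hr1 : r ≤ 1) (hκ : ∀ s ∈ Icc (-T) T, ∀ x y, ‖x - y‖ ≤ r →
      ‖φ (hv.flow s 0 x) - φ (hv.flow s 0 y)‖ ≤ κ) {t : ℝ} (ht : t ∈ Icc (-T) T) :
    ‖∫ x, φ x * ∫ᵛ z, mollifier μ r (z - hv.flow 0 t x) ∂<•(q t) ∂μ -
      ∫ x, φ x * ∫ᵛ z, mollifier μ r (z - x) ∂<•(q 0) ∂μ‖ ≤
      P * (2 * G * M * μ.real (Metric.closedBall 0 1) * ((1 - Real.log r) * κ)) * |t| := by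
  have h₀ : (0 : ℝ) ∈ Icc (-T) T := by constructor <;> linarith [ht.1, ht.2]
  have hκ0 : 0 ≤ κ := (norm_nonneg _).trans (hκ 0 h₀ 0 0 (by simpa using hr.le))
  have hG0 : 0 ≤ G := by
    have := (norm_nonneg _).trans (hG 0)
    rwa [le_div_iff₀ (by positivity), zero_mul] at this
  have hP0 : 0 ≤ P := (norm_nonneg (pairing (q 0))).trans (hP 0 h₀)
  have hlog0 : 1 ≤ 1 - Real.log r := by linarith [Real.log_nonpos hr.le hr1]
  have hL (s : ℝ) (hs : s ∈ Icc (-T) T) (x y : E) (hxy : ‖x - y‖ ≤ r) :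
      ‖v s x - v s y‖ ≤ M * (2 * (1 - Real.log r) * r) := by
    refine (hlog s hs x y r hr hr1).trans ?_
    gcongr
    nlinarith
  have hderiv (s : ℝ) := hv.hasDerivAt_integral_mul_vintegral_comp_flow (μ := μ) hq hqv hφ hφc
    (isTestFunction_mollifier (μ := μ) hr) s
  have hbound (s : ℝ) (hs : s ∈ Icc (-T) T) := calc
    _ ≤ _ := hv.norm_integral_mul_vintegral_commutator_le (hmp s) (hdiv s) (q s) hφ hφc
      (isTestFunction_mollifier hr) hr.le (support_mollifier_subset hr) hG (hκ s hs) (hL s hs)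
    _ ≤ P * (2 * G * M * μ.real (Metric.closedBall 0 1) * ((1 - Real.log r) * κ)) := by
      refine mul_le_mul (hP s hs) (le_of_eq ?_) (by positivity) hP0
      rw [pow_succ]
      field_simp
  have h := (convex_Icc (-T) T).norm_image_sub_le_of_norm_hasDerivWithin_le
    (fun s _ => (hderiv s).hasDerivWithinAt) hbound h₀ ht
  simpa only [flow_self, sub_zero, Real.norm_eq_abs t] using h

theorem norm_vintegral_comp_flow_sub_le (hv : IsOsgoodField v)
    (hmp : ∀ t, MeasurePreserving (hv.flowHomeo 0 t) μ μ) (hdiv : ∀ t, IsWeaklyDivFree μ (v t))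
    {q : ℝ → SignedMeasure E} (hq : IsWeakStarContinuous q) (hqv : IsTransportSolution v q)
    (hφ : Continuous φ) (hφc : HasCompactSupport φ) {T M P G r κ : ℝ} (hM : 0 ≤ M)
    (hlog : LogLipOn v M T) (hP : ∀ s ∈ Icc (-T) T, ‖pairing (q s)‖ ≤ P)
    (hG : ∀ x, ‖fderiv ℝ (mollifier μ r) x‖ ≤ G / r ^ (Module.finrank ℝ E + 1))
    (hr : 0 < r) (hr1 : r ≤ 1) (hκ : ∀ s ∈ Icc (-T) T, ∀ x y, ‖x - y‖ ≤ r →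
      ‖φ (hv.flow s 0 x) - φ (hv.flow s 0 y)‖ ≤ κ) {t : ℝ} (ht : t ∈ Icc (-T) T) :
    ‖∫ᵛ x, φ (hv.flow t 0 x) ∂<•(q t) - ∫ᵛ x, φ x ∂<•(q 0)‖ ≤ 2 * (P * κ) +
      P * (2 * G * M * μ.real (Metric.closedBall 0 1) * ((1 - Real.log r) * κ)) * |t| := by
  have h₀ : (0 : ℝ) ∈ Icc (-T) T := by constructor <;> linarith [ht.1, ht.2]
  have hκ0 : 0 ≤ κ := (norm_nonneg _).trans (hκ 0 h₀ 0 0 (by simpa using hr.le))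
  set I : ℝ → ℝ := fun s => ∫ x, φ x * ∫ᵛ z, mollifier μ r (z - hv.flow 0 s x) ∂<•(q s) ∂μ
  have herr (s : ℝ) (hs : s ∈ Icc (-T) T) :
      ‖I s - ∫ᵛ x, φ (hv.flow s 0 x) ∂<•(q s)‖ ≤ P * κ :=
    (hv.norm_integral_mul_vintegral_mollifier_sub_le (hmp s) (q s) hφ hφc hr (hκ s hs)).trans
      (by gcongr; exact hP s hs)
  have hI := hv.norm_integral_mul_vintegral_mollifier_sub_initial_le hmp hdiv hq hqv hφ hφc hM hlog
    hP hG hr hr1 hκ ht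
  have herr_t := herr t ht
  have herr_0 := herr 0 h₀
  simp only [I, flow_self] at herr_0
  rw [norm_sub_rev] at herr_t
  rw [two_mul, add_right_comm]
  exact (norm_sub_le_norm_sub_add_norm_sub _ _ _).trans (add_le_add
    ((norm_sub_le_norm_sub_add_norm_sub _ _ _).trans (add_le_add herr_t hI)) herr_0)

theorem vintegral_comp_flow (hv : IsOsgoodField v)
    (hmp : ∀ t, MeasurePreserving (hv.flowHomeo 0 t) μ μ) (hdiv : ∀ t, IsWeaklyDivFree μ (v t))
    {q : ℝ → SignedMeasure E} (hq : IsWeakStarContinuous q) (hqv : IsTransportSolution v q)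
    (hφ : IsTestFunction φ) (t : ℝ) :
    ∫ᵛ x, φ (hv.flow t 0 x) ∂<•(q t) = ∫ᵛ x, φ x ∂<•(q 0) := by
  have ht : t ∈ Icc (-|t|) |t| := abs_le.1 le_rfl
  have h₀ : (0 : ℝ) ∈ Icc (-|t|) |t| := by simp
  obtain ⟨K, hK⟩ := hφ.1.lipschitzWith_of_hasCompactSupport hφ.2 (by simp)
  obtain ⟨M, hM, hlog, -⟩ := hv.exists_logLipOn |t|
  obtain ⟨P, hP, hqP⟩ := hq.exists_norm_pairing_le (isCompact_Icc (a := -|t|) (b := |t|))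
  obtain ⟨G, hG⟩ := exists_norm_fderiv_mollifier_le μ
  obtain ⟨κ, hκ, hflow⟩ := hv.exists_flow_modulus |t|
  set A := 2 * (P * K) + P * (2 * G * M * μ.real (Metric.closedBall 0 1) * K) * |t|
  have hlim : Tendsto (fun r => A * ((1 - Real.log r) * κ r)) (𝓝[>] 0) (𝓝 0) := by
    simpa using hκ.const_mul A
  suffices ‖∫ᵛ x, φ (hv.flow t 0 x) ∂<•(q t) - ∫ᵛ x, φ x ∂<•(q 0)‖ ≤ 0 from
    sub_eq_zero.1 (norm_le_zero_iff.1 this)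
  refine ge_of_tendsto hlim ?_
  filter_upwards [hflow, Ioo_mem_nhdsGT zero_lt_one] with r hr ⟨hr0, hr1⟩
  have hκ0 : 0 ≤ κ r := (norm_nonneg _).trans (hr 0 h₀ 0 0 (by simpa using hr0.le) 0 h₀)
  have hlog0 : Real.log r ≤ 0 := Real.log_nonpos hr0.le hr1.le
  have hφκ (s : ℝ) (hs : s ∈ Icc (-|t|) |t|) (x y : E) (hxy : ‖x - y‖ ≤ r) :
      ‖φ (hv.flow s 0 x) - φ (hv.flow s 0 y)‖ ≤ K * κ r :=
    (hK.norm_sub_le _ _).trans (by gcongr; exact hr s hs x y hxy 0 h₀)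
  calc ‖∫ᵛ x, φ (hv.flow t 0 x) ∂<•(q t) - ∫ᵛ x, φ x ∂<•(q 0)‖
      ≤ 2 * (P * (K * κ r)) + P * (2 * G * M * μ.real (Metric.closedBall 0 1) *
          ((1 - Real.log r) * (K * κ r))) * |t| :=
        hv.norm_vintegral_comp_flow_sub_le hmp hdiv hq hqv hφ.1.continuous hφ.2 hM hlog hqP
          (hG r hr0) hr0 hr1.le hφκ ht
    _ ≤ 2 * (P * (K * ((1 - Real.log r) * κ r))) + P * (2 * G * M *
          μ.real (Metric.closedBall 0 1) * ((1 - Real.log r) * (K * κ r))) * |t| := by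
        gcongr
        nlinarith
    _ = A * ((1 - Real.log r) * κ r) := by ring

theorem eq_map_flow (hv : IsOsgoodField v)
    (hmp : ∀ t, MeasurePreserving (hv.flowHomeo 0 t) μ μ) (hdiv : ∀ t, IsWeaklyDivFree μ (v t))
    {q : ℝ → SignedMeasure E} (hq : IsWeakStarContinuous q) (hqv : IsTransportSolution v q)
    (t : ℝ) : q t = VectorMeasure.map (q 0) (hv.flow 0 t) := by
  have hflow (s s' : ℝ) : Measurable (hv.flow s s') := (hv.continuous_flow_right s s').measurable
  have hmap : VectorMeasure.map (q t) (hv.flow t 0) = q 0 := by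
    refine signedMeasure_ext_of_testFunctions fun φ hφ => ?_
    obtain ⟨C, hC⟩ := hφ.2.exists_bound_of_continuous hφ.1.continuous
    rw [vintegral_map (q t) (hv.continuous_flow_right t 0) hφ.1.continuous hC,
      hv.vintegral_comp_flow hmp hdiv hq hqv hφ]
  ext s hs
  rw [VectorMeasure.map_apply _ (hflow 0 t) hs, ← hmap,
    VectorMeasure.map_apply _ (hflow t 0) (hflow 0 t hs), ← preimage_comp]
  simp [Function.comp_def]

end IsOsgoodField

/-! ### Existence and uniqueness -/

/-- The image of `q` once every particle `x` has moved to `x + w x`. -/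
def displacedMeasure {E : Type*} [NormedAddCommGroup E] [MeasurableSpace E] (q : SignedMeasure E)
    (w : E →ᵇ E) : SignedMeasure E :=
  VectorMeasure.map q fun x => x + w x

section BoundedContinuousFunction

variable {X E : Type*} [TopologicalSpace X] [NormedAddCommGroup E] [NormedSpace ℝ E]

theorem hasDerivAt_boundedContinuousFunction_apply {W : ℝ → X →ᵇ E} {W' : X →ᵇ E} {t : ℝ}
    (hW : HasDerivAt W W' t) (x : X) : HasDerivAt (fun s => W s x) (W' x) t :=
  (BoundedContinuousFunction.evalCLM (β := E) ℝ x).hasFDerivAt.comp_hasDerivAt t hW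

theorem hasDerivAt_of_forall_hasDerivAt_apply [CompleteSpace E] {W F : ℝ → X →ᵇ E}
    (hF : Continuous F) (h : ∀ t x, HasDerivAt (fun s => W s x) (F t x) t) (t : ℝ) :
    HasDerivAt W (F t) t := by
  have hprim (t : ℝ) : HasDerivAt (fun t => ∫ s in (0 : ℝ)..t, F s) (F t) t :=
    (hF.integral_hasStrictDerivAt 0 t).hasDerivAt
  have hdiff (x : X) (t : ℝ) :
      HasDerivAt (fun t => W t x - (∫ s in (0 : ℝ)..t, F s) x) 0 t :=
    ((h t x).fun_sub (hasDerivAt_boundedContinuousFunction_apply (hprim t) x)).congr_deriv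
      (sub_self _)
  have hW : W = fun t => W 0 + ∫ s in (0 : ℝ)..t, F s := by
    ext t x
    have := is_const_of_deriv_eq_zero (fun t => (hdiff x t).differentiableAt)
      (fun t => (hdiff x t).deriv) t 0
    rw [intervalIntegral.integral_same] at this
    simpa [sub_eq_iff_eq_add] using this
  rw [hW]
  exact (hprim t).const_add (W 0)

end BoundedContinuousFunction

namespace IsOsgoodField

variable {E : Type*} [NormedAddCommGroup E] [NormedSpace ℝ E] [CompleteSpace E] {v : ℝ → E → E}

/-- The displacement at time `t` of the particles following `v` from time `0`. -/
def displacement (hv : IsOsgoodField v) (t : ℝ) : E →ᵇ E :=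
  BoundedContinuousFunction.ofNormedAddCommGroup (fun x => hv.flow 0 t x - x)
    ((hv.continuous_flow_right 0 t).sub continuous_id)
    ((hv.exists_logLipOn |t|).choose * |t - 0|) fun x => by
      obtain ⟨-, -, hM⟩ := (hv.exists_logLipOn |t|).choose_spec
      have := hv.norm_flow_sub_flow_le hM 0 (s := 0) (abs_le.1 (by simp)) (abs_le.1 le_rfl) x
      rwa [hv.flow_self] at this

theorem add_displacement (hv : IsOsgoodField v) (t : ℝ) (x : E) :
    x + hv.displacement t x = hv.flow 0 t x :=
  add_sub_cancel x _

theorem displacement_zero (hv : IsOsgoodField v) : hv.displacement 0 = 0 := by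
  ext x
  exact sub_eq_zero.2 (hv.flow_self 0 x)

theorem continuous_displacement (hv : IsOsgoodField v) : Continuous hv.displacement := by
  refine continuous_iff_continuousAt.2 fun t₀ => ?_
  obtain ⟨M, hM, -, hb⟩ := hv.exists_logLipOn (|t₀| + 1)
  have hmem : Icc (-(|t₀| + 1)) (|t₀| + 1) ∈ 𝓝 t₀ :=
    Icc_mem_nhds (by linarith [neg_abs_le t₀]) (by linarith [le_abs_self t₀])
  have hlim : Tendsto (fun t => M * |t - t₀|) (𝓝 t₀) (𝓝 0) :=
    Continuous.tendsto' (by fun_prop) t₀ 0 (by simp)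
  refine tendsto_iff_norm_sub_tendsto_zero.2 (squeeze_zero' (.of_forall fun _ => norm_nonneg _) ?_
    hlim)
  filter_upwards [hmem] with t ht
  refine (BoundedContinuousFunction.norm_le (by positivity)).2 fun x => ?_
  refine le_of_eq_of_le (congrArg norm ?_)
    (hv.norm_flow_sub_flow_le hb 0 (mem_of_mem_nhds hmem) ht x)
  exact sub_sub_sub_cancel_right _ _ x

end IsOsgoodField

section Displacement

variable {E : Type*} [NormedAddCommGroup E] [MeasurableSpace E]

theorem displacedMeasure_zero (q : SignedMeasure E) : displacedMeasure q 0 = q := by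
  simp only [displacedMeasure, BoundedContinuousFunction.coe_zero, Pi.zero_apply, add_zero]
  exact VectorMeasure.map_id q

variable [BorelSpace E]

theorem continuous_vintegral_displacedMeasure (q : SignedMeasure E) {W : ℝ → E →ᵇ E}
    (hW : Continuous W) (f : E →ᵇ ℝ) :
    Continuous fun t => ∫ᵛ x, f x ∂<•(displacedMeasure q (W t)) :=
  continuous_vintegral_map q (fun t => continuous_id.add (W t).continuous)
    (fun x => continuous_const.add ((continuous_eval_const x).comp hW)) f

theorem isWeakStarContinuous_displacedMeasure (q : SignedMeasure E) {W : ℝ → E →ᵇ E}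
    (hW : Continuous W) : IsWeakStarContinuous fun t => displacedMeasure q (W t) :=
  fun f => continuous_vintegral_displacedMeasure q hW f.toBCF

variable [NormedSpace ℝ E] [FiniteDimensional ℝ E] {k : E → E} {q : SignedMeasure E}
  {W : ℝ → E →ᵇ E}

namespace IsKernel

theorem velocity_displacedMeasure (hk : IsKernel k) (q : SignedMeasure E) (w : E →ᵇ E) :
    velocity k (displacedMeasure q w) = hk.displacedField q w :=
  funext fun x => hk.velocity_map q (continuous_id.add w.continuous) x

theorem isIntegralCurve_add_displacement (hk : IsKernel k)
    (hW : IsIntegralCurve W fun _ w => hk.particleField q w) (x : E) :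
    IsIntegralCurve (fun t => x + W t x) fun t => velocity k (displacedMeasure q (W t)) :=
  fun t => by
    simp only [hk.velocity_displacedMeasure]
    exact (hasDerivAt_boundedContinuousFunction_apply (hW t) x).const_add x

theorem isTransportSolution_displacedMeasure (hk : IsKernel k)
    (hW : IsIntegralCurve W fun _ w => hk.particleField q w) :
    IsTransportSolution (fun t => velocity k (displacedMeasure q (W t)))
      fun t => displacedMeasure q (W t) :=
  isTransportSolution_map q (fun t => continuous_id.add (W t).continuous)
    (hk.continuous_velocity (isWeakStarContinuous_displacedMeasure q hW.continuous))
    (hk.isIntegralCurve_add_displacement hW)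

theorem flow_velocity_displacedMeasure (hk : IsKernel k) (hW0 : W 0 = 0)
    (hW : IsIntegralCurve W fun _ w => hk.particleField q w)
    (hv : IsOsgoodField fun t => velocity k (displacedMeasure q (W t))) (t : ℝ) (x : E) :
    hv.flow 0 t x = x + W t x := by
  simpa [hW0] using hv.flow_eq (hk.isIntegralCurve_add_displacement hW x) 0 t

end IsKernel

namespace IsOsgoodKernel

variable {μ : Measure E} [μ.IsAddHaarMeasure] {p : ℝ → SignedMeasure E}

theorem eq_displacedMeasure_displacement (hk : IsOsgoodKernel μ k) (hp : IsWeakStarContinuous p)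
    (h : IsTransportSolution (fun t => velocity k (p t)) p) (t : ℝ) :
    p t = displacedMeasure (p 0) ((hk.isOsgoodField_velocity hp).displacement t) := by
  simp only [displacedMeasure, IsOsgoodField.add_displacement]
  exact (hk.isOsgoodField_velocity hp).eq_map_flow (hk.measurePreserving_flow hp 0)
    (fun t => hk.isWeaklyDivFree_velocity hk.isWeaklyDivFree (p t)) hp h t

theorem isIntegralCurve_displacement (hk : IsOsgoodKernel μ k) (hp : IsWeakStarContinuous p)
    (h : IsTransportSolution (fun t => velocity k (p t)) p) :
    IsIntegralCurve (hk.isOsgoodField_velocity hp).displacement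
      fun _ w => hk.particleField (p 0) w := by
  set hv := hk.isOsgoodField_velocity hp
  refine hasDerivAt_of_forall_hasDerivAt_apply
    ((hk.continuous_particleField (p 0)).comp hv.continuous_displacement) fun t x => ?_
  refine ((hv.isIntegralCurve_flow 0 x t).sub_const x).congr_deriv ?_
  simp only [← hv.add_displacement]
  rw [hk.eq_displacedMeasure_displacement hp h t,
    hk.velocity_displacedMeasure]
  rfl

theorem displacement_eq (hk : IsOsgoodKernel μ k) (hp : IsWeakStarContinuous p)
    (h : IsTransportSolution (fun t => velocity k (p t)) p) (hW0 : W 0 = 0)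
    (hW : IsIntegralCurve W fun _ w => hk.particleField (p 0) w) :
    (hk.isOsgoodField_velocity hp).displacement = W :=
  (hk.isOsgoodField_particleField (p 0)).integralCurve_unique
    (hk.isIntegralCurve_displacement hp h) hW (t₀ := 0) <| by
      rw [IsOsgoodField.displacement_zero, hW0]

end IsOsgoodKernel

end Displacement

theorem coAdjoint_displacedMeasure {η : MeasurePreservingHomeo} {w : Plane →ᵇ Plane}
    (hη : ∀ x, η.1 x = x + w x) (q : RadonMeasure) : coAdjoint η (displacedMeasure q w) = q := by
  have hη' : Measurable η.1 := η.1.continuous.measurable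
  have hsymm : Measurable η.1.symm := η.1.symm.continuous.measurable
  ext A hA
  rw [coAdjoint, displacedMeasure, ← funext hη, VectorMeasure.map_apply _ hsymm hA,
    VectorMeasure.map_apply _ hη' (hsymm hA), ← preimage_comp, Homeomorph.symm_comp_self,
    preimage_id]

section Displacement

variable {α : ℝ} {q₀ : RadonMeasure} {W : ℝ → Plane →ᵇ Plane}

theorem exists_measurePreservingHomeo_displacement {k : Plane → Plane}
    (hk : IsOsgoodKernel volume k) (hW0 : W 0 = 0)
    (hW : IsIntegralCurve W fun _ w => hk.particleField q₀ w) :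
    ∃ η : ℝ → MeasurePreservingHomeo, ∀ t x, (η t).1 x = x + W t x := by
  have hq := isWeakStarContinuous_displacedMeasure q₀ hW.continuous
  exact ⟨fun t => ⟨(hk.isOsgoodField_velocity hq).flowHomeo 0 t, hk.measurePreserving_flow hq 0 t⟩,
    hk.flow_velocity_displacedMeasure hW0 hW (hk.isOsgoodField_velocity hq)⟩

theorem isWeakSolution_displacement (hk : IsKernel (blobKernel α)) (hW0 : W 0 = 0)
    (hW : IsIntegralCurve W fun _ w => hk.particleField q₀ w) :
    IsWeakSolution α q₀ (fun t x => x + W t x) (fun t => hk.displacedField q₀ (W t))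
      fun t => displacedMeasure q₀ (W t) := by
  simp only [← hk.velocity_displacedMeasure]
  exact
    { continuous_weakStar := isWeakStarContinuous_displacedMeasure q₀ hW.continuous
      initial := by rw [hW0, displacedMeasure_zero]
      velocity := fun _ _ => rfl
      transport := hk.isTransportSolution_displacedMeasure hW
      flow_initial := fun x => by simp [hW0]
      flow := fun t x => hk.isIntegralCurve_add_displacement hW x t }

theorem IsWeakSolution.eq_displacement {η u : ℝ → Plane → Plane} {q : ℝ → RadonMeasure}
    (h : IsWeakSolution α q₀ η u q) (hk : IsOsgoodKernel volume (blobKernel α)) (hW0 : W 0 = 0)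
    (hW : IsIntegralCurve W fun _ w => hk.particleField q₀ w) :
    (∀ t x, η t x = x + W t x) ∧ (∀ t x, u t x = hk.displacedField q₀ (W t) x) ∧
      ∀ t, q t = displacedMeasure q₀ (W t) := by
  obtain ⟨hq, rfl, hu, htransport, hη0, hη⟩ := h
  obtain rfl : u = fun t => EulerAlpha.velocity (blobKernel α) (q t) := funext₂ hu
  set hv := hk.isOsgoodField_velocity hq
  have hvW : hv.displacement = W := hk.displacement_eq hq htransport hW0 hW
  have hqW (t : ℝ) : q t = displacedMeasure (q 0) (W t) :=
    hvW ▸ hk.eq_displacedMeasure_displacement hq htransport t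
  refine ⟨fun t x => ?_, fun t x => ?_, hqW⟩
  · rw [← hvW, hv.add_displacement, ← hv.flow_eq (fun s => hη s x) 0 t, hη0]
  · simp only [← hk.velocity_displacedMeasure, ← hqW]

theorem isC1Curve_of_isIntegralCurve {η : ℝ → MeasurePreservingHomeo}
    {F : (Plane →ᵇ Plane) → Plane →ᵇ Plane} (hF : Continuous F) (hW0 : W 0 = 0)
    (hW : IsIntegralCurve W fun _ => F) (hη : ∀ t x, (η t).1 x = x + W t x) : IsC1Curve η := by
  refine ⟨W, contDiff_one_iff_deriv.2 ⟨fun t => (hW t).differentiableAt, ?_⟩, fun t x => ?_⟩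
  · rw [show deriv W = fun t => F (W t) from funext fun t => (hW t).deriv]
    exact hF.comp hW.continuous
  · rw [hη, hη 0, hW0, BoundedContinuousFunction.coe_zero, Pi.zero_apply, add_zero]

end Displacement

end EulerAlpha

end

theorem mainTheorem1 (α : ℝ) (hα : 0 < α) (q₀ : RadonMeasure) :
    ∃ (η : ℝ → MeasurePreservingHomeo) (u : ℝ → BoundedContinuousFunction Plane Plane)
      (q : ℝ → RadonMeasure),
      IsWeakSolution α q₀ (fun t => (η t).1) (fun t => u t) q ∧
      IsC1Curve η ∧
      (Continuous u ∧ ∀ t, IsDivergenceFree (u t)) ∧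
      IsWeaklyContinuous q ∧
      (∀ (η' : ℝ → Plane → Plane) (u' : ℝ → Plane → Plane) (q' : ℝ → RadonMeasure),
        IsWeakSolution α q₀ η' u' q' →
          (∀ t x, η' t x = (η t).1 x) ∧ (∀ t x, u' t x = u t x) ∧ ∀ t, q' t = q t) ∧
      (∀ t, coAdjoint (η t) (q t) = q₀) ∧
      (∀ φ : ℝ × Plane → ℝ, IsTestFunction φ → weakCoadjoint (fun t => u t) q φ = 0) := by
  have hk := isOsgoodKernel_blobKernel hα
  obtain ⟨W, hW0, hW⟩ := (hk.isOsgoodField_particleField q₀).exists_isIntegralCurve 0 0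
  obtain ⟨η, hη⟩ := exists_measurePreservingHomeo_displacement hk hW0 hW
  have hsol := isWeakSolution_displacement hk.toIsKernel hW0 hW
  refine ⟨η, fun t => hk.displacedField q₀ (W t), fun t => displacedMeasure q₀ (W t), ?_,
    isC1Curve_of_isIntegralCurve (hk.continuous_particleField q₀) hW0 hW hη,
    ⟨(hk.continuous_displacedField q₀).comp hW.continuous, fun t => ?_⟩,
    continuous_vintegral_displacedMeasure q₀ hW.continuous, fun η' u' q' h' => ?_,
    fun t => coAdjoint_displacedMeasure (hη t) q₀, hsol.transport⟩
  · simpa only [← hη] using hsol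
  · rw [← hk.velocity_displacedMeasure]
    exact (hk.isWeaklyDivFree_velocity hk.isWeaklyDivFree _).isDivergenceFree
  · simpa only [hη] using h'.eq_displacement hk hW0 hW
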